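/- Let $p$ be a prime number, $e\ge 1$ an integer and $q=p^e$. Let $X$ be a Noetherian regular $\mathbf F_p$-scheme whose absolute Frobenius $F_p\colon X\to X$ is finite, and let $F_q\colon X\to X$ be the $q$-th Frobenius endomorphism (the identity on the underlying space, $a\mapsto a^q$ on $\mathcal O_X$). Put $\Omega^1_X=\Omega^1_{X/\mathbf Z}$ (a locally free $\mathcal O_X$-module of finite rank), let $\omega_X=\bigwedge^{\mathrm{rk}\,\Omega^1_X}\Omega^1_X$ be its top exterior power, where $\mathrm{rk}\,\Omega_X^1$ is the locally constant rank function, and let $\omega_X^{\otimes(1-q)}=\mathcal Hom_{\mathcal O_X}(\omega_X^{\otimes(q-1)},\mathcal O_X)$. Let $\mathcal C^{(1)}_X=\mathcal Hom_{\mathcal O_X}(F_{q*}\mathcal O_X,\mathcal O_X)$, regarded as an $\mathcal O_X$-module via $(a\cdot\phi)(b)=\phi(ab)$. (1) There is a canonical isomorphism of $\mathcal O_X$-modules $\Phi\colon\omega_X^{\otimes(1-q)}\xrightarrow{\ \cong\ }\mathcal C^{(1)}_X$. It is the unique isomorphism with the following property: for every open $U\subset X$ on which $\Omega^1_X$ has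 constant rank $n$, all $g_1,\dots,g_n\in\mathcal O_X(U)$ and every section $\delta$ of $\omega_X^{\otimes(1-q)}$ over $U$ with image $C=\Phi(\delta)$, the value of $\delta$ at $(dg_1\wedge\cdots\wedge dg_n)^{\otimes(q-1)}$ is the image of $$\Bigl(\prod_{i=1}^n(1\otimes g_i-g_i\otimes1)\Bigr)^{q-1}$$ under the additive map $\mathcal O_X(U)\otimes_{\mathbf Z}\mathcal O_X(U)\to\mathcal O_X(U)$, $x\otimes y\mapsto x\,C(y)^q$. (2) Consequently, for all $\mathcal O_X$-modules $M$ and $N$ there is a bijection, functorial in $M$ and $N$ and depending on no choice, $$\mathrm{Hom}_{\mathcal O_X}\bigl(F_{q*}(M\otimes_{\mathcal O_X}\omega_X),\,N\otimes_{\mathcal O_X}\omega_X\bigr)\ \cong\ \mathrm{Hom}_{\mathcal O_X}(M,F_q^*N).$$ This family of bijections is the unique one with the following property: if $C$ corresponds to $\theta$ and $\theta(m)=\sum_j a_j\cdot(1\otimes n_j)$ for a local section $m$ of $M$, then $$C\bigl(m\otimes\delta(w^{\otimes(q-1)})\,w\bigr)=\sum_j n_j\otimes\Phi(\delta)(a_j)\,w$$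 for all local sections $w$ of $\omega_X$ and $\delta$ of $\omega_X^{\otimes(1-q)}$. -/

import Mathlib

open CategoryTheory AlgebraicGeometry TopologicalSpace Opposite

universe u

noncomputable section

namespace FrobTwist

open MonoidalCategory TensorProduct

/-! ### Frobenius -/


/-- `X` is an `𝔽_p`-scheme: it has a (necessarily unique) morphism to `Spec 𝔽_p`. -/
class IsFpScheme (p : ℕ) (X : Scheme.{u}) : Prop where
  nonempty_hom : Nonempty (X ⟶ Spec (CommRingCat.of (ULift.{u} (ZMod p))))

theorem natCast_eq_zero (p : ℕ) (X : Scheme.{u}) [h : IsFpScheme p X] (U : X.Opens) :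
    (p : Γ(X, U)) = 0 := by
  obtain ⟨f⟩ := h.nonempty_hom
  have φ : ULift.{u} (ZMod p) →+* Γ(X, U) :=
    (X.presheaf.map (homOfLE (le_top : U ≤ ⊤)).op).hom.comp
      ((f.appTop).hom.comp (Scheme.ΓSpecIso (CommRingCat.of (ULift.{u} (ZMod p)))).inv.hom)
  have h0 : ((p : ℕ) : ULift.{u} (ZMod p)) = 0 := by
    apply ULift.down_injective
    simp
  rw [← map_natCast φ, h0, map_zero]

theorem add_pow_of_natCast_eq_zero {p : ℕ} [Fact p.Prime] {R : Type*} [CommRing R]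
    (hR : (p : R) = 0) (e : ℕ) (x y : R) : (x + y) ^ p ^ e = x ^ p ^ e + y ^ p ^ e := by
  cases subsingleton_or_nontrivial R
  · exact Subsingleton.elim _ _
  · have : CharP R p := (CharP.charP_iff_prime_eq_zero (Fact.out : p.Prime)).2 hR
    exact add_pow_char_pow x y p e

/-- The `p ^ e`-th power map of a ring in which `p = 0`. -/
def powHom {p : ℕ} [Fact p.Prime] {R : Type*} [CommRing R] (hR : (p : R) = 0) (e : ℕ) :
    R →+* R where
  toFun x := x ^ p ^ e
  map_one' := one_pow _
  map_mul' x y := mul_pow x y _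
  map_zero' := zero_pow (pow_ne_zero _ (Fact.out : p.Prime).ne_zero)
  map_add' x y := add_pow_of_natCast_eq_zero hR e x y

/-- The `p ^ e`-th Frobenius as a morphism of presheafed spaces. -/
def frobPre (p : ℕ) [Fact p.Prime] (e : ℕ) (X : Scheme.{u}) [IsFpScheme p X] :
    X.toPresheafedSpace.Hom X.toPresheafedSpace where
  base := 𝟙 _
  c := { app := fun U ↦ CommRingCat.ofHom (powHom (natCast_eq_zero p X U.unop) e)
         naturality := fun U V i ↦ by
          ext x
          exact (map_pow (X.presheaf.map i).hom x _).symm }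

theorem frobPre_isLocalHom (p : ℕ) [Fact p.Prime] (e : ℕ) (X : Scheme.{u}) [IsFpScheme p X]
    (x : X) :
    IsLocalHom ((frobPre p e X).stalkMap x).hom := by
  constructor
  intro a ha
  obtain ⟨U, hx, s, rfl⟩ := X.presheaf.exists_germ_eq a
  have h : ((frobPre p e X).stalkMap x).hom (X.presheaf.germ U x hx s) =
      (X.presheaf.germ U x hx s) ^ p ^ e := by
    refine (PresheafedSpace.stalkMap_germ_apply (frobPre p e X) U x hx s).trans ?_
    exact map_pow (X.presheaf.germ U x hx).hom s _
  erw [h] at ha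
  exact (isUnit_pow_iff (pow_ne_zero _ (Fact.out : p.Prime).ne_zero)).1 ha

/-- The Frobenius endomorphism `F_q : X ⟶ X`, `q = p ^ e`, of an `𝔽_p`-scheme: the identity on the
underlying space and `a ↦ a ^ q` on sections. -/
def frob (p : ℕ) [Fact p.Prime] (e : ℕ) (X : Scheme.{u}) [IsFpScheme p X] : X ⟶ X where
  toHom := frobPre p e X
  prop := frobPre_isLocalHom p e X

theorem frob_app_apply (p : ℕ) [Fact p.Prime] (e : ℕ) (X : Scheme.{u}) [IsFpScheme p X]
    (U : X.Opens) (a : Γ(X, U)) : (frob p e X).app U a = (a ^ p ^ e : Γ(X, U)) := rfl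

/-! ### Sheaves of modules: associated sheaf, tensor products, ranks -/

/-- The sheaf of `𝒪_X`-modules associated with a presheaf of `𝒪_X`-modules. -/
def assocSheaf (X : Scheme.{u}) : X.PresheafOfModules ⥤ X.Modules :=
  PresheafOfModules.sheafification (𝟙 X.ringCatSheaf.obj)

/-- The section of the associated sheaf defined by a section of a presheaf of modules. -/
def toAssocSheaf {X : Scheme.{u}} (P : X.PresheafOfModules) (U : X.Opens) (s : P.obj (op U)) :
    Γ((assocSheaf X).obj P, U) :=
  ((PresheafOfModules.sheafificationAdjunction (𝟙 X.ringCatSheaf.obj)).unit.app P).app (op U) s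

/-- Presheaves of `𝒪_X`-modules (definitionally `X.PresheafOfModules`), written so that the
commutativity of the rings `Γ(X, U)` is visible. -/
abbrev PreMod (X : Scheme.{u}) :=
  PresheafOfModules.{u} (X.presheaf ⋙ forget₂ CommRingCat RingCat)
/-- The functor `M ↦ M ⊗ L` on `𝒪_X`-modules: the sheaf associated with
`U ↦ Γ(M, U) ⊗ Γ(L, U)`. -/
def tensorBy {X : Scheme.{u}} (L : X.Modules) : X.Modules ⥤ X.Modules :=
  Scheme.Modules.toPresheafOfModules X ⋙
   MonoidalCategory.tensorRight (C := PreMod X) L.val ⋙ assocSheaf X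

/-- `𝒪_X` as a module over itself. -/
def structureModule (X : Scheme.{u}) : X.Modules := SheafOfModules.unit X.ringCatSheaf

/-- The section `m ⊗ l` of `M ⊗ L`. -/
def tmul {X : Scheme.{u}} {M L : X.Modules} {U : X.Opens} (m : Γ(M, U)) (l : Γ(L, U)) :
    Γ((tensorBy L).obj M, U) :=
  toAssocSheaf (MonoidalCategory.tensorObj (C := PreMod X) M.val L.val) U
   ((m : M.val.obj (op U)) ⊗ₜ[Γ(X, U)] (l : L.val.obj (op U)))

/-- The tensor power `L ^ ⊗n`. -/
def tpow {X : Scheme.{u}} (L : X.Modules) : ℕ → X.Modules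
  | 0 => structureModule X
  | n + 1 => (tensorBy L).obj (tpow L n)

/-- The section `l ^ ⊗n` of `L ^ ⊗n`. -/
def secPow {X : Scheme.{u}} {L : X.Modules} {U : X.Opens} (l : Γ(L, U)) :
    (n : ℕ) → Γ(tpow L n, U)
  | 0 => (1 : Γ(X, U))
  | n + 1 => tmul (secPow l n) l

/-- The rank over `𝒪_{X,x}` of the stalk at `x` of a presheaf of modules. -/
def preRankAt {X : Scheme.{u}} (P : PreMod X) (x : X) : ℕ :=
  Module.finrank (X.presheaf.stalk x) (TopCat.Presheaf.stalk P.presheaf x : Ab)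

/-- The rank of an `𝒪_X`-module at `x`: the rank of its stalk. -/
def rankAt {X : Scheme.{u}} (M : X.Modules) (x : X) : ℕ := preRankAt M.val x

/-! ### Differentials and the top exterior power -/

/-- The morphism from the constant presheaf `ℤ` to the structure sheaf. -/
def fromZ (X : Scheme.{u}) :
    (Functor.const (Opens X)ᵒᵖ).obj (CommRingCat.of (ULift.{u} ℤ)) ⟶ X.presheaf where
  app U := CommRingCat.ofHom ((Int.castRingHom _).comp ULift.ringEquiv.toRingHom)
  naturality U V i := by ext x; simp

/-- The presheaf `U ↦ Ω¹_{Γ(X, U)/ℤ}`. -/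
def preOmega (X : Scheme.{u}) : PreMod X :=
  PresheafOfModules.DifferentialsConstruction.relativeDifferentials' (fromZ X)

/-- The sheaf of absolute Kähler differentials `Ω¹_X = Ω¹_{X/ℤ}`. -/
def Omega (X : Scheme.{u}) : X.Modules := (assocSheaf X).obj (preOmega X)

/-- The section `dg` of `Ω¹_X`. -/
def differential {X : Scheme.{u}} {U : X.Opens} (g : Γ(X, U)) : Γ(Omega X, U) :=
  toAssocSheaf (preOmega X) U (CommRingCat.KaehlerDifferential.d (f := (fromZ X).app (op U)) g)

/-- The map induced on exterior powers by a semilinear map. -/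
def extMap {R S M N : Type*} [CommRing R] [CommRing S] [AddCommGroup M] [AddCommGroup N]
    [Module R M] [Module S N] {σ : R →+* S} (g : M →ₛₗ[σ] N) (n : ℕ) :
    ⋀[R]^n M →ₛₗ[σ] ⋀[S]^n N :=
  letI := Module.compHom (⋀[S]^n N) σ
  let a : M [⋀^Fin n]→ₗ[R] ⋀[S]^n N :=
    { toFun := fun m ↦ exteriorPower.ιMulti S n (fun i ↦ g (m i))
      map_update_add' := fun m i x y ↦ by
        have h (z : M) : (fun j ↦ g (Function.update m i z j)) =
            Function.update (fun j ↦ g (m j)) i (g z) := by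
          ext j
          by_cases hj : j = i
          · subst hj; simp
          · simp [hj]
        simp only [h, map_add, AlternatingMap.map_update_add]
      map_update_smul' := fun m i c x ↦ by
        have h (z : M) : (fun j ↦ g (Function.update m i z j)) =
            Function.update (fun j ↦ g (m j)) i (g z) := by
          ext j
          by_cases hj : j = i
          · subst hj; simp
          · simp [hj]
        simp only [h, map_smulₛₗ, AlternatingMap.map_update_smul]
        rfl
      map_eq_zero_of_eq' := fun m i j h hij ↦
        (exteriorPower.ιMulti S n).map_eq_zero_of_eq _ (congrArg g h) hij }
  { toFun := exteriorPower.alternatingMapLinearEquiv a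
    map_add' := map_add _
    map_smul' := fun r x ↦ (exteriorPower.alternatingMapLinearEquiv a).map_smul r x }

theorem extMap_ιMulti {R S M N : Type*} [CommRing R] [CommRing S] [AddCommGroup M] [AddCommGroup N]
    [Module R M] [Module S N] {σ : R →+* S} (g : M →ₛₗ[σ] N) (n : ℕ) (m : Fin n → M) :
    extMap g n (exteriorPower.ιMulti R n m) = exteriorPower.ιMulti S n (fun i ↦ g (m i)) := by
  let := Module.compHom (⋀[S]^n N) σ
  exact exteriorPower.alternatingMapLinearEquiv_apply_ιMulti _ m

theorem ext_induction {R M : Type*} [CommRing R] [AddCommGroup M] [Module R M] {n : ℕ}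
    {P : ⋀[R]^n M → Prop} (hι : ∀ m, P (exteriorPower.ιMulti R n m))
    (hadd : ∀ x y, P x → P y → P (x + y)) (hs : ∀ (r : R) x, P x → P (r • x))
    (x : ⋀[R]^n M) : P x := by
  have hx : x ∈ Submodule.span R (Set.range (exteriorPower.ιMulti R n (M := M))) := by
    rw [exteriorPower.ιMulti_span]; trivial
  induction hx using Submodule.span_induction with
  | mem x h => obtain ⟨m, rfl⟩ := h; exact hι m
  | zero => simpa using hs 0 _ (hι 0)
  | add x y _ _ hx hy => exact hadd x y hx hy
  | smul r x _ hx => exact hs r x hx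


theorem extMap_id {R M : Type*} [CommRing R] [AddCommGroup M] [Module R M] {σ : R →+* R}
    (g : M →ₛₗ[σ] M) (hσ : ∀ r, σ r = r) (hg : ∀ m, g m = m) (n : ℕ) (x : ⋀[R]^n M) :
    extMap g n x = x := by
  induction x using ext_induction with
  | hι m => rw [extMap_ιMulti]; congr 1; funext k; exact hg _
  | hadd x y hx hy => rw [map_add, hx, hy]
  | hs r x hx => rw [map_smulₛₗ, hx, hσ]

theorem extMap_comp {R S T M N K : Type*} [CommRing R] [CommRing S] [CommRing T]
    [AddCommGroup M] [Module R M] [AddCommGroup N] [Module S N] [AddCommGroup K] [Module T K]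
    {σ : R →+* S} {τ : S →+* T} {ρ : R →+* T} (g : M →ₛₗ[σ] N) (h : N →ₛₗ[τ] K) (k : M →ₛₗ[ρ] K)
    (hρ : ∀ r, ρ r = τ (σ r)) (hk : ∀ m, k m = h (g m)) (n : ℕ) (x : ⋀[R]^n M) :
    extMap k n x = extMap h n (extMap g n x) := by
  induction x using ext_induction with
  | hι m =>
    rw [extMap_ιMulti, extMap_ιMulti, extMap_ιMulti]; congr 1; funext i; exact hk _
  | hadd x y hx hy => rw [map_add, map_add, map_add, hx, hy]
  | hs r x hx => rw [map_smulₛₗ, map_smulₛₗ, map_smulₛₗ, hx, hρ]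

/-- Families `(sₙ)` with `sₙ ∈ ⋀ⁿ M` and `sₙ = 0` unless `A n`. -/
def extPart (R M : Type*) [CommRing R] [AddCommGroup M] [Module R M] (A : ℕ → Prop) :
    Submodule R (∀ n : ℕ, ⋀[R]^n M) where
  carrier := {s | ∀ n, ¬ A n → s n = 0}
  add_mem' {s t} hs ht n hn := by simp [hs n hn, ht n hn]
  zero_mem' n _ := rfl
  smul_mem' r s hs n hn := by simp [hs n hn]

/-- The map induced by a semilinear map on families as in `extPart`. -/
def extPartMap {R S M N : Type*} [CommRing R] [CommRing S] [AddCommGroup M] [AddCommGroup N]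
    [Module R M] [Module S N] {σ : R →+* S} (g : M →ₛₗ[σ] N) {A B : ℕ → Prop}
    (hAB : ∀ n, A n → B n) : extPart R M A →ₛₗ[σ] extPart S N B where
  toFun s := ⟨fun n ↦ extMap g n (s.1 n), fun n hn ↦
    (congrArg (extMap g n) (s.2 n fun h ↦ hn (hAB n h))).trans (map_zero _)⟩
  map_add' s t := by ext1; funext n; exact map_add _ _ _
  map_smul' r s := by ext1; funext n; exact map_smulₛₗ (extMap g n) _ _

/-- The restriction maps of a presheaf of modules, as semilinear maps. -/
def resₛₗ {X : Scheme.{u}} (P : PreMod X) {U V : (Opens X)ᵒᵖ} (i : U ⟶ V) :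
    P.obj U →ₛₗ[(X.presheaf.map i).hom] P.obj V where
  toFun := P.map i
  map_add' := map_add (P.map i).hom
  map_smul' r m := P.map_smul i r m

/-- The presheaf whose sheafification is the top exterior power. A section over `U` is a family of
elements of `⋀ⁿ P(U)`, `n ≥ 0`, whose `n`-th member is zero unless `P` has rank `n` at all points
of `U`. So over a nonempty `U` on which the rank is constantly `n` the sections are `⋀ⁿ P(U)`, and
over a nonempty `U` on which the rank is not constant there is only the zero section; if the rank
is locally constant, the opens of the first kind form a basis of the topology. -/
def preTopWedge {X : Scheme.{u}} (P : PreMod X) : PreMod X where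
  obj U := ModuleCat.of (X.presheaf.obj U)
    (extPart (X.presheaf.obj U) (P.obj U) fun n ↦ ∀ x ∈ U.unop, preRankAt P x = n)
  map {U V} i :=
    let r := extPartMap (resₛₗ P i) (A := fun n ↦ ∀ x ∈ U.unop, preRankAt P x = n)
      (B := fun n ↦ ∀ x ∈ V.unop, preRankAt P x = n) fun n h x hx ↦ h x (i.unop.le hx)
    ModuleCat.ofHom (Y := (ModuleCat.restrictScalars (X.presheaf.map i).hom).obj
      (ModuleCat.of (X.presheaf.obj V)
        (extPart (X.presheaf.obj V) (P.obj V) fun n ↦ ∀ x ∈ V.unop, preRankAt P x = n)))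
    { toFun := r
      map_add' := map_add r
      map_smul' := fun a s ↦ map_smulₛₗ r a s }
  map_id U := by
    ext s
    refine Subtype.ext (funext fun n ↦ ?_)
    exact extMap_id (resₛₗ P (𝟙 U)) (fun r ↦ by simp)
      (fun m ↦ congrArg (fun φ ↦ φ.hom m) (P.map_id U)) n (s.1 n)
  map_comp {U V W} i j := by
    ext s
    refine Subtype.ext (funext fun n ↦ ?_)
    exact extMap_comp (resₛₗ P i) (resₛₗ P j) (resₛₗ P (i ≫ j)) (fun r ↦ by simp)
      (fun m ↦ P.map_comp_apply i j m) n (s.1 n)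

/-- The section `m₁ ∧ ⋯ ∧ mₙ` of `preTopWedge`, over an open set where the rank is `n`. -/
def preWedge {X : Scheme.{u}} (P : PreMod X) {U : X.Opens} {n : ℕ}
    (hn : ∀ x ∈ U, preRankAt P x = n) (m : Fin n → P.obj (op U)) : (preTopWedge P).obj (op U) :=
  (⟨Pi.single n (exteriorPower.ιMulti (X.presheaf.obj (op U)) n m), fun k hk ↦
    Pi.single_eq_of_ne (by rintro rfl; exact hk hn) _⟩ :
    extPart (X.presheaf.obj (op U)) (P.obj (op U)) fun n ↦ ∀ x ∈ U, preRankAt P x = n)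

/-- The top exterior power `⋀^{rk M} M` of an `𝒪_X`-module `M` of locally constant rank `rk M`. -/
def topExterior {X : Scheme.{u}} (M : X.Modules) : X.Modules :=
  (assocSheaf X).obj (preTopWedge (X := X) M.val)

/-- The section `m₁ ∧ ⋯ ∧ mₙ` of the top exterior power, over an open set where the rank is `n`. -/
def wedge {X : Scheme.{u}} {M : X.Modules} {U : X.Opens} {n : ℕ} (hn : ∀ x ∈ U, rankAt M x = n)
    (m : Fin n → Γ(M, U)) : Γ(topExterior M, U) :=
  toAssocSheaf (preTopWedge (X := X) M.val) U (preWedge (X := X) M.val hn m)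

/-- `ω_X`, the top exterior power of `Ω¹_X`. -/
def omega (X : Scheme.{u}) : X.Modules := topExterior (Omega X)

/-! ### Sheaves of homomorphisms -/

/-- The endomorphism `f` of `X` does not move open subsets. -/
class IsIdOnOpens {X : Scheme.{u}} (f : X ⟶ X) : Prop where
  preimage_eq : ∀ V : X.Opens, f ⁻¹ᵁ V = V

instance (X : Scheme.{u}) : IsIdOnOpens (𝟙 X) := ⟨fun _ ↦ rfl⟩
instance (p : ℕ) [Fact p.Prime] (e : ℕ) (X : Scheme.{u}) [IsFpScheme p X] :
    IsIdOnOpens (frob p e X) := ⟨fun _ ↦ rfl⟩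

/-- The sections over `U` of the sheaf `ℋom_{𝒪_X}(f_* M, N)`, i.e. the morphisms of `𝒪_U`-modules
`(f_* M)|_U ⟶ N|_U`: compatible families of `Γ(X, V)`-linear maps `Γ(f_* M, V) → Γ(N, V)`, for
`V ≤ U` open. -/
@[ext]
structure HomSections {X : Scheme.{u}} (f : X ⟶ X) (M N : X.Modules) (U : X.Opens) where
  app (V : X.Opens) (hV : V ≤ U) :
    Γ((Scheme.Modules.pushforward f).obj M, V) →ₗ[Γ(X, V)] Γ(N, V)
  naturality (V W : X.Opens) (hV : V ≤ U) (hW : W ≤ V)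
    (m : Γ((Scheme.Modules.pushforward f).obj M, V)) :
    N.presheaf.map (homOfLE hW).op (app V hV m) =
      app W (hW.trans hV) (((Scheme.Modules.pushforward f).obj M).presheaf.map (homOfLE hW).op m)

namespace HomSections
variable {X : Scheme.{u}} {f : X ⟶ X} {M N : X.Modules} {U : X.Opens}

instance : Zero (HomSections f M N U) := ⟨⟨fun _ _ ↦ 0, fun _ _ _ _ _ ↦ map_zero _⟩⟩
instance : Add (HomSections f M N U) := ⟨fun φ ψ ↦ ⟨fun V h ↦ φ.app V h + ψ.app V h,
  fun V W hV hW m ↦ (map_add _ _ _).trans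
    (congrArg₂ (· + ·) (φ.naturality V W hV hW m) (ψ.naturality V W hV hW m))⟩⟩
instance : Neg (HomSections f M N U) := ⟨fun φ ↦ ⟨fun V h ↦ - φ.app V h,
  fun V W hV hW m ↦ (map_neg _ _).trans (congrArg (- ·) (φ.naturality V W hV hW m))⟩⟩

instance : AddCommGroup (HomSections f M N U) where
  add_assoc _ _ _ := by ext V h : 3; exact add_assoc _ _ _
  zero_add _ := by ext V h : 3; exact zero_add _
  add_zero _ := by ext V h : 3; exact add_zero _
  neg_add_cancel _ := by ext V h : 3; exact neg_add_cancel _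
  add_comm _ _ := by ext V h : 3; exact add_comm _ _
  nsmul := nsmulRec
  zsmul := zsmulRec

theorem pushforward_smul (V : X.Opens) (r : Γ(X, V))
    (m : Γ((Scheme.Modules.pushforward f).obj M, V)) :
    r • m = (show Γ(M, f ⁻¹ᵁ V) from (f.app V r) • (show Γ(M, f ⁻¹ᵁ V) from m)) := rfl

theorem preimage_le [h : IsIdOnOpens f] {V : X.Opens} (hV : V ≤ U) : f ⁻¹ᵁ V ≤ U :=
  (h.preimage_eq V).le.trans hV

/-- The action `(a • φ)(m) = φ(a m)` of `Γ(X, U)`, where `a m` is computed in `M`. -/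
def precomp [IsIdOnOpens f] (a : Γ(X, U)) (φ : HomSections f M N U) : HomSections f M N U where
  app V hV :=
    { toFun := fun m ↦ φ.app V hV (show Γ(M, f ⁻¹ᵁ V) from
        X.presheaf.map (homOfLE (preimage_le (f := f) hV)).op a • (show Γ(M, f ⁻¹ᵁ V) from m))
      map_add' := fun m m' ↦ by
        refine Eq.trans ?_ (map_add (φ.app V hV) _ _)
        exact congrArg _ (smul_add _ _ _)
      map_smul' := fun r m ↦ by
        refine Eq.trans ?_ (map_smul (φ.app V hV) _ _)
        exact congrArg _ (smul_comm (M := Γ(X, f ⁻¹ᵁ V)) (N := Γ(X, f ⁻¹ᵁ V))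
          (α := Γ(M, f ⁻¹ᵁ V)) _ _ _) }
  naturality V W hV hW m := by
    refine (φ.naturality V W hV hW _).trans ?_
    refine congrArg (φ.app W _) ?_
    refine (Scheme.Modules.map_smul M (homOfLE (f.preimage_mono hW)) _ _).trans ?_
    rw [← ConcreteCategory.comp_apply, ← X.presheaf.map_comp]
    rfl

instance [IsIdOnOpens f] : Module Γ(X, U) (HomSections f M N U) where
  smul := precomp
  one_smul φ := by
    ext V hV m
    refine congrArg (φ.app V hV) ?_
    refine (congrArg (· • (show Γ(M, f ⁻¹ᵁ V) from m)) (map_one _)).trans (one_smul _ _)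
  mul_smul a b φ := by
    ext V hV m
    refine congrArg (φ.app V hV) ?_
    rw [mul_comm]
    refine (congrArg (· • (show Γ(M, f ⁻¹ᵁ V) from m)) (map_mul _ _ _)).trans (mul_smul _ _ _)
  smul_zero a := rfl
  smul_add a φ ψ := rfl
  add_smul a b φ := by
    ext V hV m
    refine Eq.trans (congrArg (φ.app V hV) ?_) (map_add (φ.app V hV) _ _)
    refine (congrArg (· • (show Γ(M, f ⁻¹ᵁ V) from m)) (map_add _ _ _)).trans (add_smul _ _ _)
  zero_smul φ := by
    ext V hV m
    refine Eq.trans (congrArg (φ.app V hV) ?_) (map_zero (φ.app V hV))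
    refine (congrArg (· • (show Γ(M, f ⁻¹ᵁ V) from m)) (map_zero _)).trans (zero_smul _ _)

/-- Restriction to a smaller open subset. -/
def res {V : X.Opens} (h : V ≤ U) (φ : HomSections f M N U) : HomSections f M N V where
  app W hW := φ.app W (hW.trans h)
  naturality W W' hW hW' m := φ.naturality W W' (hW.trans h) hW' m

end HomSections


/-- The presheaf underlying `homSheaf`. -/
def preHom {X : Scheme.{u}} (f : X ⟶ X) [IsIdOnOpens f] (M N : X.Modules) : PreMod X where
  obj U := ModuleCat.of Γ(X, U.unop) (HomSections f M N U.unop)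
  map {U V} i := ModuleCat.ofHom (Y := (ModuleCat.restrictScalars (X.presheaf.map i).hom).obj
      (ModuleCat.of Γ(X, V.unop) (HomSections f M N V.unop)))
    { toFun := HomSections.res i.unop.le
      map_add' := fun _ _ ↦ rfl
      map_smul' := fun r φ ↦ by
        refine HomSections.ext (funext fun V ↦ funext fun hV ↦ LinearMap.ext fun m ↦ ?_)
        refine congrArg (φ.app V _) ?_
        refine congrArg (· • (show Γ(M, f ⁻¹ᵁ V) from m)) ?_
        change _ = X.presheaf.map _ (X.presheaf.map _ _)
        rw [← ConcreteCategory.comp_apply, ← X.presheaf.map_comp]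
        rfl }
  map_id U := rfl
  map_comp i j := rfl

theorem preHom_isSheaf {X : Scheme.{u}} (f : X ⟶ X) [IsIdOnOpens f] (M N : X.Modules) :
    TopCat.Presheaf.IsSheaf (PresheafOfModules.presheaf (preHom f M N)) := by
  rw [TopCat.Presheaf.isSheaf_iff_isSheafUniqueGluing]
  intro ι U sf hsf
  let FM : TopCat.Presheaf Ab X := ((Scheme.Modules.pushforward f).obj M).presheaf
  let sh : TopCat.Sheaf Ab X := ⟨N.presheaf, N.isSheaf⟩
  let φ (i : ι) : HomSections f M N (U i) := sf i
  have hφ (i j : ι) (W : X.Opens) (hi : W ≤ U i) (hj : W ≤ U j) :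
      (φ i).app W hi = (φ j).app W hj := by
    have := hsf i j
    exact congrArg (fun ψ : HomSections f M N (U i ⊓ U j) ↦ ψ.app W (le_inf hi hj)) this
  have cov {V : X.Opens} (hV : V ≤ iSup U) : V ≤ ⨆ i, V ⊓ U i := by
    rw [← inf_iSup_eq]; exact le_inf le_rfl hV
  have loc {V : X.Opens} (hV : V ≤ iSup U) (s t : Γ(N, V))
      (h : ∀ i, N.presheaf.map (homOfLE (inf_le_left : V ⊓ U i ≤ V)).op s =
        N.presheaf.map (homOfLE (inf_le_left : V ⊓ U i ≤ V)).op t) : s = t :=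
    sh.eq_of_locally_eq' (fun i ↦ V ⊓ U i) V (fun i ↦ homOfLE inf_le_left) (cov hV) s t h
  have ex (V : X.Opens) (hV : V ≤ iSup U) (m : FM.obj (op V)) : ∃ s : Γ(N, V),
      ∀ i, N.presheaf.map (homOfLE (inf_le_left : V ⊓ U i ≤ V)).op s =
        (φ i).app (V ⊓ U i) inf_le_right (FM.map (homOfLE inf_le_left).op m) := by
    refine (sh.existsUnique_gluing' (fun i ↦ V ⊓ U i) V (fun i ↦ homOfLE inf_le_left) (cov hV)
      (fun i ↦ (φ i).app (V ⊓ U i) inf_le_right (FM.map (homOfLE inf_le_left).op m)) ?_).exists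
    intro i j
    refine ((φ i).naturality _ _ _ (inf_le_left) _).trans (Eq.trans ?_
      ((φ j).naturality _ _ _ (inf_le_right) _).symm)
    rw [hφ i j]
    refine congrArg _ ?_
    change FM.map _ (FM.map _ m) = FM.map _ (FM.map _ m)
    rw [← ConcreteCategory.comp_apply, ← FM.map_comp, ← ConcreteCategory.comp_apply, ← FM.map_comp]
    rfl
  choose g hg using ex
  have glob (V : X.Opens) (hV : V ≤ iSup U) (m : FM.obj (op V)) (i : ι) (W : X.Opens) (hW : W ≤ V)
      (hWi : W ≤ U i) : N.presheaf.map (homOfLE hW).op (g V hV m) =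
        (φ i).app W hWi (FM.map (homOfLE hW).op m) := by
    have h1 := congrArg (N.presheaf.map (homOfLE (le_inf hW hWi)).op) (hg V hV m i)
    refine Eq.trans ?_ (h1.trans (((φ i).naturality _ _ inf_le_right (le_inf hW hWi) _).trans ?_))
    · rw [← ConcreteCategory.comp_apply, ← N.presheaf.map_comp]
      rfl
    · refine congrArg _ ?_
      change FM.map _ (FM.map _ m) = FM.map _ m
      rw [← ConcreteCategory.comp_apply, ← FM.map_comp]
      rfl
  let G : HomSections f M N (iSup U) :=
    { app := fun V hV ↦
        { toFun := g V hV
          map_add' := fun m m' ↦ by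
            refine loc hV _ _ fun i ↦ ?_
            refine Eq.trans ?_ (map_add _ _ _).symm
            rw [hg, hg, hg]
            refine Eq.trans ?_ (map_add _ _ _)
            exact congrArg _ (map_add (FM.map _).hom m m')
          map_smul' := fun r m ↦ by
            refine loc hV _ _ fun i ↦ ?_
            refine Eq.trans ?_ (Scheme.Modules.map_smul N _ _ _).symm
            rw [hg, hg]
            refine Eq.trans ?_ (map_smul _ _ _)
            exact congrArg _ (Scheme.Modules.map_smul ((Scheme.Modules.pushforward f).obj M) _ _ _) }
      naturality := fun V W hV hW m ↦ by
        refine loc (hW.trans hV) _ _ fun i ↦ ?_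
        refine Eq.trans ?_ (hg W _ _ i).symm
        rw [← ConcreteCategory.comp_apply, ← N.presheaf.map_comp]
        refine (glob V hV m i (W ⊓ U i) (inf_le_left.trans hW) inf_le_right).trans ?_
        refine congrArg _ ?_
        change FM.map _ m = FM.map _ (FM.map _ m)
        rw [← ConcreteCategory.comp_apply, ← FM.map_comp]
        rfl }
  refine ⟨G, ?_, ?_⟩
  · intro i
    refine HomSections.ext (funext fun V ↦ funext fun hV ↦ LinearMap.ext fun m ↦ ?_)
    have h := glob V (hV.trans (le_iSup U i)) m i V le_rfl hV
    have e1 : N.presheaf.map (homOfLE (le_refl V)).op = 𝟙 _ := N.presheaf.map_id _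
    have e2 : FM.map (homOfLE (le_refl V)).op = 𝟙 _ := FM.map_id _
    rw [e1, e2] at h
    exact h
  · intro G' hG'
    refine HomSections.ext (funext fun V ↦ funext fun hV ↦ LinearMap.ext fun m ↦ ?_)
    refine loc hV _ _ fun i ↦ ?_
    refine Eq.trans ?_ (hg V hV m i).symm
    refine (HomSections.naturality (show HomSections f M N (iSup U) from G') V _ hV
      inf_le_left m).trans ?_
    exact congrArg (fun ψ : HomSections f M N (U i) ↦ ψ.app (V ⊓ U i) inf_le_right
      (FM.map (homOfLE inf_le_left).op m)) (hG' i)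

/-- The sheaf `ℋom_{𝒪_X}(f_* M, N)`, for an endomorphism `f` of `X` that is the identity on open
subsets, as an `𝒪_X`-module through the action of `𝒪_X` on `M`: `(a • φ)(m) = φ(a m)`. For `f = 𝟙`
this is the usual internal Hom. -/
def homSheaf {X : Scheme.{u}} (f : X ⟶ X) [IsIdOnOpens f] (M N : X.Modules) : X.Modules where
  val := preHom f M N
  isSheaf := preHom_isSheaf f M N

/-- `L ^ ⊗(-n)`, the dual `ℋom(L ^ ⊗n, 𝒪_X)` of `L ^ ⊗n`. -/
def negPow {X : Scheme.{u}} (L : X.Modules) (n : ℕ) : X.Modules :=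
  homSheaf (𝟙 X) (tpow L n) (structureModule X)

/-- The value of a section of `L ^ ⊗(-n)` at a section of `L ^ ⊗n`. -/
def evalNeg {X : Scheme.{u}} {L : X.Modules} {n : ℕ} {U : X.Opens} (δ : Γ(negPow L n, U))
    (s : Γ(tpow L n, U)) : Γ(X, U) :=
  (show HomSections (𝟙 X) (tpow L n) (structureModule X) U from δ).app U le_rfl s

/-! ### The Cartier module and the canonical identifications -/

/-- `𝒞_X^{(1)} = ℋom_{𝒪_X}(F_{q*} 𝒪_X, 𝒪_X)`, `q = p ^ e`, an `𝒪_X`-module through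
`a • φ = φ(a -)`. -/
def cartier (p : ℕ) [Fact p.Prime] (e : ℕ) (X : Scheme.{u}) [IsFpScheme p X] : X.Modules :=
  homSheaf (frob p e X) (structureModule X) (structureModule X)

section

variable {p : ℕ} [Fact p.Prime] {e : ℕ} {X : Scheme.{u}} [IsFpScheme p X] {U : X.Opens}

/-- A section `C` of `𝒞_X^{(1)}` as an additive map `Γ(X, U) → Γ(X, U)`. -/
def cartierApp (C : Γ(cartier p e X, U)) : Γ(X, U) →+ Γ(X, U) :=
  ((show HomSections (frob p e X) (structureModule X) (structureModule X) U from C).app U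
    le_rfl).toAddMonoidHom

theorem cartierApp_pow_mul (C : Γ(cartier p e X, U)) (a b : Γ(X, U)) :
    cartierApp C (a ^ p ^ e * b) = a * cartierApp C b :=
  ((show HomSections (frob p e X) (structureModule X) (structureModule X) U from C).app U
    le_rfl).map_smul a b

theorem cartierApp_smul (C : Γ(cartier p e X, U)) (a b : Γ(X, U)) :
    cartierApp (a • C) b = cartierApp C (a * b) := by
  refine congrArg (cartierApp C) ?_
  exact congrArg (fun g ↦ (g a * b : Γ(X, U)))
    (congrArg (fun φ ↦ φ.hom) (X.presheaf.map_id (op U)))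

/-- The additive map `x ⊗ y ↦ x * C(y) ^ q`, `q = p ^ e`, attached to a section `C` of `𝒞_X^{(1)}`.
It factors through `Γ(X, U) ⊗ Γ(X, U)` over the subring of `q`-th powers, because
`C(a ^ q y) = a C(y)`. -/
def cartierTensor (C : Γ(cartier p e X, U)) : Γ(X, U) ⊗[ℤ] Γ(X, U) →+ Γ(X, U) :=
  (LinearMap.mul' ℤ Γ(X, U) ∘ₗ TensorProduct.map LinearMap.id
    ((powHom (natCast_eq_zero p X U) e).toAddMonoidHom.comp
      (cartierApp C)).toIntLinearMap).toAddMonoidHom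

theorem cartierTensor_tmul (C : Γ(cartier p e X, U)) (x y : Γ(X, U)) :
    cartierTensor C (x ⊗ₜ[ℤ] y) = x * cartierApp C y ^ p ^ e := rfl

/-- The element `(ξ(g₁) ⋯ ξ(gₙ)) ^ k` of `Γ(X, U) ⊗ Γ(X, U)`, where `ξ(g) = 1 ⊗ g - g ⊗ 1`. -/
def diagPow {n : ℕ} (g : Fin n → Γ(X, U)) (k : ℕ) : Γ(X, U) ⊗[ℤ] Γ(X, U) :=
  (∏ i, ((1 : Γ(X, U)) ⊗ₜ[ℤ] g i - g i ⊗ₜ[ℤ] (1 : Γ(X, U)))) ^ k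

end

/-- The normalization that singles out the canonical isomorphism `ω_X^{⊗(1-q)} ≅ 𝒞_X^{(1)}`: if
`δ ↦ C`, then for all functions `g₁, …, gₙ` on an open set where `Ω¹_X` has rank `n`, the value of
`δ` at `(dg₁ ∧ ⋯ ∧ dgₙ) ^ ⊗(q-1)` is the image of `(ξ(g₁) ⋯ ξ(gₙ)) ^ (q-1)` under
`x ⊗ y ↦ x * C(y) ^ q`. -/
def IsCanonicalIso {p : ℕ} [Fact p.Prime] {e : ℕ} {X : Scheme.{u}} [IsFpScheme p X]
    (Φ : negPow (omega X) (p ^ e - 1) ≅ cartier p e X) : Prop :=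
  ∀ (U : X.Opens) (n : ℕ) (hn : ∀ x ∈ U, rankAt (Omega X) x = n) (g : Fin n → Γ(X, U))
    (δ : Γ(negPow (omega X) (p ^ e - 1), U)),
    evalNeg δ (secPow (wedge hn fun i ↦ differential (g i)) (p ^ e - 1)) =
      cartierTensor (Φ.hom.app U δ) (diagPow g (p ^ e - 1))

/-- The section `1 ⊗ n` of `f^* N` over `f ⁻¹ᵁ U` defined by a section `n` of `N` over `U`. -/
def pullbackSection {X : Scheme.{u}} (f : X ⟶ X) {N : X.Modules} {U : X.Opens} (n : Γ(N, U)) :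
    Γ((Scheme.Modules.pullback f).obj N, f ⁻¹ᵁ U) :=
  ((Scheme.Modules.pullbackPushforwardAdjunction f).unit.app N).app U n

/-- Families of bijections `Hom(F_{q*}(M ⊗ ω_X), N ⊗ ω_X) ≃ Hom(M, F_q^* N)`, for all
`𝒪_X`-modules `M` and `N`. -/
abbrev HomBijections (p : ℕ) [Fact p.Prime] (e : ℕ) (X : Scheme.{u}) [IsFpScheme p X] :=
  ∀ M N : X.Modules,
    ((Scheme.Modules.pushforward (frob p e X)).obj ((tensorBy (omega X)).obj M) ⟶
      (tensorBy (omega X)).obj N) ≃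
    (M ⟶ (Scheme.Modules.pullback (frob p e X)).obj N)

/-- Functoriality of the bijections in `M` and `N`. -/
def HomBijections.IsNatural {p : ℕ} [Fact p.Prime] {e : ℕ} {X : Scheme.{u}} [IsFpScheme p X]
    (B : HomBijections p e X) : Prop :=
  ∀ ⦃M M' N N' : X.Modules⦄ (a : M' ⟶ M) (b : N ⟶ N')
    (C : (Scheme.Modules.pushforward (frob p e X)).obj ((tensorBy (omega X)).obj M) ⟶
      (tensorBy (omega X)).obj N),
    B M' N' ((Scheme.Modules.pushforward (frob p e X)).map ((tensorBy (omega X)).map a) ≫ C ≫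
      (tensorBy (omega X)).map b) =
    a ≫ B M N C ≫ (Scheme.Modules.pullback (frob p e X)).map b

/-- The bijections are the ones induced by `Φ : ω_X^{⊗(1-q)} ≅ 𝒞_X^{(1)}`: if `C` corresponds to
`θ : M ⟶ F_q^* N`, and `θ(m) = ∑ aⱼ ⊗ nⱼ`, then
`C(m ⊗ δ(w ^ ⊗(q-1)) w) = ∑ nⱼ ⊗ Φ(δ)(aⱼ) w` for all sections `w` of `ω_X` and `δ` of
`ω_X^{⊗(1-q)}`. -/
def HomBijections.IsInducedBy {p : ℕ} [Fact p.Prime] {e : ℕ} {X : Scheme.{u}} [IsFpScheme p X]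
    (B : HomBijections p e X) (Φ : negPow (omega X) (p ^ e - 1) ≅ cartier p e X) : Prop :=
  ∀ (M N : X.Modules)
    (C : (Scheme.Modules.pushforward (frob p e X)).obj ((tensorBy (omega X)).obj M) ⟶
      (tensorBy (omega X)).obj N)
    (U : X.Opens) (m : Γ(M, U)) (k : ℕ) (a : Fin k → Γ(X, U)) (n : Fin k → Γ(N, U)),
    (B M N C).app U m =
        ∑ j, (show Γ((Scheme.Modules.pullback (frob p e X)).obj N, U) from
          a j • (show Γ((Scheme.Modules.pullback (frob p e X)).obj N, U) from
            pullbackSection (frob p e X) (n j))) →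
      ∀ (w : Γ(omega X, U)) (δ : Γ(negPow (omega X) (p ^ e - 1), U)),
        C.app U (show Γ((tensorBy (omega X)).obj M, U) from
          tmul m (evalNeg δ (secPow w (p ^ e - 1)) • w)) =
        ∑ j, tmul (n j) (cartierApp (Φ.hom.app U δ) (a j) • w)

end FrobTwist

end

open FrobTwist

noncomputable section

namespace FrobTwist

open MonoidalCategory TensorProduct

/-! ### Rings with a finite free Frobenius -/

/-! Everything rests on local `q`-bases: functions `g₁, …, gₙ` whose monomials `g ^ I` with
exponents below `q` form a basis of the ring over itself through the `q`-th power map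
(`IsFrobBasis`). A regular local ring `A` with finite Frobenius has a `p`-basis
(`exists_isFrobBasis_of_regular`). For a field one takes a maximal `p`-independent family. In
general a parameter `x` outside the square of the maximal ideal is joined to a lift of a `p`-basis
of `A / x`: injectivity comes from Krull's intersection theorem, surjectivity from Nakayama's lemma.
A `p`-basis of a stalk spreads to a neighbourhood (`exists_isFrobBasis_localization`), and iterating
Frobenius turns it into a `q`-basis. In such a chart the `dgᵢ` form a basis of `Ω¹`, so `dg₁ ∧ ⋯ ∧
dgₙ` generates `ω`.

For the canonical isomorphism, put `ξ(g) = 1 ⊗ g - g ⊗ 1`. In characteristic `p` one has `(y - x) ^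
(q-1) = ∑ x ^ (q-1-k) y ^ k`, so `x ⊗ y ↦ x C(y) ^ q` sends `∏ ξ(gᵢ) ^ (q-1)` to `∑ C(g ^ (q-1-I)) ^
q g ^ I`. The coefficients of this function in the `q`-basis are the values of `C` on the `q`-basis.
Hence in a chart both `C` and `δ` are determined by one arbitrary function, and equating the two
functions defines `Φ`. Linearity and independence of the chart are seen in the quotient of `R ⊗ R`
by the elements `a ^ q ⊗ 1 - 1 ⊗ a ^ q`. There `ξ(gⱼ) ^ q = 0`, and `ξ(h)` is a combination of the
`ξ(gⱼ)` with coefficients congruent to `∂h/∂gⱼ` modulo the `ξ(gⱼ)`. Replacing `g` by `h` therefore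
multiplies `∏ ξ(gᵢ) ^ (q-1)` by the `(q-1)`-st power of the Jacobian determinant (`prod_pow_det`),
exactly as it does `(dg₁ ∧ ⋯ ∧ dgₙ) ^ ⊗(q-1)`.

For the bijections, the local `q`-bases identify `F_q^* N` with `ℋom(F_{q*} 𝒞, N)` by `a ⊗ n ↦ (C ↦
C(a) n)`. Where `w` generates `ω` and `δ` is dual to `w ^ ⊗(q-1)`, the element `Φ(δ)` generates `𝒞`,
and a morphism `C` corresponds to `θ` when `C(m ⊗ w)` is the value of `θ(m)` at `Φ(δ)`, tensored
with `w`. Replacing `w` by `v w` changes both sides compatibly because `v · v ^ (q-1) = v ^ q`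
(`IsDualGen.tmul_dualApp`). So the local correspondence glues (`HasCharts.exists_corresponds_left`,
`HasCharts.exists_corresponds_right`). -/

/-- The `q`-th power map of `R` is a ring homomorphism. -/
structure FrobAdd (q : ℕ) (R : Type*) [CommRing R] : Prop where
  pos : 0 < q
  add_pow (x y : R) : (x + y) ^ q = x ^ q + y ^ q

theorem FrobAdd.of_natCast_eq_zero {p : ℕ} [Fact p.Prime] {R : Type*} [CommRing R]
    (hR : (p : R) = 0) (e : ℕ) : FrobAdd (p ^ e) R :=
  ⟨pow_pos (Fact.out : p.Prime).pos e, add_pow_of_natCast_eq_zero hR e⟩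

theorem FrobAdd.of_natCast_eq_zero' {p : ℕ} [Fact p.Prime] {R : Type*} [CommRing R]
    (hR : (p : R) = 0) : FrobAdd p R := by
  simpa using FrobAdd.of_natCast_eq_zero hR 1

/-- The `q`-th power map as a ring homomorphism. -/
def FrobAdd.hom {q : ℕ} {R : Type*} [CommRing R] (hq : FrobAdd q R) : R →+* R where
  toFun x := x ^ q
  map_one' := one_pow _
  map_mul' x y := mul_pow x y _
  map_zero' := zero_pow hq.pos.ne'
  map_add' := hq.add_pow

theorem FrobAdd.sum_pow {q : ℕ} {R : Type*} [CommRing R] (hq : FrobAdd q R) {ι : Type*}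
    (s : Finset ι) (f : ι → R) : (∑ i ∈ s, f i) ^ q = ∑ i ∈ s, f i ^ q :=
  map_sum hq.hom f s

theorem FrobAdd.sub_pow {q : ℕ} {R : Type*} [CommRing R] (hq : FrobAdd q R) (x y : R) :
    (x - y) ^ q = x ^ q - y ^ q := map_sub hq.hom x y

/-- The sum `∑ c_I ^ q g ^ I` over the multi-indices `I` with entries `< q`. -/
def frobSum (q : ℕ) {R : Type*} [CommRing R] {n : ℕ} (g : Fin n → R)
    (c : (Fin n → Fin q) → R) : R :=
  ∑ I, c I ^ q * ∏ i, g i ^ (I i : ℕ)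

/-- The monomials `g ^ I` with exponents `< q` form a basis of `R` over `R` through the `q`-th power
map. -/
def IsFrobBasis (q : ℕ) {R : Type*} [CommRing R] {n : ℕ} (g : Fin n → R) : Prop :=
  Function.Bijective (frobSum q g)

section

variable {q : ℕ} {R : Type*} [CommRing R] {n : ℕ} {g : Fin n → R}

theorem frobSum_add (hq : FrobAdd q R) (c d : (Fin n → Fin q) → R) :
    frobSum q g (c + d) = frobSum q g c + frobSum q g d := by
  simp only [frobSum, Pi.add_apply, hq.add_pow, add_mul, Finset.sum_add_distrib]

theorem frobSum_sub (hq : FrobAdd q R) (c d : (Fin n → Fin q) → R) :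
    frobSum q g (c - d) = frobSum q g c - frobSum q g d := by
  simp only [frobSum, Pi.sub_apply, hq.sub_pow, sub_mul, Finset.sum_sub_distrib]

theorem frobSum_smul (a : R) (c : (Fin n → Fin q) → R) :
    frobSum q g (a • c) = a ^ q * frobSum q g c := by
  simp only [frobSum, Pi.smul_apply, smul_eq_mul, mul_pow, Finset.mul_sum, mul_assoc]

theorem frobSum_zero (hq : FrobAdd q R) : frobSum q g 0 = 0 := by
  simp [frobSum, hq.pos.ne']

theorem frobSum_single (hq : FrobAdd q R) (I : Fin n → Fin q) (a : R) :
    frobSum q g (Pi.single I a) = a ^ q * ∏ i, g i ^ (I i : ℕ) := by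
  classical
  rw [frobSum, Finset.sum_eq_single I]
  · simp
  · intro J _ hJ
    simp [Pi.single_eq_of_ne hJ, hq.pos.ne']
  · simp

theorem map_frobSum {S : Type*} [CommRing S] (f : R →+* S) (c : (Fin n → Fin q) → R) :
    f (frobSum q g c) = frobSum q (f ∘ g) (f ∘ c) := by
  simp [frobSum, map_sum, map_prod]

theorem frobSum_injective_iff (hq : FrobAdd q R) :
    Function.Injective (frobSum q g) ↔ ∀ c, frobSum q g c = 0 → c = 0 := by
  refine ⟨fun h c hc ↦ h (hc.trans (frobSum_zero hq).symm), fun h c d hcd ↦ ?_⟩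
  rw [← sub_eq_zero]
  exact h _ (by rw [frobSum_sub hq, hcd, sub_self])

theorem frobSum_cons (x : R) (c : (Fin (n + 1) → Fin q) → R) :
    frobSum q (Fin.cons x g : Fin (n + 1) → R) c =
      ∑ i : Fin q, x ^ (i : ℕ) * frobSum q g fun I ↦ c (Fin.cons i I) := by
  rw [frobSum, ← (Fin.consEquiv fun _ ↦ Fin q).sum_comp, Fintype.sum_prod_type]
  refine Finset.sum_congr rfl fun i _ ↦ ?_
  rw [frobSum, Finset.mul_sum]
  refine Finset.sum_congr rfl fun I _ ↦ ?_
  change c (Fin.cons i I) ^ q * ∏ j, (Fin.cons x g : Fin (n + 1) → R) j ^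
    ((Fin.cons i I : Fin (n + 1) → Fin q) j : ℕ) = _
  simp only [Fin.prod_univ_succ, Fin.cons_zero, Fin.cons_succ]
  ring

/-- Dividing each exponent by `q` with remainder, the quotient part is a `q`-th power and is
absorbed into the coefficient. -/
theorem exists_frobSum_eq_monomial (hq : FrobAdd q R) (c : R) (M : Fin n → ℕ) :
    frobSum q g (Pi.single (fun i ↦ ⟨M i % q, Nat.mod_lt _ hq.pos⟩) (c * ∏ i, g i ^ (M i / q))) =
      c ^ q * ∏ i, g i ^ M i := by
  rw [frobSum_single hq, mul_pow, mul_assoc, ← Finset.prod_pow, ← Finset.prod_mul_distrib]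
  congr 1
  refine Finset.prod_congr rfl fun i _ ↦ ?_
  rw [← pow_mul, ← pow_add, Nat.div_add_mod']

/-- The subring generated by the `q`-th powers and the `g i`. -/
def frobRange (hq : FrobAdd q R) (g : Fin n → R) : Subring R where
  carrier := Set.range (frobSum q g)
  zero_mem' := ⟨0, frobSum_zero hq⟩
  one_mem' := ⟨_, (exists_frobSum_eq_monomial hq 1 0).trans (by simp)⟩
  add_mem' := by
    rintro _ _ ⟨c, rfl⟩ ⟨d, rfl⟩
    exact ⟨c + d, frobSum_add hq c d⟩
  neg_mem' := by
    rintro _ ⟨c, rfl⟩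
    exact ⟨0 - c, by rw [frobSum_sub hq, frobSum_zero hq, zero_sub]⟩
  mul_mem' := by
    rintro _ _ ⟨c, rfl⟩ ⟨d, rfl⟩
    have hsum {ι : Type _} (s : Finset ι) (f : ι → R)
        (h : ∀ i ∈ s, f i ∈ Set.range (frobSum q g)) : ∑ i ∈ s, f i ∈ Set.range (frobSum q g) := by
      refine Finset.sum_induction f (· ∈ Set.range (frobSum q g)) ?_ ⟨0, frobSum_zero hq⟩ h
      rintro _ _ ⟨c, rfl⟩ ⟨d, rfl⟩
      exact ⟨c + d, frobSum_add hq c d⟩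
    rw [frobSum.eq_def q g c, frobSum.eq_def q g d, Finset.sum_mul_sum]
    -- A product of two basis monomials may have exponents `≥ q`; these are reduced by
    -- `exists_frobSum_eq_monomial`.
    refine hsum _ _ fun I _ ↦ hsum _ _ fun J _ ↦
      ⟨_, (exists_frobSum_eq_monomial hq (c I * d J) fun i ↦ I i + J i).trans ?_⟩
    simp only [pow_add, Finset.prod_mul_distrib, mul_pow]
    ring

theorem pow_mem_frobRange (hq : FrobAdd q R) (a : R) : a ^ q ∈ frobRange hq g :=
  ⟨_, (exists_frobSum_eq_monomial hq a 0).trans (by simp)⟩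

/-- A property of elements of `R` that is closed under sums and products and holds for the `g i` and
for the `q`-th powers holds everywhere. -/
theorem IsFrobBasis.induction (hg : IsFrobBasis q g) (hq : FrobAdd q R) {P : R → Prop}
    (hpow : ∀ a, P (a ^ q)) (hgen : ∀ i, P (g i)) (hadd : ∀ a b, P a → P b → P (a + b))
    (hmul : ∀ a b, P a → P b → P (a * b)) (a : R) : P a := by
  classical
  obtain ⟨c, rfl⟩ := hg.2 a
  have h1 : P 1 := by simpa using hpow 1
  have h0 : P 0 := by simpa [hq.pos.ne'] using hpow 0
  have hp (a : R) (ha : P a) (k : ℕ) : P (a ^ k) := by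
    induction k with
    | zero => simpa using h1
    | succ k ih => rw [pow_succ]; exact hmul _ _ ih ha
  have hprod (I : Fin n → Fin q) : P (∏ i, g i ^ (I i : ℕ)) :=
    Finset.prod_induction _ P hmul h1 fun i _ ↦ hp _ (hgen i) _
  exact Finset.sum_induction _ P hadd h0 fun I _ ↦ hmul _ _ (hpow _) (hprod _)

/-- The coefficients of `a` in the basis `g ^ I`. -/
def IsFrobBasis.coeff (hg : IsFrobBasis q g) (a : R) : (Fin n → Fin q) → R :=
  (Equiv.ofBijective _ hg).symm a

theorem IsFrobBasis.frobSum_coeff (hg : IsFrobBasis q g) (a : R) : frobSum q g (hg.coeff a) = a :=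
  (Equiv.ofBijective _ hg).apply_symm_apply a

theorem IsFrobBasis.coeff_frobSum (hg : IsFrobBasis q g) (c : (Fin n → Fin q) → R) :
    hg.coeff (frobSum q g c) = c :=
  (Equiv.ofBijective _ hg).symm_apply_apply c

theorem IsFrobBasis.coeff_add (hg : IsFrobBasis q g) (hq : FrobAdd q R) (a b : R) :
    hg.coeff (a + b) = hg.coeff a + hg.coeff b :=
  hg.1 (by rw [frobSum_add hq, hg.frobSum_coeff, hg.frobSum_coeff, hg.frobSum_coeff])

theorem IsFrobBasis.coeff_pow_mul (hg : IsFrobBasis q g) (a b : R) :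
    hg.coeff (a ^ q * b) = a • hg.coeff b :=
  hg.1 (by rw [frobSum_smul, hg.frobSum_coeff, hg.frobSum_coeff])

end

/-- An exponent below `q * r` is uniquely `i + r * k` with `i < r` and `k < q`, and `c ^ (q r) g ^
(I + r K) = (c ^ q g ^ K) ^ r g ^ I`. This is the tower law for the composite of two Frobenius maps.
-/
theorem frobSum_mul {q r : ℕ} {R : Type*} [CommRing R] {n : ℕ} (hr : FrobAdd r R) (g : Fin n → R)
    (c : (Fin n → Fin (q * r)) → R) : frobSum (q * r) g c =
      frobSum r g fun I ↦ frobSum q g fun K ↦ c fun i ↦ finProdFinEquiv (K i, I i) := by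
  let E : (Fin n → Fin q) × (Fin n → Fin r) ≃ (Fin n → Fin (q * r)) :=
    (Equiv.arrowProdEquivProdArrow (Fin n) (fun _ ↦ Fin q) fun _ ↦ Fin r).symm.trans
      (Equiv.piCongrRight fun _ ↦ finProdFinEquiv)
  have hE (K : Fin n → Fin q) (I : Fin n → Fin r) :
      E (K, I) = fun i ↦ finProdFinEquiv (K i, I i) := rfl
  rw [frobSum, ← E.sum_comp, Fintype.sum_prod_type_right, frobSum]
  refine Finset.sum_congr rfl fun I _ ↦ ?_
  rw [frobSum, hr.sum_pow, Finset.sum_mul]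
  refine Finset.sum_congr rfl fun K _ ↦ ?_
  rw [hE, mul_pow, ← pow_mul, mul_assoc, ← Finset.prod_pow, ← Finset.prod_mul_distrib]
  congr 1
  refine Finset.prod_congr rfl fun i _ ↦ ?_
  rw [← pow_mul, ← pow_add, finProdFinEquiv_apply_val, mul_comm r, add_comm]

theorem IsFrobBasis.mul {q r : ℕ} {R : Type*} [CommRing R] {n : ℕ} (hr : FrobAdd r R)
    {g : Fin n → R} (h : IsFrobBasis q g) (h' : IsFrobBasis r g) : IsFrobBasis (q * r) g := by
  let E : (Fin n → Fin q) × (Fin n → Fin r) ≃ (Fin n → Fin (q * r)) :=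
    (Equiv.arrowProdEquivProdArrow (Fin n) (fun _ ↦ Fin q) fun _ ↦ Fin r).symm.trans
      (Equiv.piCongrRight fun _ ↦ finProdFinEquiv)
  constructor
  · intro c d hcd
    rw [frobSum_mul hr, frobSum_mul hr] at hcd
    funext J
    obtain ⟨⟨K, I⟩, rfl⟩ := E.surjective J
    exact congrFun (h.1 (congrFun (h'.1 hcd) I)) K
  · intro a
    obtain ⟨b, rfl⟩ := h'.2 a
    choose c hc using fun I ↦ h.2 (b I)
    refine ⟨fun J ↦ c (E.symm J).2 (E.symm J).1, ?_⟩
    rw [frobSum_mul hr]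
    congr 1
    funext I
    rw [← hc I]
    congr 1
    funext K
    change c (E.symm (E (K, I))).2 (E.symm (E (K, I))).1 = _
    rw [E.symm_apply_apply]

theorem IsFrobBasis.pow {p : ℕ} {R : Type*} [CommRing R] {n : ℕ} (hp : FrobAdd p R)
    {g : Fin n → R} (h : IsFrobBasis p g) (e : ℕ) : IsFrobBasis (p ^ e) g := by
  induction e with
  | zero =>
    rw [pow_zero]
    -- For `q = 1` the only multi-index is zero, and the sum is its single coefficient.
    have : frobSum 1 g = fun c ↦ c default := by
      funext c
      rw [frobSum, Fintype.sum_unique]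
      simp
    refine ⟨fun c d hcd ↦ ?_, fun a ↦ ⟨fun _ ↦ a, by simp [this]⟩⟩
    funext I
    rw [this] at hcd
    rw [Subsingleton.elim I default]
    exact hcd
  | succ e ih => exact ih.mul hp h

/-- `R` is a finite module over itself through the `q`-th power map. -/
def FrobFinite (q : ℕ) (R : Type*) [CommRing R] : Prop :=
  ∃ (k : ℕ) (r : Fin k → R), ∀ a, ∃ c : Fin k → R, a = ∑ i, c i ^ q * r i

theorem FrobFinite.of_surjective {q : ℕ} {R S : Type*} [CommRing R] [CommRing S]
    (h : FrobFinite q R) (f : R →+* S) (hf : Function.Surjective f) : FrobFinite q S := by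
  obtain ⟨k, r, hr⟩ := h
  refine ⟨k, f ∘ r, fun a ↦ ?_⟩
  obtain ⟨a, rfl⟩ := hf a
  obtain ⟨c, hc⟩ := hr a
  exact ⟨f ∘ c, by conv_lhs => rw [hc]
                   simp⟩

/-- `R` as a module over itself through the `q`-th power map. -/
def FrobMod {q : ℕ} {R : Type*} [CommRing R] (_ : FrobAdd q R) : Type _ := R

section

variable {q : ℕ} {R : Type*} [CommRing R] (hq : FrobAdd q R)

instance : AddCommGroup (FrobMod hq) := inferInstanceAs (AddCommGroup R)
instance : Module R (FrobMod hq) := Module.compHom R hq.hom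

/-- `frobSum` as a linear map. -/
def frobSumₗ {n : ℕ} (g : Fin n → R) : ((Fin n → Fin q) → R) →ₗ[R] FrobMod hq where
  toFun := frobSum q g
  map_add' := frobSum_add hq
  map_smul' := frobSum_smul

theorem FrobFinite.module_finite (h : FrobFinite q R) : Module.Finite R (FrobMod hq) := by
  obtain ⟨k, r, hr⟩ := h
  refine Module.Finite.of_surjective (Fintype.linearCombination R (M := FrobMod hq) r) fun a ↦ ?_
  obtain ⟨c, hc⟩ := hr a
  exact ⟨c, hc.symm⟩

end

/-! ### Existence of bases: fields, and lifting from the quotient by a parameter. -/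

theorem frobSum_injective_zero {q : ℕ} {R : Type*} [CommRing R] [IsReduced R] (hq : FrobAdd q R)
    (g : Fin 0 → R) : Function.Injective (frobSum q g) := by
  refine (frobSum_injective_iff hq).2 fun c hc ↦ funext fun I ↦ ?_
  rw [frobSum, Fintype.sum_unique, Fin.prod_univ_zero, mul_one] at hc
  rw [Subsingleton.elim I default]
  exact (pow_eq_zero_iff hq.pos.ne').1 hc

/-- The ring `L` generated by the `p`-th powers and the `g i` is a field. Since `z ∉ L`, the
polynomial `X ^ p - z ^ p` is irreducible over `L`, so `1, z, …, z ^ (p-1)` are linearly independent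
over `L`. -/
theorem frobSum_cons_injective {p : ℕ} [Fact p.Prime] {k : Type*} [Field k] (hp : FrobAdd p k)
    {n : ℕ} {g : Fin n → k} (hg : Function.Injective (frobSum p g)) {z : k}
    (hz : z ∉ frobRange hp g) : Function.Injective (frobSum p (Fin.cons z g : Fin (n + 1) → k)) := by
  let L : Subfield k :=
    { frobRange hp g with
      inv_mem' := fun x hx ↦ by
        change x ∈ frobRange hp g at hx
        change x⁻¹ ∈ frobRange hp g
        rcases eq_or_ne x 0 with rfl | hx0
        · simp
        -- Inverses stay in the subring because `x⁻¹` is the `p`-th power `(x⁻¹) ^ p` times a power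
        -- of `x`.
        · have : x⁻¹ = (x⁻¹) ^ p * x ^ (p - 1) := by
            obtain ⟨m, hm⟩ : ∃ m, p = m + 1 :=
              ⟨p - 1, (Nat.succ_pred (Fact.out : p.Prime).ne_zero).symm⟩
            rw [hm, Nat.add_sub_cancel, pow_succ', mul_assoc, ← mul_pow, inv_mul_cancel₀ hx0,
              one_pow, mul_one]
          rw [this]
          exact mul_mem (pow_mem_frobRange hp _) (pow_mem hx _) }
  have hL (x : k) : x ∈ L ↔ x ∈ frobRange hp g := Iff.rfl
  let w : L := ⟨z ^ p, pow_mem_frobRange hp z⟩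
  have hirr : Irreducible (Polynomial.X ^ p - Polynomial.C w) := by
    -- A `p`-th root of `z ^ p` in `L` would equal `z`, since Frobenius is injective on a field.
    refine X_pow_sub_C_irreducible_of_prime Fact.out fun b hb ↦ hz ?_
    have h1 : (b : k) ^ p = z ^ p := congrArg Subtype.val hb
    have h2 : ((b : k) - z) ^ p = 0 := by rw [hp.sub_pow, h1, sub_self]
    have h3 : (b : k) = z := sub_eq_zero.1 (pow_eq_zero_iff (Fact.out : p.Prime).ne_zero |>.1 h2)
    exact h3 ▸ b.2
  have hmin : Polynomial.X ^ p - Polynomial.C w = minpoly L z :=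
    minpoly.eq_of_irreducible_of_monic hirr
      (by simp only [map_sub, map_pow, Polynomial.aeval_X, Polynomial.aeval_C]; exact sub_self _)
      (Polynomial.monic_X_pow_sub_C _ (Fact.out : p.Prime).ne_zero)
  rw [frobSum_injective_iff hp]
  intro c hc
  rw [frobSum_cons] at hc
  let l (i : Fin p) : L := ⟨frobSum p g fun I ↦ c (Fin.cons i I), ⟨_, rfl⟩⟩
  -- A relation among the powers of `z` is a polynomial of degree `< p` vanishing at `z`, hence zero
  -- by minimality of degree.
  let P : Polynomial L := ∑ i : Fin p, Polynomial.C (l i) * Polynomial.X ^ (i : ℕ)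
  have hP : P = 0 := by
    by_contra h
    have h1 := minpoly.degree_le_of_ne_zero L z h (by
      simp only [P, map_sum, map_mul, map_pow, Polynomial.aeval_X, Polynomial.aeval_C]
      refine Eq.trans (Finset.sum_congr rfl fun i _ ↦ ?_) hc
      exact mul_comm _ _)
    rw [← hmin, Polynomial.degree_X_pow_sub_C (Fact.out : p.Prime).pos] at h1
    refine absurd h1 (not_le.2 ?_)
    refine (Polynomial.degree_sum_le _ _).trans_lt ((Finset.sup_lt_iff (WithBot.bot_lt_coe p)).2 ?_)
    intro i _
    exact (Polynomial.degree_C_mul_X_pow_le _ _).trans_lt (WithBot.coe_lt_coe.2 i.2)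
  funext J
  have h2 : l (J 0) = 0 := by
    have := congrArg (fun Q ↦ Polynomial.coeff Q (J 0)) hP
    simpa [P, Polynomial.finsetSum_coeff, Polynomial.coeff_X_pow, Fin.val_inj] using this
  have h3 := (frobSum_injective_iff hp).1 hg _ (congrArg Subtype.val h2)
  have h4 := congrFun h3 (Fin.tail J)
  rwa [Fin.cons_self_tail] at h4

/-- An independent family of length `n` gives `p ^ n` independent vectors, so `n < p ^ n` is bounded
by the dimension over Frobenius. A family of maximal length must span, as any element outside its
range could be adjoined. -/
theorem exists_isFrobBasis_of_field {p : ℕ} [Fact p.Prime] {k : Type*} [Field k]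
    (hp : FrobAdd p k) (hfin : FrobFinite p k) : ∃ (n : ℕ) (g : Fin n → k), IsFrobBasis p g := by
  have := hfin.module_finite hp
  have hbound (n : ℕ) (g : Fin n → k) (hg : Function.Injective (frobSum p g)) :
      n ≤ Module.finrank k (FrobMod hp) := by
    have h1 := LinearMap.finrank_le_finrank_of_injective (f := frobSumₗ hp g) hg
    rw [Module.finrank_fintype_fun_eq_card, Fintype.card_fun, Fintype.card_fin,
      Fintype.card_fin] at h1
    exact (Nat.lt_pow_self (Fact.out : p.Prime).one_lt).le.trans h1
  obtain ⟨n, ⟨g, hg⟩, hmax⟩ : ∃ n, (∃ g : Fin n → k, Function.Injective (frobSum p g)) ∧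
      ¬ ∃ g : Fin (n + 1) → k, Function.Injective (frobSum p g) := by
    by_contra! hcon
    have (n : ℕ) : ∃ g : Fin n → k, Function.Injective (frobSum p g) := by
      induction n with
      | zero => exact ⟨Fin.elim0, frobSum_injective_zero hp _⟩
      | succ n ih => exact hcon n ih
    obtain ⟨g, hg⟩ := this (Module.finrank k (FrobMod hp) + 1)
    have := hbound _ g hg
    omega
  refine ⟨n, g, hg, fun z ↦ ?_⟩
  by_contra hz
  exact hmax ⟨_, frobSum_cons_injective hp hg hz⟩

/-- Induction on the exponent `i` of `x`. Modulo `x ^ (i+1)` the terms with larger exponent vanish,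
and so do those with smaller exponent, whose coefficients are already divisible by `x` and enter
through their `q`-th powers. Cancelling `x ^ i` and reducing modulo `x`, independence in the
quotient gives divisibility at `i`. Finally a common factor `x` of the coefficients comes out as `x
^ q` and is cancelled. -/
theorem frobSum_cons_dvd {q : ℕ} {A : Type*} [CommRing A] (hq : FrobAdd q A) {x : A}
    (hx : x ∈ nonZeroDivisors A) {n : ℕ} {g : Fin n → A}
    (hg : Function.Injective (frobSum q (Ideal.Quotient.mk (Ideal.span {x}) ∘ g)))
    (c : (Fin (n + 1) → Fin q) → A) (hc : frobSum q (Fin.cons x g : Fin (n + 1) → A) c = 0) :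
    ∃ c', c = x • c' ∧ frobSum q (Fin.cons x g : Fin (n + 1) → A) c' = 0 := by
  have hq' : FrobAdd q (A ⧸ Ideal.span {x}) := ⟨hq.pos, fun a b ↦ by
    obtain ⟨a, rfl⟩ := Ideal.Quotient.mk_surjective a
    obtain ⟨b, rfl⟩ := Ideal.Quotient.mk_surjective b
    rw [← map_add, ← map_pow, hq.add_pow, map_add, map_pow, map_pow]⟩
  have key : ∀ (m : ℕ) (i : Fin q), (i : ℕ) = m → ∀ I, x ∣ c (Fin.cons i I) := by
    intro m
    induction m using Nat.strong_induction_on with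
    | _ m ih =>
      intro i hi
      rw [frobSum_cons, ← Finset.add_sum_erase _ _ (Finset.mem_univ i)] at hc
      have hd : x ^ ((i : ℕ) + 1) ∣ ∑ j ∈ Finset.univ.erase i,
          x ^ (j : ℕ) * frobSum q g fun I ↦ c (Fin.cons j I) := by
        refine Finset.dvd_sum fun j hj ↦ ?_
        rcases lt_or_ge (j : ℕ) (i : ℕ) with h | h
        · choose c' hc' using ih j (hi ▸ h) j rfl
          have : (fun I ↦ c (Fin.cons j I)) = x • c' := funext hc'
          rw [this, frobSum_smul]
          refine Dvd.dvd.mul_left (Dvd.dvd.mul_right (pow_dvd_pow x ?_) _) _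
          have := i.2
          omega
        · have hne : (j : ℕ) ≠ i := fun h ↦ (Finset.mem_erase.1 hj).1 (Fin.ext h)
          exact Dvd.dvd.mul_right (pow_dvd_pow x (by omega)) _
      obtain ⟨b, hb⟩ := hd
      have h1 : x ^ (i : ℕ) * ((frobSum q g fun I ↦ c (Fin.cons i I)) + x * b) = 0 := by
        rw [hb] at hc
        rw [← hc]
        ring
      have h2 := (mul_right_mem_nonZeroDivisors_eq_zero_iff (pow_mem hx (i : ℕ))).1
        ((mul_comm _ _).trans h1)
      have h3 : frobSum q (Ideal.Quotient.mk (Ideal.span {x}) ∘ g)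
          (Ideal.Quotient.mk (Ideal.span {x}) ∘ fun I ↦ c (Fin.cons i I)) = 0 := by
        rw [← map_frobSum, Ideal.Quotient.eq_zero_iff_mem, Ideal.mem_span_singleton]
        exact ⟨-b, by linear_combination h2⟩
      have h4 := (frobSum_injective_iff hq').1 hg _ h3
      intro I
      rw [← Ideal.mem_span_singleton, ← Ideal.Quotient.eq_zero_iff_mem]
      exact congrFun h4 I
  have hdvd (J : Fin (n + 1) → Fin q) : x ∣ c J := by
    have := key _ (J 0) rfl (Fin.tail J)
    rwa [Fin.cons_self_tail] at this
  choose c' hc' using hdvd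
  refine ⟨c', funext hc', ?_⟩
  rw [show c = x • c' from funext hc', frobSum_smul] at hc
  exact (mul_right_mem_nonZeroDivisors_eq_zero_iff (pow_mem hx q)).1 ((mul_comm _ _).trans hc)

/-- Coefficients of a relation can be divided by `x` indefinitely, hence lie in every power of the
maximal ideal and vanish by Krull. For generation, `a ≡ ∑ cᵢ ^ q gᴵ` modulo `x` is iterated and
Nakayama's lemma is applied to the ring as a module over itself through Frobenius. -/
theorem IsFrobBasis.cons {q : ℕ} {A : Type*} [CommRing A] [IsLocalRing A] [IsNoetherianRing A]
    (hq : FrobAdd q A) (hfin : FrobFinite q A) {x : A} (hx : x ∈ nonZeroDivisors A)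
    (hxm : x ∈ IsLocalRing.maximalIdeal A) {n : ℕ} {g : Fin n → A}
    (hg : IsFrobBasis q (Ideal.Quotient.mk (Ideal.span {x}) ∘ g)) :
    IsFrobBasis q (Fin.cons x g : Fin (n + 1) → A) := by
  constructor
  · rw [frobSum_injective_iff hq]
    intro c hc
    have key (N : ℕ) : ∀ c, frobSum q (Fin.cons x g : Fin (n + 1) → A) c = 0 →
        ∀ J, c J ∈ IsLocalRing.maximalIdeal A ^ N := by
      induction N with
      | zero => simp
      | succ N ih =>
        intro c hc J
        obtain ⟨c', rfl, hc'⟩ := frobSum_cons_dvd hq hx hg.1 c hc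
        rw [pow_succ']
        exact Ideal.mul_mem_mul hxm (ih c' hc' J)
    funext J
    have h : c J ∈ ⨅ N, IsLocalRing.maximalIdeal A ^ N :=
      Ideal.mem_iInf.2 fun N ↦ key N c hc J
    rwa [Ideal.iInf_pow_eq_bot_of_isLocalRing _ (Ideal.IsPrime.ne_top'), Ideal.mem_bot] at h
  · have step (a : A) : ∃ (c : (Fin n → Fin q) → A) (b : A), a = frobSum q g c + x * b := by
      obtain ⟨c, hc⟩ := hg.2 (Ideal.Quotient.mk _ a)
      choose c' hc' using fun I ↦ Ideal.Quotient.mk_surjective (c I)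
      have hcc : c = Ideal.Quotient.mk (Ideal.span {x}) ∘ c' := funext fun I ↦ (hc' I).symm
      rw [hcc, ← map_frobSum, eq_comm, ← sub_eq_zero, ← map_sub, Ideal.Quotient.eq_zero_iff_mem,
        Ideal.mem_span_singleton] at hc
      obtain ⟨b, hb⟩ := hc
      exact ⟨c', b, by rw [← hb]; ring⟩
    have steps (N : ℕ) (a : A) : ∃ (c : Fin N → (Fin n → Fin q) → A) (b : A),
        a = (∑ i : Fin N, x ^ (i : ℕ) * frobSum q g (c i)) + x ^ N * b := by
      induction N with
      | zero => exact ⟨Fin.elim0, a, by simp⟩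
      | succ N ih =>
        obtain ⟨c, b, h⟩ := ih
        obtain ⟨c', b', h'⟩ := step b
        refine ⟨Fin.snoc c c', b', ?_⟩
        rw [Fin.sum_univ_castSucc]
        simp only [Fin.snoc_castSucc, Fin.val_castSucc, Fin.snoc_last, Fin.val_last]
        rw [h, h']
        ring
    let N : Submodule A (FrobMod hq) :=
      { (frobRange hq (Fin.cons x g : Fin (n + 1) → A)).toAddSubgroup.toAddSubmonoid with
        smul_mem' := fun a b hb ↦
          (frobRange hq (Fin.cons x g : Fin (n + 1) → A)).mul_mem (pow_mem_frobRange hq a) hb }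
    have := hfin.module_finite hq
    have hN : (⊤ : Submodule A (FrobMod hq)) ≤ N := by
      refine Submodule.le_of_le_smul_of_le_jacobson_bot (I := IsLocalRing.maximalIdeal A)
        Module.Finite.fg_top (IsLocalRing.maximalIdeal_le_jacobson _) ?_
      rintro a -
      -- Exactly `q` iterations: the powers of `x` used are `< q`, and the remainder `x ^ q * b` is
      -- the scalar `x` acting on `b` in `FrobMod hq`.
      obtain ⟨c, b, rfl⟩ := steps q a
      refine Submodule.add_mem_sup ?_ ?_
      · refine ⟨fun J ↦ c (J 0) (Fin.tail J), ?_⟩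
        rw [frobSum_cons]
        simp only [Fin.cons_zero, Fin.tail_cons]
      · have h (b : FrobMod hq) : x • b ∈
            IsLocalRing.maximalIdeal A • (⊤ : Submodule A (FrobMod hq)) :=
          Submodule.smul_mem_smul hxm Submodule.mem_top
        exact h b
    have h (a : FrobMod hq) : a ∈ N := hN Submodule.mem_top
    exact h

/-! ### Regular local rings -/

-- Since `x` is not in the square of the maximal ideal, it involves some member of a minimal
-- generating set with a unit coefficient. That generator becomes redundant in the quotient, while
-- the Krull dimension drops by at most one.
open IsLocalRing in
theorem regularLocalRing_quotient {A : Type*} [CommRing A] [IsRegularLocalRing A] {x : A}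
    (hx : x ∈ maximalIdeal A) (hx2 : x ∉ maximalIdeal A ^ 2) :
    ∃ _ : IsRegularLocalRing (A ⧸ Ideal.span {x}),
      (maximalIdeal (A ⧸ Ideal.span {x})).spanFinrank < (maximalIdeal A).spanFinrank := by
  classical
  have : Nontrivial (A ⧸ Ideal.span {x}) := Ideal.Quotient.nontrivial_iff.2
    (ne_top_of_le_ne_top Ideal.IsPrime.ne_top' ((Ideal.span_singleton_le_iff_mem _).2 hx))
  have hloc : IsLocalRing (A ⧸ Ideal.span {x}) :=
    .of_surjective' (Ideal.Quotient.mk _) Ideal.Quotient.mk_surjective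
  obtain ⟨s, hcard, hs⟩ :=
    Submodule.FG.exists_span_finset_card_eq_spanFinrank (maximalIdeal A).fg_of_isNoetherianRing
  have hxs : x ∈ Submodule.span A (s : Set A) := hs ▸ hx
  obtain ⟨a, -, ha⟩ := Submodule.mem_span_finset.1 hxs
  obtain ⟨t, hts, hat⟩ : ∃ t ∈ s, IsUnit (a t) := by
    by_contra! hcon
    refine hx2 (ha ▸ Ideal.sum_mem _ fun t ht ↦ ?_)
    rw [pow_two]
    exact Ideal.mul_mem_mul ((mem_maximalIdeal _).2 (hcon t ht)) (hs ▸ Submodule.subset_span ht)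
  let π := Ideal.Quotient.mk (Ideal.span {x})
  have hmap : maximalIdeal (A ⧸ Ideal.span {x}) = (maximalIdeal A).map π :=
    (eq_maximalIdeal (Ideal.map_eq_top_or_isMaximal_of_surjective π
      Ideal.Quotient.mk_surjective (maximalIdeal.isMaximal A) |>.resolve_left fun h ↦ by
        have h1 := congrArg (Ideal.comap π) h
        rw [Ideal.comap_map_of_surjective π Ideal.Quotient.mk_surjective, Ideal.comap_top,
          ← RingHom.ker_eq_comap_bot, Ideal.mk_ker, sup_eq_left.2
            ((Ideal.span_singleton_le_iff_mem _).2 hx)] at h1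
        exact Ideal.IsPrime.ne_top' h1)).symm
  have hspan : maximalIdeal (A ⧸ Ideal.span {x}) = Ideal.span ((s.erase t).image π : Set _) := by
    rw [hmap]
    refine le_antisymm (Ideal.map_le_iff_le_comap.2 ?_) (Ideal.span_le.2 ?_)
    · rw [← hs]
      refine Submodule.span_le.2 fun u hu ↦ ?_
      rw [SetLike.mem_coe, Ideal.mem_comap]
      by_cases hut : u = t
      · subst hut
        have h0 : π x = 0 := Ideal.Quotient.eq_zero_iff_mem.2 (Ideal.mem_span_singleton_self x)
        replace h0 := (congrArg π ha).trans h0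
        rw [← Finset.add_sum_erase _ _ hts, map_add, smul_eq_mul, map_mul] at h0
        rw [← Ideal.unit_mul_mem_iff_mem _ (hat.map π), eq_neg_of_add_eq_zero_left h0, map_sum]
        refine Ideal.neg_mem_iff _ |>.2 (Ideal.sum_mem _ fun v hv ↦ ?_)
        rw [smul_eq_mul, map_mul]
        exact Ideal.mul_mem_left _ _ (Ideal.subset_span (by
          exact Finset.mem_coe.2 (Finset.mem_image_of_mem _ hv)))
      · refine Ideal.subset_span ?_
        exact Finset.mem_coe.2 (Finset.mem_image_of_mem _ (Finset.mem_erase.2 ⟨hut, hu⟩))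
    · intro y hy
      obtain ⟨u, hu, rfl⟩ := Finset.mem_image.1 (Finset.mem_coe.1 hy)
      refine Ideal.mem_map_of_mem _ ?_
      rw [← hs]
      exact Submodule.subset_span (Finset.mem_of_mem_erase hu)
  have hlt : (maximalIdeal (A ⧸ Ideal.span {x})).spanFinrank < (maximalIdeal A).spanFinrank := by
    rw [hspan, ← hcard]
    refine lt_of_le_of_lt ?_ (Finset.card_erase_lt_of_mem hts)
    refine (Submodule.spanFinrank_span_le_ncard_of_finite (Finset.finite_toSet _)).trans ?_
    rw [Set.ncard_coe_finset]
    exact Finset.card_image_le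
  refine ⟨.of_spanFinrank_maximalIdeal_le _ ?_, hlt⟩
  have hdim := ringKrullDim_le_ringKrullDim_quotient_add_card {x} (R := A) (by
    rw [IsLocalRing.ringJacobson_eq_maximalIdeal]
    simpa using hx)
  rw [← IsRegularLocalRing.spanFinrank_maximalIdeal, Finset.coe_singleton,
    Finset.card_singleton] at hdim
  have h1 : (((maximalIdeal (A ⧸ Ideal.span {x})).spanFinrank + 1 : ℕ) : WithBot ℕ∞) ≤
      ((maximalIdeal A).spanFinrank : ℕ) := by exact_mod_cast hlt
  have h2 := h1.trans hdim
  push_cast at h2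
  rcases hD : ringKrullDim (A ⧸ Ideal.span {x}) with _ | _ | D
  · rw [hD] at h2
    exact absurd h2 (by rw [← not_lt, not_not]; exact WithBot.bot_lt_coe _)
  · exact le_top
  · replace hD : ringKrullDim (A ⧸ Ideal.span {x}) = ((D : ℕ) : WithBot ℕ∞) := hD
    rw [hD] at h2
    have h3 : ((maximalIdeal (A ⧸ Ideal.span {x})).spanFinrank + 1 : ℕ) ≤ D + 1 := by
      exact_mod_cast h2
    have h4 : (maximalIdeal (A ⧸ Ideal.span {x})).spanFinrank ≤ D := by omega
    exact le_of_le_of_eq (by exact_mod_cast h4) (rfl : ((D : ℕ) : WithBot ℕ∞) = _)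

open IsLocalRing in
theorem regularLocalRing_isField {A : Type*} [CommRing A] [IsRegularLocalRing A]
    (h : (maximalIdeal A).spanFinrank = 0) : IsField A :=
  isField_iff_maximalIdeal_eq.2
    ((Submodule.spanFinrank_eq_zero_iff_eq_bot (maximalIdeal A).fg_of_isNoetherianRing).1 h)

-- In positive dimension, prime avoidance gives `x` in the maximal ideal, outside its square and
-- outside all minimal primes. By induction `(x)` is prime, so it contains a minimal prime `P`. As
-- `x ∉ P`, every element of `P` is `x` times an element of `P`, and Nakayama's lemma gives `P = 0`.
open IsLocalRing in
theorem regularLocalRing_isDomain (A : Type*) [CommRing A] [IsRegularLocalRing A] :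
    IsDomain A := by
  classical
  induction h : (maximalIdeal A).spanFinrank using Nat.strong_induction_on generalizing A with
  | _ d ih =>
    rcases Nat.eq_zero_or_pos d with rfl | hd
    · exact (regularLocalRing_isField h).isDomain
    have hdim : 0 < ringKrullDim A := by
      rw [← IsRegularLocalRing.spanFinrank_maximalIdeal, h]
      exact_mod_cast hd
    have hmin {P : Ideal A} (hP : P ∈ minimalPrimes A) : ¬ maximalIdeal A ≤ P := by
      intro hle
      have : P.IsPrime := hP.1.1
      have hPm : P = maximalIdeal A := le_antisymm (le_maximalIdeal this.ne_top) hle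
      have h1 : (maximalIdeal A).height = 0 := by
        rw [Ideal.height_eq_zero_iff]
        exact hPm ▸ hP
      rw [← maximalIdeal_height_eq_ringKrullDim, h1] at hdim
      exact lt_irrefl _ hdim
    have hfin := Ideal.finite_minimalPrimes_of_isNoetherianRing A ⊥
    obtain ⟨x, hx, hxn⟩ : ∃ x ∈ maximalIdeal A, x ∉ maximalIdeal A ^ 2 ∧
        ∀ P ∈ minimalPrimes A, x ∉ P := by
      by_contra! hcon
      have hsub : (maximalIdeal A : Set A) ⊆
          ⋃ i ∈ (↑(insert (maximalIdeal A ^ 2) hfin.toFinset) : Set (Ideal A)), (i : Set A) := by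
        intro x hx
        by_cases hx2 : x ∈ maximalIdeal A ^ 2
        · exact Set.mem_biUnion (by simp) hx2
        · obtain ⟨P, hP, hxP⟩ := hcon x hx hx2
          exact Set.mem_biUnion (x := P) (by simpa using Or.inr hP) hxP
      -- Prime avoidance tolerates two ideals that need not be prime; the square of the maximal
      -- ideal fills both places.
      obtain ⟨I, hI, hle⟩ := (Ideal.subset_union_prime (f := id) (maximalIdeal A ^ 2)
        (maximalIdeal A ^ 2) (fun i hi h1 _ ↦ by
          have : i ∈ minimalPrimes A := by simpa [h1] using hi
          exact this.1.1)).1 hsub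
      rcases Finset.mem_insert.1 hI with rfl | hI
      · refine (not_le_of_gt ((maximalIdeal_sq_lt_maximalIdeal A).2 fun hf ↦ ?_)) hle
        rw [ringKrullDim_eq_zero_of_isField hf] at hdim
        exact lt_irrefl _ hdim
      · exact hmin (hfin.mem_toFinset.1 hI) hle
    obtain ⟨hreg, hlt⟩ := regularLocalRing_quotient hx hxn.1
    have hdom := ih _ (h ▸ hlt) (A ⧸ Ideal.span {x}) rfl
    have hprime : (Ideal.span {x}).IsPrime := Ideal.Quotient.isDomain_iff_prime _ |>.1 hdom
    obtain ⟨P, hP, hle⟩ := Ideal.exists_minimalPrimes_le (I := ⊥) (J := Ideal.span {x}) bot_le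
    have hPp : P.IsPrime := hP.1.1
    have hbot : P = ⊥ := by
      refine Submodule.eq_bot_of_le_smul_of_le_jacobson_bot (maximalIdeal A) P
        P.fg_of_isNoetherianRing (fun y hy ↦ ?_) (maximalIdeal_le_jacobson _)
      obtain ⟨z, rfl⟩ := Ideal.mem_span_singleton.1 (hle hy)
      exact Submodule.smul_mem_smul hx ((hPp.mem_or_mem hy).resolve_left (hxn.2 P hP))
    have := (hbot ▸ hPp : (⊥ : Ideal A).IsPrime)
    exact IsDomain.of_bot_isPrime A

-- Induction on the number of generators of the maximal ideal. Being a domain is what makes the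
-- parameter `x` a non-zero-divisor, as `IsFrobBasis.cons` requires.
open IsLocalRing in
theorem exists_isFrobBasis_of_regular {p : ℕ} [Fact p.Prime] (A : Type*) [CommRing A]
    [IsRegularLocalRing A] (hp : (p : A) = 0) (hfin : FrobFinite p A) :
    ∃ (n : ℕ) (g : Fin n → A), IsFrobBasis p g := by
  induction h : (maximalIdeal A).spanFinrank using Nat.strong_induction_on generalizing A with
  | _ d ih =>
    rcases Nat.eq_zero_or_pos d with rfl | hd
    · let := (regularLocalRing_isField h).toField
      exact exists_isFrobBasis_of_field (FrobAdd.of_natCast_eq_zero' hp) hfin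
    have := regularLocalRing_isDomain A
    have hnf : ¬ IsField A := fun hf ↦ by
      rw [isField_iff_maximalIdeal_eq.1 hf, Submodule.spanFinrank_bot] at h
      omega
    obtain ⟨x, hx, hx2⟩ := SetLike.exists_of_lt ((maximalIdeal_sq_lt_maximalIdeal A).2 hnf)
    obtain ⟨hreg, hlt⟩ := regularLocalRing_quotient hx hx2
    obtain ⟨n, g, hg⟩ := ih _ (h ▸ hlt) (A ⧸ Ideal.span {x})
      (by rw [← map_natCast (Ideal.Quotient.mk (Ideal.span {x})), hp, map_zero])
      (hfin.of_surjective _ Ideal.Quotient.mk_surjective) rfl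
    choose g' hg' using fun i ↦ Ideal.Quotient.mk_surjective (g i)
    refine ⟨n + 1, Fin.cons x g', IsFrobBasis.cons (FrobAdd.of_natCast_eq_zero' hp) hfin
      (mem_nonZeroDivisors_of_ne_zero ?_) hx ?_⟩
    · rintro rfl
      exact hx2 (zero_mem _)
    · rwa [show Ideal.Quotient.mk (Ideal.span {x}) ∘ g' = g from funext hg']

/-! ### Spreading out -/

theorem FrobAdd.of_isLocalization {q : ℕ} {R S : Type*} [CommRing R] [CommRing S] [Algebra R S]
    (M : Submonoid R) [IsLocalization M S] (hq : FrobAdd q R) : FrobAdd q S := by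
  refine ⟨hq.pos, fun x y ↦ ?_⟩
  obtain ⟨⟨a, s⟩, hx⟩ := IsLocalization.surj M x
  obtain ⟨⟨b, t⟩, hy⟩ := IsLocalization.surj M y
  have h : IsUnit ((algebraMap R S s * algebraMap R S t) ^ q) :=
    ((IsLocalization.map_units S s).mul (IsLocalization.map_units S t)).pow q
  refine h.mul_right_cancel ?_
  have hx' : x * (algebraMap R S s * algebraMap R S t) = algebraMap R S (a * t) := by
    rw [← mul_assoc, hx, map_mul]
  have hy' : y * (algebraMap R S s * algebraMap R S t) = algebraMap R S (b * s) := by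
    rw [mul_comm (algebraMap R S s), ← mul_assoc, hy, map_mul]
  rw [add_mul, ← mul_pow, ← mul_pow, ← mul_pow, add_mul, hx', hy', ← map_add, ← map_pow, ← map_pow,
    ← map_pow, hq.add_pow, map_add]

/-- A property of elements `a` of a module over a ring `R`, "annihilated by an element outside
`P`", holds for finitely many elements simultaneously. -/
theorem exists_notMem_forall {R : Type*} [CommRing R] {P : Ideal R} [P.IsPrime] {ι : Type*}
    (s : Finset ι) {A : ι → R → Prop} (hA : ∀ i f g, A i f → A i (g * f))
    (h : ∀ i ∈ s, ∃ f ∉ P, A i f) : ∃ f ∉ P, ∀ i ∈ s, A i f := by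
  classical
  induction s using Finset.induction_on with
  | empty => exact ⟨1, P.ne_top_iff_one.1 Ideal.IsPrime.ne_top', by simp⟩
  | insert i s hi ih =>
    obtain ⟨f, hf, hf'⟩ := ih fun j hj ↦ h j (Finset.mem_insert_of_mem hj)
    obtain ⟨g, hg, hg'⟩ := h i (Finset.mem_insert_self _ _)
    refine ⟨f * g, fun hfg ↦ (Ideal.IsPrime.mem_or_mem ‹_› hfg).elim hf hg, fun j hj ↦ ?_⟩
    rcases Finset.mem_insert.1 hj with rfl | hj
    · exact hA _ _ _ hg'
    · rw [mul_comm]; exact hA _ _ _ (hf' j hj)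

section

variable {q : ℕ} {R : Type*} [CommRing R] {n : ℕ} {g : Fin n → R}

/-- Each of the finitely many Frobenius generators `r i` lies in the range after multiplication by
`f ^ q` for some `f ∉ P`. Wherever a common `f` becomes a unit, `f ^ q` is undone by the `q`-th
power of its inverse. -/
theorem exists_surjective_frobSum (hq : FrobAdd q R) {P : Ideal R} [P.IsPrime] (RP : Type*)
    [CommRing RP] [Algebra R RP] [IsLocalization.AtPrime RP P] (hfin : FrobFinite q R)
    (hg : Function.Surjective (frobSum q (algebraMap R RP ∘ g))) :
    ∃ f ∉ P, ∀ (R' : Type*) [CommRing R'] [Algebra R R'] (M : Submonoid R) [IsLocalization M R'],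
      IsUnit (algebraMap R R' f) → Function.Surjective (frobSum q (algebraMap R R' ∘ g)) := by
  classical
  obtain ⟨k, r, hr⟩ := hfin
  obtain ⟨f, hf, hfr⟩ := exists_notMem_forall (P := P) Finset.univ
    (A := fun i f ↦ f ^ q * r i ∈ frobRange hq g)
    (fun i f g h ↦ by
      change f ^ q * r i ∈ _ at h
      rw [mul_pow, mul_assoc]; exact mul_mem (pow_mem_frobRange hq g) h)
    (fun i _ ↦ by
      obtain ⟨c, hc⟩ := hg (algebraMap R RP (r i))
      obtain ⟨s, hs⟩ := IsLocalization.exist_integer_multiples P.primeCompl Finset.univ c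
      choose a ha using fun I ↦ hs I (Finset.mem_univ I)
      have h1 : algebraMap R RP ∘ a = algebraMap R RP s • c := by
        funext I
        rw [Function.comp_apply, ha I, Pi.smul_apply, Algebra.smul_def, smul_eq_mul]
      have h2 : algebraMap R RP (frobSum q g a) = algebraMap R RP (s ^ q * r i) := by
        rw [map_frobSum, h1, frobSum_smul, hc, map_mul, map_pow]
      obtain ⟨t, ht⟩ := (IsLocalization.eq_iff_exists P.primeCompl RP).1 h2
      -- `s` clears the denominators of the coefficients and `t` kills the remaining discrepancy, so
      -- `t • a` represents `(t * s) ^ q * r i`.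
      refine ⟨t * s, fun h ↦ (Ideal.IsPrime.mem_or_mem ‹_› h).elim t.2 s.2, t • a, ?_⟩
      have hpos := hq.pos
      obtain ⟨m, rfl⟩ : ∃ m, q = m + 1 := ⟨q - 1, by omega⟩
      change frobSum _ g ((t : R) • a) = _
      rw [frobSum_smul, pow_succ, mul_assoc, ht]
      ring)
  refine ⟨f, hf, fun R' _ _ M _ hfu ↦ ?_⟩
  have hq' : FrobAdd q R' := hq.of_isLocalization M
  have hmem (x : R) (hx : x ∈ frobRange hq g) :
      algebraMap R R' x ∈ frobRange hq' (algebraMap R R' ∘ g) := by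
    obtain ⟨c, rfl⟩ := hx
    exact ⟨_, (map_frobSum _ _).symm⟩
  have hinv (u x : R') (hu : IsUnit u) (h : u ^ q * x ∈ frobRange hq' (algebraMap R R' ∘ g)) :
      x ∈ frobRange hq' (algebraMap R R' ∘ g) := by
    obtain ⟨u, rfl⟩ := hu
    have := mul_mem (pow_mem_frobRange hq' (g := algebraMap R R' ∘ g) (↑u⁻¹ : R')) h
    rwa [← mul_assoc, ← mul_pow, Units.inv_mul, one_pow, one_mul] at this
  intro x
  change x ∈ frobRange hq' (algebraMap R R' ∘ g)
  obtain ⟨⟨a, m⟩, hx⟩ := IsLocalization.surj M x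
  refine hinv _ x (IsLocalization.map_units R' m) ?_
  have hpos := hq.pos
  obtain ⟨l, hl⟩ : ∃ l, q = l + 1 := ⟨q - 1, by omega⟩
  -- For `x = a / m`, multiplying by the `q`-th power `m ^ q` leaves `m ^ (q-1) * a`, which comes
  -- from `R`.
  have h1 : algebraMap R R' m ^ q * x = algebraMap R R' (m ^ l * a) := by
    rw [hl, map_mul, ← hx, map_pow]; ring
  obtain ⟨c, hc⟩ := hr (m ^ l * a)
  rw [h1, hc, map_sum]
  refine sum_mem fun i _ ↦ ?_
  rw [map_mul, map_pow]
  refine mul_mem (pow_mem_frobRange hq' _) (hinv _ _ hfu ?_)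
  rw [← map_pow, ← map_mul]
  exact hmem _ (hfr i (Finset.mem_univ i))

/-- The relations form an `R`-submodule of a finite free module, finitely generated because `R` is
Noetherian. Each generator vanishes at `P`, so one `f ∉ P` kills them all; a relation over a
localization comes from `R` after clearing denominators. -/
theorem exists_injective_frobSum (hq : FrobAdd q R) [IsNoetherianRing R] {P : Ideal R}
    [P.IsPrime] (RP : Type*) [CommRing RP] [Algebra R RP] [IsLocalization.AtPrime RP P]
    (hg : Function.Injective (frobSum q (algebraMap R RP ∘ g))) :
    ∃ f ∉ P, ∀ (R' : Type*) [CommRing R'] [Algebra R R'] (M : Submonoid R) [IsLocalization M R'],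
      IsUnit (algebraMap R R' f) → Function.Injective (frobSum q (algebraMap R R' ∘ g)) := by
  classical
  have hqP : FrobAdd q RP := hq.of_isLocalization P.primeCompl
  obtain ⟨s, hs⟩ := IsNoetherian.noetherian (LinearMap.ker (frobSumₗ hq g))
  have hmem (c : (Fin n → Fin q) → R) : c ∈ Submodule.span R (s : Set _) ↔ frobSum q g c = 0 := by
    rw [hs, LinearMap.mem_ker]; rfl
  obtain ⟨f, hf, hfs⟩ := exists_notMem_forall (P := P) s (A := fun c f ↦ f • c = 0)
    (fun c f g h ↦ by
      change f • c = 0 at h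
      rw [mul_smul, h, smul_zero])
    (fun c hc ↦ by
      have h0 := (frobSum_injective_iff hqP).1 hg (algebraMap R RP ∘ c) (by
        rw [← map_frobSum, (hmem c).1 (Submodule.subset_span hc), map_zero])
      obtain ⟨f, hf, h⟩ := exists_notMem_forall (P := P) Finset.univ (A := fun I f ↦ f * c I = 0)
        (fun I f g h ↦ by
          change f * c I = 0 at h
          rw [mul_assoc, h, mul_zero])
        (fun I _ ↦ by
          obtain ⟨t, ht⟩ := (IsLocalization.map_eq_zero_iff P.primeCompl RP (c I)).1 (congrFun h0 I)
          exact ⟨t, t.2, ht⟩)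
      exact ⟨f, hf, funext fun I ↦ h I (Finset.mem_univ I)⟩)
  refine ⟨f, hf, fun R' _ _ M _ hfu ↦ ?_⟩
  have hker (c : (Fin n → Fin q) → R) (hc : frobSum q g c = 0) : f • c = 0 := by
    have h : c ∈ Submodule.span R (s : Set _) := (hmem c).2 hc
    induction h using Submodule.span_induction with
    | mem c h => exact hfs c h
    | zero => exact smul_zero f
    | add c d hc' hd' ihc ihd => rw [smul_add, ihc ((hmem c).1 hc'), ihd ((hmem d).1 hd'), add_zero]
    | smul a c hc' ih => rw [smul_comm, ih ((hmem c).1 hc'), smul_zero]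
  rw [frobSum_injective_iff (hq.of_isLocalization M)]
  intro c hc
  obtain ⟨m, hm⟩ := IsLocalization.exist_integer_multiples M Finset.univ c
  choose a ha using fun I ↦ hm I (Finset.mem_univ I)
  have h1 : algebraMap R R' ∘ a = algebraMap R R' m • c := by
    funext I
    rw [Function.comp_apply, ha I, Pi.smul_apply, Algebra.smul_def, smul_eq_mul]
  have h2 : algebraMap R R' (frobSum q g a) = 0 := by
    rw [map_frobSum, h1, frobSum_smul, hc, mul_zero]
  obtain ⟨t, ht⟩ := (IsLocalization.map_eq_zero_iff M R' _).1 h2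
  have hpos := hq.pos
  obtain ⟨l, hl⟩ : ∃ l, q = l + 1 := ⟨q - 1, by omega⟩
  -- `t` kills the value of `frobSum` at `a`, hence so does `t ^ q`, and `t • a` is a relation over
  -- `R`.
  have h3 : f • (t : R) • a = 0 := hker _ (by
    rw [frobSum_smul]
    have h4 : (t : R) ^ q = t ^ l * t := by rw [hl, pow_succ]
    rw [h4, mul_assoc, ht, mul_zero])
  funext I
  have h4 : f * (t * a I) = 0 := congrFun h3 I
  have h5 := congrArg (algebraMap R R') h4
  rw [map_mul, map_mul, map_zero, hfu.mul_right_eq_zero,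
    (IsLocalization.map_units R' t).mul_right_eq_zero] at h5
  have h6 : algebraMap R R' m * c I = 0 := (congrFun h1 I).symm.trans h5
  exact (IsLocalization.map_units R' m).mul_right_eq_zero.1 h6

/-- If the images of the `g i` in the local ring at `P` give a basis through the `q`-th power map,
this remains true in a neighbourhood of `P`. -/
theorem exists_isFrobBasis_localization (hq : FrobAdd q R) [IsNoetherianRing R] {P : Ideal R}
    [P.IsPrime] (RP : Type*) [CommRing RP] [Algebra R RP] [IsLocalization.AtPrime RP P]
    (hfin : FrobFinite q R) (hg : IsFrobBasis q (algebraMap R RP ∘ g)) :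
    ∃ f ∉ P, ∀ (R' : Type*) [CommRing R'] [Algebra R R'] (M : Submonoid R) [IsLocalization M R'],
      IsUnit (algebraMap R R' f) → IsFrobBasis q (algebraMap R R' ∘ g) := by
  obtain ⟨f, hf, h⟩ := exists_injective_frobSum (P := P) hq RP hg.1
  obtain ⟨f', hf', h'⟩ := exists_surjective_frobSum (P := P) hq RP hfin hg.2
  refine ⟨f * f', fun hff ↦ (Ideal.IsPrime.mem_or_mem ‹_› hff).elim hf hf', fun R' _ _ M _ hu ↦ ?_⟩
  rw [map_mul, IsUnit.mul_iff] at hu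
  exact ⟨h R' M hu.1, h' R' M hu.2⟩

end

/-! ### Derivations and differentials -/

section

variable {q : ℕ} {R : Type*} [CommRing R] {n : ℕ} {g : Fin n → R}

/-- The derivative of the monomial `g ^ M` in the direction `j`. -/
def dMonomial (g : Fin n → R) (j : Fin n) (M : Fin n → ℕ) : R :=
  -- For `M j = 0` the truncated exponent is harmless, since the factor `M j` vanishes.
  M j * g j ^ (M j - 1) * ∏ i ∈ Finset.univ.erase j, g i ^ M i

theorem prod_pow_eq (g : Fin n → R) (j : Fin n) (M : Fin n → ℕ) :
    ∏ i, g i ^ M i = g j ^ M j * ∏ i ∈ Finset.univ.erase j, g i ^ M i :=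
  (Finset.mul_prod_erase _ _ (Finset.mem_univ j)).symm

theorem dMonomial_add (g : Fin n → R) (j : Fin n) (M N : Fin n → ℕ) :
    dMonomial g j (M + N) =
      (∏ i, g i ^ M i) * dMonomial g j N + (∏ i, g i ^ N i) * dMonomial g j M := by
  rw [prod_pow_eq g j M, prod_pow_eq g j N, dMonomial, dMonomial, dMonomial]
  simp only [Pi.add_apply, pow_add, Finset.prod_mul_distrib, Nat.cast_add]
  rcases hM : M j with _ | a
  · simp; ring
  · rcases hN : N j with _ | b
    · simp; ring
    · have : a + 1 + (b + 1) - 1 = a + b + 1 := by omega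
      rw [this]
      simp only [Nat.add_sub_cancel]
      ring

/-- As `q = 0` in `R`, only the exponents modulo `q` enter as coefficients, and `q`-th powers behave
as constants. This makes a derivative defined on exponents `< q` correct on all monomials. -/
theorem dMonomial_mod (hq0 : (q : R) = 0) (g : Fin n → R) (j : Fin n) (M : Fin n → ℕ) :
    (∏ i, g i ^ (M i / q)) ^ q * dMonomial g j (fun i ↦ M i % q) = dMonomial g j M := by
  rw [← Finset.prod_pow, ← Finset.mul_prod_erase _ _ (Finset.mem_univ j), dMonomial, dMonomial]
  have h1 : ((M j % q : ℕ) : R) = M j := by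
    conv_rhs => rw [← Nat.div_add_mod (M j) q]
    rw [Nat.cast_add, Nat.cast_mul, hq0, zero_mul, zero_add]
  have h2 : ∏ i ∈ Finset.univ.erase j, g i ^ M i =
      (∏ i ∈ Finset.univ.erase j, (g i ^ (M i / q)) ^ q) *
        ∏ i ∈ Finset.univ.erase j, g i ^ (M i % q) := by
    rw [← Finset.prod_mul_distrib]
    refine Finset.prod_congr rfl fun i _ ↦ ?_
    rw [← pow_mul, ← pow_add, Nat.div_add_mod']
  rw [h2, ← h1]
  rcases h : M j % q with _ | a
  · simp
  · have : M j - 1 = M j / q * q + a := by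
      have := Nat.div_add_mod' (M j) q
      omega
    rw [this, Nat.add_sub_cancel, pow_add, ← pow_mul]
    ring

/-- The partial derivative along `g j`. -/
def IsFrobBasis.partialDeriv (hg : IsFrobBasis q g) (hq : FrobAdd q R) (j : Fin n) : R →+ R where
  toFun a := ∑ I, hg.coeff a I ^ q * dMonomial g j (fun i ↦ I i)
  map_zero' := by
    have h := hg.coeff_frobSum 0
    rw [frobSum_zero hq] at h
    simp [h, hq.pos.ne']
  map_add' a b := by
    simp only [hg.coeff_add hq, Pi.add_apply, hq.add_pow, add_mul, Finset.sum_add_distrib]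

theorem IsFrobBasis.partialDeriv_monomial (hg : IsFrobBasis q g) (hq : FrobAdd q R)
    (hq0 : (q : R) = 0) (j : Fin n) (c : R) (M : Fin n → ℕ) :
    hg.partialDeriv hq j (c ^ q * ∏ i, g i ^ M i) = c ^ q * dMonomial g j M := by
  classical
  change ∑ I, _ = _
  rw [← exists_frobSum_eq_monomial hq, hg.coeff_frobSum, Finset.sum_eq_single
    (fun i ↦ ⟨M i % q, Nat.mod_lt _ hq.pos⟩), Pi.single_eq_same, mul_pow, mul_assoc,
    dMonomial_mod hq0]
  · intro I _ hI
    rw [Pi.single_eq_of_ne hI, zero_pow hq.pos.ne', zero_mul]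
  · simp

/-- Additivity reduces both factors to monomials with a `q`-th power coefficient, where the rule is
`dMonomial_add`. -/
theorem IsFrobBasis.partialDeriv_mul (hg : IsFrobBasis q g) (hq : FrobAdd q R)
    (hq0 : (q : R) = 0) (j : Fin n) (a b : R) :
    hg.partialDeriv hq j (a * b) = a * hg.partialDeriv hq j b + b * hg.partialDeriv hq j a := by
  have h1 (c : R) (M : Fin n → ℕ) (b : R) : hg.partialDeriv hq j (c ^ q * (∏ i, g i ^ M i) * b) =
      c ^ q * (∏ i, g i ^ M i) * hg.partialDeriv hq j b +
        b * hg.partialDeriv hq j (c ^ q * (∏ i, g i ^ M i)) := by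
    obtain ⟨d, rfl⟩ := hg.2 b
    rw [frobSum, Finset.mul_sum, map_sum, map_sum, Finset.mul_sum, Finset.sum_mul,
      ← Finset.sum_add_distrib]
    refine Finset.sum_congr rfl fun I _ ↦ ?_
    have h2 : c ^ q * (∏ i, g i ^ M i) * (d I ^ q * ∏ i, g i ^ (I i : ℕ)) =
        (c * d I) ^ q * ∏ i, g i ^ ((M + fun i ↦ (I i : ℕ)) i) := by
      simp only [Pi.add_apply, pow_add, Finset.prod_mul_distrib, mul_pow]
      ring
    rw [h2, hg.partialDeriv_monomial hq hq0, dMonomial_add, hg.partialDeriv_monomial hq hq0,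
      hg.partialDeriv_monomial hq hq0 j c M]
    ring
  obtain ⟨c, rfl⟩ := hg.2 a
  rw [frobSum, Finset.sum_mul, map_sum, map_sum, Finset.mul_sum, Finset.sum_mul,
    ← Finset.sum_add_distrib]
  exact Finset.sum_congr rfl fun I _ ↦ h1 _ _ _

theorem IsFrobBasis.partialDeriv_pow (hg : IsFrobBasis q g) (hq : FrobAdd q R)
    (hq0 : (q : R) = 0) (j : Fin n) (a : R) : hg.partialDeriv hq j (a ^ q) = 0 := by
  have := hg.partialDeriv_monomial hq hq0 j a 0
  simpa [dMonomial] using this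

theorem IsFrobBasis.partialDeriv_apply (hg : IsFrobBasis q g) (hq : FrobAdd q R)
    (hq0 : (q : R) = 0) (i j : Fin n) : hg.partialDeriv hq j (g i) = if i = j then 1 else 0 := by
  classical
  have := hg.partialDeriv_monomial hq hq0 j 1 (Pi.single i 1)
  rw [one_pow, one_mul, one_mul, Finset.prod_eq_single i, Pi.single_eq_same, pow_one] at this
  · rw [this, dMonomial]
    split_ifs with h
    · subst h
      rw [Pi.single_eq_same, Finset.prod_eq_one]
      · simp
      · intro k hk
        rw [Pi.single_eq_of_ne (Finset.ne_of_mem_erase hk), pow_zero]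
    · rw [Pi.single_eq_of_ne (Ne.symm h)]; simp
  · intro k _ hk
    rw [Pi.single_eq_of_ne hk, pow_zero]
  · simp

/-- The partial derivative as a derivation over a ring whose elements act as integers. -/
def IsFrobBasis.derivation (hg : IsFrobBasis q g) (hq : FrobAdd q R) (hq0 : (q : R) = 0)
    (B : Type*) [CommRing B] [Algebra B R] (hB : ∀ b : B, ∃ z : ℤ, algebraMap B R b = z)
    (j : Fin n) : Derivation B R R :=
  Derivation.mk'
    { toFun := hg.partialDeriv hq j
      map_add' := map_add _
      map_smul' := fun b x ↦ by
        obtain ⟨z, hz⟩ := hB b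
        rw [Algebra.smul_def, hz, ← zsmul_eq_mul, map_zsmul, zsmul_eq_mul, ← hz, ← Algebra.smul_def]
        rfl }
    (hg.partialDeriv_mul hq hq0 j)

/-- Both sides are derivations in `a`; they agree on the `g i` and vanish on `q`-th powers, where
`d(a ^ q) = q a ^ (q-1) da = 0`. -/
theorem IsFrobBasis.kaehler_d_eq (hg : IsFrobBasis q g) (hq : FrobAdd q R) (hq0 : (q : R) = 0)
    (B : Type*) [CommRing B] [Algebra B R] (a : R) :
    KaehlerDifferential.D B R a =
      ∑ j, hg.partialDeriv hq j a • KaehlerDifferential.D B R (g j) := by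
  classical
  induction a using hg.induction hq with
  | hpow a =>
    rw [Derivation.leibniz_pow, ← Nat.cast_smul_eq_nsmul R, hq0, zero_smul]
    simp [hg.partialDeriv_pow hq hq0]
  | hgen i => simp [hg.partialDeriv_apply hq hq0]
  | hadd a b ha hb => rw [map_add, ha, hb]; simp [add_smul, Finset.sum_add_distrib]
  | hmul a b ha hb =>
    rw [Derivation.leibniz, ha, hb]
    simp only [hg.partialDeriv_mul hq hq0, add_smul, Finset.sum_add_distrib, Finset.smul_sum,
      mul_smul]

/-- The `dgⱼ` span by the previous formula. They are independent because the partial derivatives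
induce linear forms on differentials that are dual to them. -/
theorem IsFrobBasis.kaehler_existsUnique (hg : IsFrobBasis q g) (hq : FrobAdd q R)
    (hq0 : (q : R) = 0) (B : Type*) [CommRing B] [Algebra B R]
    (hB : ∀ b : B, ∃ z : ℤ, algebraMap B R b = z) (s : Ω[R⁄B]) :
    ∃! c : Fin n → R, s = ∑ j, c j • KaehlerDifferential.D B R (g j) := by
  classical
  have hs : s ∈ Submodule.span R (Set.range fun j ↦ KaehlerDifferential.D B R (g j)) := by
    have h : s ∈ (⊤ : Submodule R Ω[R⁄B]) := Submodule.mem_top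
    rw [← KaehlerDifferential.span_range_derivation] at h
    refine Submodule.span_le.2 ?_ h
    rintro _ ⟨a, rfl⟩
    rw [hg.kaehler_d_eq hq hq0 B a]
    exact Submodule.sum_mem _ fun j _ ↦ Submodule.smul_mem _ _ (Submodule.subset_span ⟨j, rfl⟩)
  obtain ⟨c, rfl⟩ := (Submodule.mem_span_range_iff_exists_fun R).1 hs
  refine ⟨c, rfl, fun d hd ↦ funext fun j ↦ ?_⟩
  have := congrArg (hg.derivation hq hq0 B hB j).liftKaehlerDifferential hd
  simp only [map_sum, map_smul, Derivation.liftKaehlerDifferential_comp_D] at this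
  have hval (i : Fin n) : hg.derivation hq hq0 B hB j (g i) = if i = j then 1 else 0 :=
    hg.partialDeriv_apply hq hq0 i j
  simpa [hval] using this.symm

end

/-! ### A determinant identity in characteristic `p` -/

/-- The ring homomorphism from `ZMod p` to a ring in which `p = 0`. -/
def zmodHom {p : ℕ} {S : Type*} [CommRing S] (hS : (p : S) = 0) : ZMod p →+* S :=
  haveI := (CharP.exists S).choose_spec
  ZMod.castHom ((CharP.cast_eq_zero_iff S (CharP.exists S).choose p).1 hS) S

/-- In the domain `𝔽_p[X, Y]` both sides become `Y ^ q - X ^ q` after multiplication by `Y - X`; the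
identity is then specialized. Here `k.rev` is `q - 1 - k`. -/
theorem sub_pow_sub_one_eq_sum {p : ℕ} [Fact p.Prime] {S : Type*} [CommRing S] (hS : (p : S) = 0)
    (e : ℕ) (x y : S) :
    (y - x) ^ (p ^ e - 1) = ∑ k : Fin (p ^ e), x ^ (k.rev : ℕ) * y ^ (k : ℕ) := by
  have hpos : 0 < p ^ e := pow_pos (Fact.out : p.Prime).pos e
  let A := MvPolynomial (Fin 2) (ZMod p)
  have hA : (p : A) = 0 := CharP.cast_eq_zero A p
  let X : A := MvPolynomial.X 0
  let Y : A := MvPolynomial.X 1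
  have hXY : Y - X ≠ 0 := sub_ne_zero.2 fun h ↦ by
    simpa using MvPolynomial.X_injective h
  have key : (Y - X) ^ (p ^ e - 1) = ∑ k : Fin (p ^ e), X ^ (k.rev : ℕ) * Y ^ (k : ℕ) := by
    refine mul_right_cancel₀ hXY ?_
    rw [← pow_succ, Nat.sub_add_cancel hpos, (FrobAdd.of_natCast_eq_zero hA e).sub_pow,
      ← Commute.geom_sum₂_mul (Commute.all Y X), ← Fin.sum_univ_eq_sum_range
        fun k ↦ Y ^ k * X ^ (p ^ e - 1 - k)]
    congr 1
    refine Finset.sum_congr rfl fun k _ ↦ ?_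
    rw [mul_comm, Fin.val_rev, Nat.sub_sub, add_comm 1]
  have := congrArg (MvPolynomial.eval₂Hom (zmodHom hS) ![x, y]) key
  simpa only [X, Y, map_pow, map_sub, map_sum, map_mul, MvPolynomial.eval₂Hom_X',
    Matrix.cons_val_zero, Matrix.cons_val_one] using this

/-- Over a field every matrix is a product of diagonal matrices and transvections. The identity is
multiplicative because the new variables again have vanishing `q`-th power. -/
theorem prod_pow_det_of_field {q : ℕ} {K S : Type*} [Field K] [CommRing S] [Algebra K S]
    (hq : FrobAdd q S) {n : ℕ} (A : Matrix (Fin n) (Fin n) K) (x : Fin n → S)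
    (hx : ∀ j, x j ^ q = 0) :
    ∏ i, (∑ j, algebraMap K S (A i j) * x j) ^ (q - 1) =
      algebraMap K S A.det ^ (q - 1) * ∏ j, x j ^ (q - 1) := by
  classical
  have hq1 : q - 1 + 1 = q := Nat.sub_add_cancel hq.pos
  induction A using Matrix.diagonal_transvection_induction generalizing x with
  | hdiag D _ =>
    have h (i : Fin n) : ∑ j, algebraMap K S (Matrix.diagonal D i j) * x j =
        algebraMap K S (D i) * x i := by
      rw [Finset.sum_eq_single i]
      · rw [Matrix.diagonal_apply_eq]
      · intro j _ hj
        rw [Matrix.diagonal_apply_ne _ hj.symm, map_zero, zero_mul]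
      · simp
    simp only [h, mul_pow, Finset.prod_mul_distrib, Matrix.det_diagonal, map_prod,
      Finset.prod_pow]
  | htransvec t =>
    rw [Matrix.TransvectionStruct.det, map_one, one_pow, one_mul]
    have h (k : Fin n) : ∑ j, algebraMap K S (t.toMatrix k j) * x j =
        x k + if k = t.i then algebraMap K S t.c * x t.j else 0 := by
      simp only [Matrix.TransvectionStruct.toMatrix, Matrix.transvection, Matrix.add_apply,
        map_add, add_mul, Finset.sum_add_distrib]
      congr 1
      · rw [Finset.sum_eq_single k]
        · simp
        · intro j _ hj
          rw [Matrix.one_apply_ne hj.symm, map_zero, zero_mul]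
        · simp
      · split_ifs with hk
        · subst hk
          rw [Finset.sum_eq_single t.j]
          · simp
          · intro j _ hj
            simp [Matrix.single, hj.symm]
          · simp
        · refine Finset.sum_eq_zero fun j _ ↦ ?_
          simp [Matrix.single, Ne.symm hk]
    simp only [h]
    rw [← Finset.mul_prod_erase _ _ (Finset.mem_univ t.i),
      ← Finset.mul_prod_erase _ (fun j ↦ x j ^ (q - 1)) (Finset.mem_univ t.i)]
    have h1 : ∏ k ∈ Finset.univ.erase t.i,
        (x k + if k = t.i then algebraMap K S t.c * x t.j else 0) ^ (q - 1) =
        ∏ k ∈ Finset.univ.erase t.i, x k ^ (q - 1) := by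
      refine Finset.prod_congr rfl fun k hk ↦ ?_
      rw [if_neg (Finset.ne_of_mem_erase hk), add_zero]
    rw [h1, if_pos rfl, ← Finset.mul_prod_erase (Finset.univ.erase t.i) _
      (Finset.mem_erase.2 ⟨t.hij.symm, Finset.mem_univ t.j⟩), ← mul_assoc, ← mul_assoc]
    congr 1
    -- Adding `c * x t.j` to `x t.i` changes its `(q-1)`-st power by a multiple of `x t.j`, which is
    -- killed by the factor `x t.j ^ (q-1)`.
    rw [← sub_eq_zero, ← sub_mul]
    obtain ⟨b, hb⟩ := sub_dvd_pow_sub_pow (x t.i + algebraMap K S t.c * x t.j) (x t.i) (q - 1)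
    rw [hb, add_sub_cancel_left]
    calc _ = algebraMap K S t.c * b * x t.j ^ (q - 1 + 1) := by ring
      _ = 0 := by rw [hq1, hx, mul_zero]
  | hmul A B hA hB =>
    let y (i : Fin n) : S := ∑ j, algebraMap K S (B i j) * x j
    have hy (i : Fin n) : y i ^ q = 0 := by
      rw [hq.sum_pow]
      exact Finset.sum_eq_zero fun j _ ↦ by rw [mul_pow, hx, mul_zero]
    have h (i : Fin n) : ∑ j, algebraMap K S ((A * B) i j) * x j =
        ∑ j, algebraMap K S (A i j) * y j := by
      simp only [Matrix.mul_apply, map_sum, map_mul, y, Finset.sum_mul, Finset.mul_sum]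
      rw [Finset.sum_comm]
      simp only [mul_assoc]
    simp only [h]
    rw [hA y hy, hB x hx, Matrix.det_mul, map_mul, mul_pow, mul_assoc]

/-- In characteristic `p`, elements `xⱼ` with `xⱼ ^ q = 0` satisfy
`∏ᵢ (∑ⱼ sᵢⱼ xⱼ) ^ (q - 1) = det(s) ^ (q - 1) ∏ⱼ xⱼ ^ (q - 1)`. -/
theorem prod_pow_det {p : ℕ} [Fact p.Prime] {S : Type*} [CommRing S] (hS : (p : S) = 0)
    (e : ℕ) {n : ℕ} (s : Matrix (Fin n) (Fin n) S) (x : Fin n → S) (hx : ∀ j, x j ^ p ^ e = 0) :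
    ∏ i, (∑ j, s i j * x j) ^ (p ^ e - 1) = s.det ^ (p ^ e - 1) * ∏ j, x j ^ (p ^ e - 1) := by
  classical
  -- The universal case: a generic matrix over `𝔽_p[sᵢⱼ]` and generic variables, with the identity
  -- required modulo the ideal generated by the `Xⱼ ^ q`. Over the fraction field `K` the field case
  -- applies.
  let R₀ := MvPolynomial (Fin n × Fin n) (ZMod p)
  let K := FractionRing R₀
  let M : Matrix (Fin n) (Fin n) R₀ := Matrix.of fun i j ↦ MvPolynomial.X (i, j)
  let G : MvPolynomial (Fin n) R₀ :=
    ∏ i, (∑ j, MvPolynomial.C (M i j) * MvPolynomial.X j) ^ (p ^ e - 1) -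
      MvPolynomial.C M.det ^ (p ^ e - 1) * ∏ j, MvPolynomial.X j ^ (p ^ e - 1)
  let E : Set (Fin n →₀ ℕ) := Set.range fun j ↦ Finsupp.single j (p ^ e)
  let I : Ideal (MvPolynomial (Fin n) K) :=
    Ideal.span ((fun s ↦ MvPolynomial.monomial s (1 : K)) '' E)
  have hmap : MvPolynomial.map (algebraMap R₀ K) G ∈ I := by
    rw [← Ideal.Quotient.eq_zero_iff_mem]
    have hQ : (p : MvPolynomial (Fin n) K ⧸ I) = 0 := by
      have h1 : (p : R₀) = 0 := CharP.cast_eq_zero R₀ p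
      have h2 := congrArg (algebraMap R₀ K) h1
      rw [map_natCast, map_zero] at h2
      have h3 := congrArg (algebraMap K (MvPolynomial (Fin n) K ⧸ I)) h2
      rwa [map_natCast, map_zero] at h3
    have h := prod_pow_det_of_field (K := K) (FrobAdd.of_natCast_eq_zero hQ e)
      (M.map (algebraMap R₀ K)) (fun j ↦ Ideal.Quotient.mk I (MvPolynomial.X j)) (fun j ↦ by
        rw [← map_pow, Ideal.Quotient.eq_zero_iff_mem]
        refine Ideal.subset_span ⟨_, ⟨j, rfl⟩, ?_⟩
        rw [MvPolynomial.X_pow_eq_monomial])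
    rw [← RingHom.mapMatrix_apply, ← RingHom.map_det] at h
    have hC (a : K) : algebraMap K (MvPolynomial (Fin n) K ⧸ I) a =
      Ideal.Quotient.mk I (MvPolynomial.C a) := rfl
    simp only [hC, ← map_mul, ← map_sum, ← map_pow, ← map_prod] at h
    rw [← sub_eq_zero, ← map_sub] at h
    refine Eq.trans (congrArg _ ?_) h
    simp [G]
  -- Membership in a monomial ideal depends only on the support, so it descends from `K` to `R₀`.
  have hG : G ∈ Ideal.span ((fun s ↦ MvPolynomial.monomial s (1 : R₀)) '' E) := by
    rw [MvPolynomial.mem_ideal_span_monomial_image] at hmap ⊢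
    rwa [MvPolynomial.support_map_of_injective _ (IsFractionRing.injective R₀ K)] at hmap
  let φ : R₀ →+* S := MvPolynomial.eval₂Hom (zmodHom hS) fun ij ↦ s ij.1 ij.2
  let ψ : MvPolynomial (Fin n) R₀ →+* S := MvPolynomial.eval₂Hom φ x
  have hker : G ∈ RingHom.ker ψ := by
    refine (Ideal.span_le.2 ?_) hG
    rintro _ ⟨_, ⟨j, rfl⟩, rfl⟩
    change ψ (MvPolynomial.monomial (Finsupp.single j (p ^ e)) 1) = 0
    rw [← MvPolynomial.X_pow_eq_monomial, map_pow, MvPolynomial.eval₂Hom_X', hx]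
  have hM : φ.mapMatrix M = s := by
    ext i j
    exact MvPolynomial.eval₂Hom_X' _ _ _
  rw [RingHom.mem_ker] at hker
  rw [← sub_eq_zero, ← hker, ← hM, ← RingHom.map_det]
  simp only [G, ψ, map_sub, map_prod, map_pow, map_sum, map_mul, MvPolynomial.eval₂Hom_X',
    MvPolynomial.eval₂Hom_C]
  rfl

/-! ### The pairing of the Cartier module with powers of the diagonal ideal -/

section

variable {p : ℕ} [Fact p.Prime] {R : Type*} [CommRing R] (hR : (p : R) = 0) (e : ℕ)

/-- The map `x ⊗ y ↦ x * C(y) ^ q`. -/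
def frobTensor (C : R →+ R) : R ⊗[ℤ] R →+ R :=
  (LinearMap.mul' ℤ R ∘ₗ TensorProduct.map LinearMap.id
    ((powHom hR e).toAddMonoidHom.comp C).toIntLinearMap).toAddMonoidHom

theorem frobTensor_tmul (C : R →+ R) (x y : R) :
    frobTensor hR e C (x ⊗ₜ[ℤ] y) = x * C y ^ p ^ e := rfl

theorem frobTensor_mul_left (C : R →+ R) (a : R) (z : R ⊗[ℤ] R) :
    frobTensor hR e C (a ⊗ₜ 1 * z) = a * frobTensor hR e C z := by
  induction z using TensorProduct.induction_on with
  | zero => simp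
  | tmul x y => rw [Algebra.TensorProduct.tmul_mul_tmul, one_mul, frobTensor_tmul, frobTensor_tmul,
      mul_assoc]
  | add x y hx hy => rw [mul_add, map_add, map_add, mul_add, hx, hy]

theorem frobTensor_mul_right (C : R →+ R) (a : R) (z : R ⊗[ℤ] R) :
    frobTensor hR e C (1 ⊗ₜ a * z) = frobTensor hR e (C.comp (AddMonoidHom.mulLeft a)) z := by
  induction z using TensorProduct.induction_on with
  | zero => simp
  | tmul x y => rw [Algebra.TensorProduct.tmul_mul_tmul, one_mul, frobTensor_tmul, frobTensor_tmul]
                rfl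
  | add x y hx hy => rw [mul_add, map_add, map_add, hx, hy]

/-- The power `(∏ (1 ⊗ gᵢ - gᵢ ⊗ 1)) ^ k`. -/
def diagonalPow {n : ℕ} (g : Fin n → R) (k : ℕ) : R ⊗[ℤ] R :=
  (∏ i, ((1 : R) ⊗ₜ[ℤ] g i - g i ⊗ₜ[ℤ] (1 : R))) ^ k

theorem prod_tmul_prod {n : ℕ} (a b : Fin n → R) :
    ∏ i, a i ⊗ₜ[ℤ] b i = (∏ i, a i) ⊗ₜ[ℤ] (∏ i, b i) := by
  classical
  have (s : Finset (Fin n)) : ∏ i ∈ s, a i ⊗ₜ[ℤ] b i = (∏ i ∈ s, a i) ⊗ₜ[ℤ] (∏ i ∈ s, b i) := by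
    induction s using Finset.induction_on with
    | empty => simp [Algebra.TensorProduct.one_def]
    | insert i s hi ih =>
      rw [Finset.prod_insert hi, Finset.prod_insert hi, Finset.prod_insert hi, ih,
        Algebra.TensorProduct.tmul_mul_tmul]
  exact this _

/-- Each factor `(1 ⊗ gᵢ - gᵢ ⊗ 1) ^ (q-1)` expands without signs or binomial coefficients, pairing
complementary exponents. The coefficients of the result are thus the values of `C` at the monomials
with exponents below `q`. -/
theorem frobTensor_diagonalPow (C : R →+ R) {n : ℕ} (g : Fin n → R) :
    frobTensor hR e C (diagonalPow g (p ^ e - 1)) =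
      frobSum (p ^ e) g fun I ↦ C (∏ i, g i ^ ((I i).rev : ℕ)) := by
  have hRR : (p : R ⊗[ℤ] R) = 0 := by
    rw [← map_natCast (Algebra.TensorProduct.includeLeftRingHom (R := ℤ) (A := R) (B := R)), hR,
      map_zero]
  have h : diagonalPow g (p ^ e - 1) = ∑ I : Fin n → Fin (p ^ e),
      (∏ i, g i ^ ((I i).rev : ℕ)) ⊗ₜ[ℤ] (∏ i, g i ^ (I i : ℕ)) := by
    rw [diagonalPow, ← Finset.prod_pow]
    simp only [sub_pow_sub_one_eq_sum hRR]
    rw [Finset.prod_univ_sum, Fintype.piFinset_univ]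
    refine Finset.sum_congr rfl fun I _ ↦ ?_
    simp only [Algebra.TensorProduct.tmul_pow, one_pow, Algebra.TensorProduct.tmul_mul_tmul,
      one_mul, mul_one]
    rw [prod_tmul_prod]
  rw [h, map_sum, frobSum, ← (Equiv.piCongrRight fun _ : Fin n ↦ @Fin.revPerm (p ^ e)).sum_comp]
  refine Finset.sum_congr rfl fun I _ ↦ ?_
  rw [frobTensor_tmul, mul_comm]
  simp [Fin.revPerm_apply]

variable {n : ℕ} {g : Fin n → R} (hg : IsFrobBasis (p ^ e) g)

/-- The coefficients of the image of the diagonal power are the values of `C` on the basis, in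
reversed order, so this single element determines `C`. Together with `frobTensor_dualMap` it gives a
bijection between such `C` and `R`. -/
theorem IsFrobBasis.apply_eq_sum (C : R →+ R) (hC : ∀ a b, C (a ^ p ^ e * b) = a * C b) (b : R) :
    C b = ∑ I, hg.coeff b I *
      hg.coeff (frobTensor hR e C (diagonalPow g (p ^ e - 1))) (fun i ↦ (I i).rev) := by
  rw [frobTensor_diagonalPow, hg.coeff_frobSum]
  conv_lhs => rw [← hg.frobSum_coeff b, frobSum, map_sum]
  refine Finset.sum_congr rfl fun I _ ↦ ?_
  simp only [hC, Fin.rev_rev]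

/-- The additive map with given image of the diagonal power. -/
def IsFrobBasis.dualMap (t : R) : R →+ R where
  toFun b := ∑ I, hg.coeff b I * hg.coeff t (fun i ↦ (I i).rev)
  map_zero' := by
    have h := hg.coeff_frobSum 0
    rw [frobSum_zero (FrobAdd.of_natCast_eq_zero hR e)] at h
    simp [h]
  map_add' a b := by
    simp only [hg.coeff_add (FrobAdd.of_natCast_eq_zero hR e), Pi.add_apply, add_mul,
      Finset.sum_add_distrib]

theorem IsFrobBasis.dualMap_pow_mul (t a b : R) :
    hg.dualMap hR e t (a ^ p ^ e * b) = a * hg.dualMap hR e t b := by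
  change ∑ I, _ = _ * ∑ I, _
  simp only [hg.coeff_pow_mul, Pi.smul_apply, smul_eq_mul, Finset.mul_sum, mul_assoc]

theorem IsFrobBasis.dualMap_monomial (t : R) (I : Fin n → Fin (p ^ e)) :
    hg.dualMap hR e t (∏ i, g i ^ (I i : ℕ)) = hg.coeff t fun i ↦ (I i).rev := by
  classical
  change ∑ I, _ = _
  have h := frobSum_single (FrobAdd.of_natCast_eq_zero hR e) (g := g) I 1
  rw [one_pow, one_mul] at h
  rw [← h, hg.coeff_frobSum, Finset.sum_eq_single I]
  · simp
  · intro J _ hJ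
    rw [Pi.single_eq_of_ne hJ, zero_mul]
  · simp

theorem IsFrobBasis.frobTensor_dualMap (t : R) :
    frobTensor hR e (hg.dualMap hR e t) (diagonalPow g (p ^ e - 1)) = t := by
  rw [frobTensor_diagonalPow]
  conv_rhs => rw [← hg.frobSum_coeff t]
  congr 1
  funext I
  rw [hg.dualMap_monomial hR e t fun i ↦ (I i).rev]
  simp only [Fin.rev_rev]

/-- The ideal of `R ⊗ R` generated by the elements `a ^ q ⊗ 1 - 1 ⊗ a ^ q`. -/
def frobIdeal (q : ℕ) (R : Type*) [CommRing R] : Ideal (R ⊗[ℤ] R) :=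
  Ideal.span (Set.range fun a : R ↦ (a ^ q) ⊗ₜ[ℤ] (1 : R) - (1 : R) ⊗ₜ[ℤ] (a ^ q))

/-- The map is balanced over `q`-th powers: `C(a ^ q y) ^ q = a ^ q C(y) ^ q`. Computations may
therefore be made in `FrobQuot`. -/
theorem frobTensor_eq_zero (C : R →+ R) (hC : ∀ a b, C (a ^ p ^ e * b) = a * C b)
    {z : R ⊗[ℤ] R} (hz : z ∈ frobIdeal (p ^ e) R) : frobTensor hR e C z = 0 := by
  -- The map is not linear over `R ⊗ R`, so the induction over the ideal carries an arbitrary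
  -- multiplier `w`.
  suffices h : ∀ w, frobTensor hR e C (w * z) = 0 by simpa using h 1
  induction hz using Submodule.span_induction with
  | zero => simp
  | add x y _ _ hx hy => intro w; rw [mul_add, map_add, hx, hy, add_zero]
  | mem x hx =>
    obtain ⟨a, rfl⟩ := hx
    intro w
    induction w using TensorProduct.induction_on with
    | zero => simp
    | tmul x y =>
      rw [mul_sub, map_sub, Algebra.TensorProduct.tmul_mul_tmul,
        Algebra.TensorProduct.tmul_mul_tmul, frobTensor_tmul, frobTensor_tmul, mul_comm y (a ^ p ^ e),
        hC, mul_one, mul_one, mul_pow]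
      ring
    | add x y hx hy => rw [add_mul, map_add, hx, hy, add_zero]
  | smul w x _ hx => intro v; rw [smul_eq_mul, ← mul_assoc]; exact hx _

/-- The quotient of `R ⊗ R` by the elements `a ^ q ⊗ 1 - 1 ⊗ a ^ q`. -/
def FrobQuot (q : ℕ) (R : Type*) [CommRing R] : Type _ := R ⊗[ℤ] R ⧸ frobIdeal q R

instance (q : ℕ) (R : Type*) [CommRing R] : CommRing (FrobQuot q R) :=
  inferInstanceAs (CommRing (R ⊗[ℤ] R ⧸ frobIdeal q R))

/-- The quotient map. -/
def frobQuotMk (q : ℕ) (R : Type*) [CommRing R] : R ⊗[ℤ] R →+* FrobQuot q R :=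
  Ideal.Quotient.mk (frobIdeal q R)

/-- The class of `a ⊗ 1`. -/
def leftMk (q : ℕ) (R : Type*) [CommRing R] : R →+* FrobQuot q R :=
  (frobQuotMk q R).comp Algebra.TensorProduct.includeLeftRingHom

/-- The class of `1 ⊗ a`. -/
def rightMk (q : ℕ) (R : Type*) [CommRing R] : R →+* FrobQuot q R :=
  (frobQuotMk q R).comp (Algebra.TensorProduct.includeRight (R := ℤ) (A := R)).toRingHom

theorem rightMk_pow (q : ℕ) (a : R) : rightMk q R (a ^ q) = leftMk q R (a ^ q) :=
  (Ideal.Quotient.eq (I := frobIdeal q R) |>.2 (Ideal.subset_span ⟨a, rfl⟩)).symm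

theorem frobTensor_eq_of_mk_eq (C : R →+ R) (hC : ∀ a b, C (a ^ p ^ e * b) = a * C b)
    {z w : R ⊗[ℤ] R} (h : frobQuotMk (p ^ e) R z = frobQuotMk (p ^ e) R w) :
    frobTensor hR e C z = frobTensor hR e C w := by
  rw [← sub_eq_zero, ← map_sub]
  exact frobTensor_eq_zero hR e C hC (Ideal.Quotient.eq.1 h)

theorem mk_diagonalPow (q : ℕ) (h : Fin n → R) (k : ℕ) :
    frobQuotMk q R (diagonalPow h k) = ∏ i, (rightMk q R (h i) - leftMk q R (h i)) ^ k := by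
  rw [diagonalPow, map_pow, map_prod, Finset.prod_pow]
  simp only [map_sub]
  rfl

variable {Q : Type*} [CommRing Q] (l r : R →+* Q)

theorem sub_pow_eq_zero (hlr : ∀ a, r (a ^ p ^ e) = l (a ^ p ^ e))
    (hR : (p : R) = 0) (a : R) : (r a - l a) ^ p ^ e = 0 := by
  have hQ : (p : Q) = 0 := by rw [← map_natCast l, hR, map_zero]
  rw [(FrobAdd.of_natCast_eq_zero hQ e).sub_pow, ← map_pow, ← map_pow, hlr, sub_self]

/-- A first-order Taylor expansion along the diagonal, proved by the induction principle of a
`q`-basis: `q`-th powers have zero difference, and products follow from `r(ab) - l(ab) = r(a)(r(b) -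
l(b)) + l(b)(r(a) - l(a))`. -/
theorem IsFrobBasis.exists_diag_eq (hlr : ∀ a, r (a ^ p ^ e) = l (a ^ p ^ e))
    (a : R) (hq0 : ((p ^ e : ℕ) : R) = 0) :
    ∃ s : Fin n → Q, r a - l a = ∑ j, s j * (r (g j) - l (g j)) ∧
      ∀ j, s j - l (hg.partialDeriv (FrobAdd.of_natCast_eq_zero hR e) j a) ∈
        Ideal.span (Set.range fun j ↦ r (g j) - l (g j)) := by
  classical
  have hq := FrobAdd.of_natCast_eq_zero hR e
  induction a using hg.induction hq with
  | hpow a =>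
    exact ⟨0, by simp only [hlr, sub_self, Pi.zero_apply, zero_mul, Finset.sum_const_zero],
      by simp [hg.partialDeriv_pow hq hq0]⟩
  | hgen i =>
    refine ⟨fun j ↦ if i = j then 1 else 0, by simp, fun j ↦ ?_⟩
    rw [hg.partialDeriv_apply hq hq0]
    split_ifs with h <;> simp [h]
  | hadd a b ha hb =>
    obtain ⟨s, hs, hs'⟩ := ha
    obtain ⟨t, ht, ht'⟩ := hb
    refine ⟨s + t, ?_, fun j ↦ ?_⟩
    · simp only [map_add, Pi.add_apply, add_mul, Finset.sum_add_distrib, ← hs, ← ht]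
      ring
    · rw [map_add, map_add, Pi.add_apply, add_sub_add_comm]
      exact add_mem (hs' j) (ht' j)
  | hmul a b ha hb =>
    obtain ⟨s, hs, hs'⟩ := ha
    obtain ⟨t, ht, ht'⟩ := hb
    refine ⟨fun j ↦ r a * t j + l b * s j, ?_, fun j ↦ ?_⟩
    · simp only [add_mul, Finset.sum_add_distrib, mul_assoc, ← Finset.mul_sum, ← hs, ← ht]
      rw [map_mul, map_mul]
      ring
    · rw [hg.partialDeriv_mul hq hq0, map_add, map_mul, map_mul]
      have h1 : r a - l a ∈ Ideal.span (Set.range fun j ↦ r (g j) - l (g j)) := by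
        rw [hs]
        exact sum_mem fun j _ ↦ Ideal.mul_mem_left _ _ (Ideal.subset_span ⟨j, rfl⟩)
      -- The error for a product is the sum of the errors for `a` and `b` plus the correction for
      -- replacing `r a` by `l a` in front of the derivative of `b`.
      have h2 := add_mem (add_mem (Ideal.mul_mem_left _ (r a) (ht' j))
        (Ideal.mul_mem_left _ (l b) (hs' j)))
        (Ideal.mul_mem_left _ (l (hg.partialDeriv hq j b)) h1)
      convert h2 using 1
      ring

/-- Each generator raises one factor of the product to the power `q`, where it vanishes. -/
theorem mem_span_mul_eq_zero (hlr : ∀ a, r (a ^ p ^ e) = l (a ^ p ^ e))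
    (g : Fin n → R) {x : Q} (hR : (p : R) = 0)
    (hx : x ∈ Ideal.span (Set.range fun j ↦ r (g j) - l (g j))) :
    x * ∏ j, (r (g j) - l (g j)) ^ (p ^ e - 1) = 0 := by
  classical
  have hpos : 0 < p ^ e := pow_pos (Fact.out : p.Prime).pos e
  induction hx using Submodule.span_induction with
  | zero => exact zero_mul _
  | add x y _ _ hx hy => rw [add_mul, hx, hy, add_zero]
  | mem x hx =>
    obtain ⟨j, rfl⟩ := hx
    rw [← Finset.mul_prod_erase _ _ (Finset.mem_univ j), ← mul_assoc, ← pow_succ',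
      Nat.sub_add_cancel hpos, sub_pow_eq_zero e l r hlr hR, zero_mul]
  | smul w x _ hx => rw [smul_eq_mul, mul_assoc, hx, mul_zero]

theorem IsFrobBasis.sub_mul_prod_eq_zero (hg : IsFrobBasis (p ^ e) g)
    (hR : (p : R) = 0) (hlr : ∀ a, r (a ^ p ^ e) = l (a ^ p ^ e))
    (hq0 : ((p ^ e : ℕ) : R) = 0) (a : R) :
    (r a - l a) * ∏ j, (r (g j) - l (g j)) ^ (p ^ e - 1) = 0 := by
  refine mem_span_mul_eq_zero e l r hlr g hR ?_
  obtain ⟨s, hs, -⟩ := hg.exists_diag_eq hR e l r hlr a hq0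
  rw [hs]
  exact sum_mem fun j _ ↦ Ideal.mul_mem_left _ _ (Ideal.subset_span ⟨j, rfl⟩)

/-- `prod_pow_det` gives the formula with the determinant of the Taylor coefficients. These agree
with the partial derivatives modulo the ideal that annihilates the product. -/
theorem IsFrobBasis.prod_pow_eq_det (hlr : ∀ a, r (a ^ p ^ e) = l (a ^ p ^ e))
    (hq0 : ((p ^ e : ℕ) : R) = 0) (h : Fin n → R) :
    ∏ i, (r (h i) - l (h i)) ^ (p ^ e - 1) =
      l ((Matrix.of fun i j ↦ hg.partialDeriv (FrobAdd.of_natCast_eq_zero hR e) j (h i)).det ^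
        (p ^ e - 1)) * ∏ j, (r (g j) - l (g j)) ^ (p ^ e - 1) := by
  classical
  have hQ : (p : Q) = 0 := by rw [← map_natCast l, hR, map_zero]
  choose s hs hs' using fun i ↦ hg.exists_diag_eq hR e l r hlr (h i) hq0
  have h1 := prod_pow_det hQ e (Matrix.of s) (fun j ↦ r (g j) - l (g j)) fun j ↦
    sub_pow_eq_zero e l r hlr hR (g j)
  simp only [Matrix.of_apply, ← hs] at h1
  rw [h1, ← sub_eq_zero, ← sub_mul]
  refine mem_span_mul_eq_zero e l r hlr g hR ?_
  rw [← Ideal.Quotient.eq_zero_iff_mem, map_sub, sub_eq_zero, map_pow, RingHom.map_det, map_pow,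
    map_pow, RingHom.map_det, RingHom.map_det]
  congr 2
  ext i j
  exact Ideal.Quotient.eq.2 (hs' i j)

end

section

variable {p : ℕ} [Fact p.Prime] {R : Type*} [CommRing R] (hR : (p : R) = 0) (e : ℕ)
  {n : ℕ} {g : Fin n → R} (hg : IsFrobBasis (p ^ e) g)

/-- Left and right multiplication by `a` agree on the diagonal power modulo `frobIdeal`. This makes
the identification of Cartier sections with functions linear for the action `(a • C)(b) = C(a b)`.
-/
theorem IsFrobBasis.frobTensor_comp_mulLeft (hg : IsFrobBasis (p ^ e) g) (C : R →+ R)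
    (hC : ∀ a b, C (a ^ p ^ e * b) = a * C b) (hq0 : ((p ^ e : ℕ) : R) = 0) (a : R) :
    frobTensor hR e (C.comp (AddMonoidHom.mulLeft a)) (diagonalPow g (p ^ e - 1)) =
      a * frobTensor hR e C (diagonalPow g (p ^ e - 1)) := by
  rw [← frobTensor_mul_right, ← frobTensor_mul_left]
  refine frobTensor_eq_of_mk_eq hR e C hC ?_
  rw [map_mul, map_mul, ← sub_eq_zero, ← sub_mul, mk_diagonalPow]
  exact hg.sub_mul_prod_eq_zero e (leftMk _ R) (rightMk _ R) hR (rightMk_pow _) hq0 a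

theorem IsFrobBasis.frobTensor_diagonalPow_eq_det (C : R →+ R)
    (hC : ∀ a b, C (a ^ p ^ e * b) = a * C b) (hq0 : ((p ^ e : ℕ) : R) = 0) (h : Fin n → R) :
    frobTensor hR e C (diagonalPow h (p ^ e - 1)) =
      (Matrix.of fun i j ↦ hg.partialDeriv (FrobAdd.of_natCast_eq_zero hR e) j (h i)).det ^
        (p ^ e - 1) * frobTensor hR e C (diagonalPow g (p ^ e - 1)) := by
  rw [← frobTensor_mul_left]
  refine frobTensor_eq_of_mk_eq hR e C hC ?_
  rw [map_mul, mk_diagonalPow, mk_diagonalPow]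
  exact hg.prod_pow_eq_det hR e (leftMk _ R) (rightMk _ R) (rightMk_pow _) hq0 h

end

/-! ### Sections of sheaves of modules -/

section

variable {X : Scheme.{u}}

/-- Restriction of functions. -/
def resO {V U : X.Opens} (h : V ≤ U) : Γ(X, U) →+* Γ(X, V) := (X.presheaf.map (homOfLE h).op).hom

/-- Restriction of sections. -/
def resM (M : X.Modules) {V U : X.Opens} (h : V ≤ U) : Γ(M, U) →+ Γ(M, V) :=
  (M.presheaf.map (homOfLE h).op).hom

/-- Restriction of sections of a presheaf of modules. -/
def resP (P : PreMod X) {V U : X.Opens} (h : V ≤ U) : P.obj (op U) →+ P.obj (op V) :=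
  AddMonoidHom.mk' (P.map (homOfLE h).op) (map_add (P.map (homOfLE h).op).hom)

theorem resO_resO {W V U : X.Opens} (h : V ≤ U) (h' : W ≤ V) (a : Γ(X, U)) :
    resO h' (resO h a) = resO (h'.trans h) a := by
  change X.presheaf.map _ (X.presheaf.map _ a) = X.presheaf.map _ a
  rw [← ConcreteCategory.comp_apply, ← X.presheaf.map_comp]
  rfl

theorem resO_self {U : X.Opens} (h : U ≤ U) (a : Γ(X, U)) : resO h a = a :=
  congrArg (fun φ ↦ φ.hom a) (X.presheaf.map_id (op U))

theorem resM_resM (M : X.Modules) {W V U : X.Opens} (h : V ≤ U) (h' : W ≤ V) (a : Γ(M, U)) :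
    resM M h' (resM M h a) = resM M (h'.trans h) a := by
  change M.presheaf.map _ (M.presheaf.map _ a) = M.presheaf.map _ a
  rw [← ConcreteCategory.comp_apply, ← M.presheaf.map_comp]
  rfl

theorem resM_self (M : X.Modules) {U : X.Opens} (h : U ≤ U) (a : Γ(M, U)) : resM M h a = a :=
  congrArg (fun φ ↦ φ.hom a) (M.presheaf.map_id (op U))

theorem resM_smul (M : X.Modules) {V U : X.Opens} (h : V ≤ U) (a : Γ(X, U)) (s : Γ(M, U)) :
    resM M h (a • s) = resO h a • resM M h s :=
  Scheme.Modules.map_smul M (homOfLE h) a s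

theorem resP_smul (P : PreMod X) {V U : X.Opens} (h : V ≤ U) (a : Γ(X, U)) (s : P.obj (op U)) :
    resP P h (a • s) = resO h a • resP P h s :=
  P.map_smul (homOfLE h).op a s

theorem resP_resP (P : PreMod X) {W V U : X.Opens} (h : V ≤ U) (h' : W ≤ V) (a : P.obj (op U)) :
    resP P h' (resP P h a) = resP P (h'.trans h) a :=
  (P.map_comp_apply (homOfLE h).op (homOfLE h').op a).symm

theorem resP_self (P : PreMod X) {U : X.Opens} (h : U ≤ U) (a : P.obj (op U)) : resP P h a = a :=
  congrArg (fun φ ↦ φ.hom a) (P.map_id (op U))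

theorem app_resM {M N : X.Modules} (φ : M ⟶ N) {V U : X.Opens} (h : V ≤ U) (s : Γ(M, U)) :
    φ.app V (resM M h s) = resM N h (φ.app U s) :=
  congrArg (fun f ↦ f.hom s) (φ.mapPresheaf.naturality (homOfLE h).op)

theorem resM_ext (M : X.Modules) {U : X.Opens} {s t : Γ(M, U)}
    (h : ∀ x ∈ U, ∃ (V : X.Opens) (hV : V ≤ U), x ∈ V ∧ resM M hV s = resM M hV t) : s = t := by
  choose V hV hx hst using h
  let sh : TopCat.Sheaf Ab X := ⟨M.presheaf, M.isSheaf⟩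
  exact sh.eq_of_locally_eq' (fun x : U ↦ V x.1 x.2) U (fun x ↦ homOfLE (hV x.1 x.2))
    (fun x hxU ↦ Opens.mem_iSup.2 ⟨⟨x, hxU⟩, hx x hxU⟩) s t fun x ↦ hst x.1 x.2

theorem resO_ext {U : X.Opens} {s t : Γ(X, U)}
    (h : ∀ x ∈ U, ∃ (V : X.Opens) (hV : V ≤ U), x ∈ V ∧ resO hV s = resO hV t) : s = t :=
  resM_ext (structureModule X) (s := s) (t := t) h

/-- Sections characterized by a local property glue. -/
theorem resM_glue (M : X.Modules) {U : X.Opens} (P : ∀ V : X.Opens, V ≤ U → Γ(M, V) → Prop)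
    (hres : ∀ (V W : X.Opens) (hV : V ≤ U) (hW : W ≤ V) (s : Γ(M, V)), P V hV s →
      P W (hW.trans hV) (resM M hW s))
    (huniq : ∀ (V : X.Opens) (hV : V ≤ U) (s t : Γ(M, V)), P V hV s → P V hV t → s = t)
    (hex : ∀ x ∈ U, ∃ (V : X.Opens) (hV : V ≤ U), x ∈ V ∧ ∃ s, P V hV s) :
    ∃ s : Γ(M, U), ∀ (V : X.Opens) (hV : V ≤ U) (t : Γ(M, V)), P V hV t → resM M hV s = t := by
  choose V hV hx t ht using hex
  let sh : TopCat.Sheaf Ab X := ⟨M.presheaf, M.isSheaf⟩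
  obtain ⟨s, hs, -⟩ := sh.existsUnique_gluing' (fun x : U ↦ V x.1 x.2) U
    (fun x ↦ homOfLE (hV x.1 x.2)) (fun x hxU ↦ Opens.mem_iSup.2 ⟨⟨x, hxU⟩, hx x hxU⟩)
    (fun x ↦ t x.1 x.2) fun x y ↦ huniq _ _ _ _
      (hres _ _ (hV x.1 x.2) (inf_le_left : V x.1 x.2 ⊓ V y.1 y.2 ≤ _) _ (ht x.1 x.2))
      (hres _ _ (hV y.1 y.2) (inf_le_right : V x.1 x.2 ⊓ V y.1 y.2 ≤ _) _ (ht y.1 y.2))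
  refine ⟨s, fun W hW t' ht' ↦ resM_ext M fun x hxW ↦
    ⟨W ⊓ V x (hW hxW), inf_le_left, ⟨hxW, hx x (hW hxW)⟩, ?_⟩⟩
  rw [resM_resM]
  have h1 : resM M (hV x (hW hxW)) s = t x (hW hxW) := hs ⟨x, hW hxW⟩
  have h2 := congrArg (resM M (inf_le_right : W ⊓ V x (hW hxW) ≤ _)) h1
  rw [resM_resM] at h2
  rw [h2]
  exact huniq _ _ _ _ (hres _ _ (hV x (hW hxW)) inf_le_right _ (ht x (hW hxW)))
    (hres _ _ hW inf_le_left _ ht')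

theorem resO_glue {U : X.Opens} (P : ∀ V : X.Opens, V ≤ U → Γ(X, V) → Prop)
    (hres : ∀ (V W : X.Opens) (hV : V ≤ U) (hW : W ≤ V) (s : Γ(X, V)), P V hV s →
      P W (hW.trans hV) (resO hW s))
    (huniq : ∀ (V : X.Opens) (hV : V ≤ U) (s t : Γ(X, V)), P V hV s → P V hV t → s = t)
    (hex : ∀ x ∈ U, ∃ (V : X.Opens) (hV : V ≤ U), x ∈ V ∧ ∃ s, P V hV s) :
    ∃ s : Γ(X, U), ∀ (V : X.Opens) (hV : V ≤ U) (t : Γ(X, V)), P V hV t → resO hV s = t :=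
  resM_glue (structureModule X) P hres huniq hex

/-! ### The associated sheaf -/

theorem toAssocSheaf_add (P : PreMod X) (U : X.Opens) (s t : P.obj (op U)) :
    toAssocSheaf (X := X) P U (s + t) = toAssocSheaf P U s + toAssocSheaf P U t :=
  map_add (((PresheafOfModules.sheafificationAdjunction (𝟙 X.ringCatSheaf.obj)).unit.app P).app
    (op U)).hom s t

theorem toAssocSheaf_smul (P : PreMod X) (U : X.Opens) (a : Γ(X, U)) (s : P.obj (op U)) :
    toAssocSheaf (X := X) P U (a • s) = a • toAssocSheaf (X := X) P U s :=
  (((PresheafOfModules.sheafificationAdjunction (𝟙 X.ringCatSheaf.obj)).unit.app P).app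
    (op U)).hom.map_smul a s

theorem resM_toAssocSheaf (P : PreMod X) {V U : X.Opens} (h : V ≤ U) (s : P.obj (op U)) :
    resM _ h (toAssocSheaf (X := X) P U s) = toAssocSheaf (X := X) P V (resP P h s) :=
  (PresheafOfModules.naturality_apply
    ((PresheafOfModules.sheafificationAdjunction (𝟙 X.ringCatSheaf.obj)).unit.app P)
    (homOfLE h).op s).symm

theorem toAssocSheaf_locally_injective (P : PreMod X) {U : X.Opens} {s t : P.obj (op U)}
    (h : toAssocSheaf (X := X) P U s = toAssocSheaf P U t) :
    ∀ x ∈ U, ∃ (V : X.Opens) (hV : V ≤ U), x ∈ V ∧ resP P hV s = resP P hV t := by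
  intro x hx
  have h1 := Presheaf.equalizerSieve_mem (Opens.grothendieckTopology X)
    (CategoryTheory.toSheafify (Opens.grothendieckTopology X) (PresheafOfModules.presheaf P))
    (X := op U) s t h
  obtain ⟨V, i, hi, hxV⟩ := h1 x hx
  exact ⟨V, i.le, hxV, hi⟩

theorem toAssocSheaf_locally_surjective (P : PreMod X) {U : X.Opens}
    (s : Γ((assocSheaf X).obj P, U)) :
    ∀ x ∈ U, ∃ (V : X.Opens) (hV : V ≤ U), x ∈ V ∧ ∃ t : P.obj (op V),
      toAssocSheaf (X := X) P V t = resM _ hV s := by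
  intro x hx
  have h1 := Presheaf.imageSieve_mem (Opens.grothendieckTopology X)
    (CategoryTheory.toSheafify (Opens.grothendieckTopology X) (PresheafOfModules.presheaf P))
    (U := op U) s
  obtain ⟨V, i, ⟨t, ht⟩, hxV⟩ := h1 x hx
  exact ⟨V, i.le, hxV, t, ht⟩

end

/-! ### Bases -/

/-- The finite family `b` is a basis of `M`. -/
def IsBasisFam (R : Type*) {M ι : Type*} [Semiring R] [AddCommMonoid M] [Module R M] [Fintype ι]
    (b : ι → M) : Prop :=
  ∀ s : M, ∃! c : ι → R, s = ∑ i, c i • b i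

section

variable {R M ι : Type*} [CommRing R] [AddCommGroup M] [Module R M] [Fintype ι] {b : ι → M}

theorem IsBasisFam.exists_basis (hb : IsBasisFam R b) : ∃ B : Module.Basis ι R M, ⇑B = b := by
  have hli : LinearIndependent R b := by
    rw [Fintype.linearIndependent_iff]
    intro c hc i
    exact congrFun ((hb 0).unique (y₁ := c) (y₂ := 0) hc.symm (by simp)) i
  refine ⟨Module.Basis.mk hli fun s _ ↦ ?_, by simp⟩
  obtain ⟨c, rfl, -⟩ := hb s
  exact sum_mem fun i _ ↦ Submodule.smul_mem _ _ (Submodule.subset_span ⟨i, rfl⟩)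

/-- Covers the empty open set, where the rank condition is vacuous and the ring of functions is
zero. -/
theorem isBasisFam_of_subsingleton [Subsingleton R] (b : ι → M) : IsBasisFam R b := fun _ ↦
  ⟨0, (Module.subsingleton R M).elim _ _, fun _ _ ↦ Subsingleton.elim _ _⟩

/-- Two alternating maps are compared on injective tuples of basis vectors, which are permutations
of the basis. -/
theorem ιMulti_eq_det_smul {n : ℕ} (B : Module.Basis (Fin n) R M) (m : Fin n → M) :
    exteriorPower.ιMulti R n m = B.det m • exteriorPower.ιMulti R n B := by
  have h : exteriorPower.ιMulti R n (M := M) =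
      (LinearMap.toSpanSingleton R _ (exteriorPower.ιMulti R n B)).compAlternatingMap B.det := by
    refine B.ext_alternating fun v hv ↦ ?_
    obtain ⟨σ, rfl⟩ : ∃ σ : Equiv.Perm (Fin n), v = σ :=
      ⟨Equiv.ofBijective v (Finite.injective_iff_bijective.1 hv), rfl⟩
    have h1 := (exteriorPower.ιMulti R n (M := M)).map_perm B σ
    have h2 := B.det.map_perm B σ
    simp only [LinearMap.compAlternatingMap_apply, LinearMap.toSpanSingleton_apply]
    change exteriorPower.ιMulti R n (B ∘ σ) = B.det (B ∘ σ) • _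
    rw [h1, h2, B.det_self, smul_assoc, one_smul]
  exact DFunLike.congr_fun h m

theorem ιMulti_sum {n : ℕ} {b : Fin n → M} (hb : IsBasisFam R b) (A : Matrix (Fin n) (Fin n) R) :
    exteriorPower.ιMulti R n (fun i ↦ ∑ j, A i j • b j) =
      A.det • exteriorPower.ιMulti R n b := by
  obtain ⟨B, rfl⟩ := hb.exists_basis
  rw [ιMulti_eq_det_smul B, Module.Basis.det_apply, ← Matrix.det_transpose]
  congr 2
  ext i j
  simp [Module.Basis.toMatrix_apply, Finsupp.single_apply]

theorem isBasisFam_ιMulti {n : ℕ} {b : Fin n → M} (hb : IsBasisFam R b) :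
    IsBasisFam R fun _ : Unit ↦ exteriorPower.ιMulti R n b := by
  obtain ⟨B, rfl⟩ := hb.exists_basis
  let φ : ⋀[R]^n M →ₗ[R] R := exteriorPower.alternatingMapLinearEquiv B.det
  have hφ : φ (exteriorPower.ιMulti R n B) = 1 := by
    rw [exteriorPower.alternatingMapLinearEquiv_apply_ιMulti, B.det_self]
  intro s
  refine ⟨fun _ ↦ φ s, ?_, fun c hc ↦ ?_⟩
  · simp only [Finset.univ_unique, Finset.sum_singleton]
    induction s using ext_induction with
    | hι m =>
      rw [exteriorPower.alternatingMapLinearEquiv_apply_ιMulti]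
      exact ιMulti_eq_det_smul B m
    | hadd x y hx hy => rw [map_add, add_smul, ← hx, ← hy]
    | hs r x hx => rw [map_smul, smul_assoc, ← hx]
  · funext i
    rw [hc]
    simp [hφ]

end

/-! ### Frames -/

section

variable {X : Scheme.{u}} {U : X.Opens} {ι : Type*} [Fintype ι]

/-- The sections `b` form a basis of the restriction to `U` of a presheaf of modules. -/
def IsPreFrame (P : PreMod X) (b : ι → P.obj (op U)) : Prop :=
  ∀ (V : X.Opens) (hV : V ≤ U),
    IsBasisFam Γ(X, V) (M := P.obj (op V)) fun i ↦ resP P hV (b i)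

/-- The sections `b` form a basis of the restriction of `M` to `U`. -/
def IsFrame {M : X.Modules} (b : ι → Γ(M, U)) : Prop :=
  ∀ (V : X.Opens) (hV : V ≤ U), IsBasisFam Γ(X, V) (M := Γ(M, V)) fun i ↦ resM M hV (b i)

theorem IsFrame.isPreFrame {M : X.Modules} {b : ι → Γ(M, U)} (hb : IsFrame b) :
    IsPreFrame (X := X) M.val b := hb

theorem toAssocSheaf_sum (P : PreMod X) (c : ι → Γ(X, U)) (b : ι → P.obj (op U)) :
    toAssocSheaf (X := X) P U (∑ i, c i • b i) = ∑ i, c i • toAssocSheaf (X := X) P U (b i) := by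
  let f : P.obj (op U) →+ Γ((assocSheaf X).obj P, U) :=
    AddMonoidHom.mk' (toAssocSheaf (X := X) P U) (toAssocSheaf_add P U)
  change f _ = _
  rw [map_sum]
  exact Finset.sum_congr rfl fun i _ ↦ toAssocSheaf_smul P U _ _

theorem resM_sum_smul (M : X.Modules) {V : X.Opens} (hV : V ≤ U) (c : ι → Γ(X, U))
    (b : ι → Γ(M, U)) : resM M hV (∑ i, c i • b i) = ∑ i, resO hV (c i) • resM M hV (b i) := by
  rw [map_sum]
  exact Finset.sum_congr rfl fun i _ ↦ resM_smul M hV _ _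

theorem resP_sum_smul (P : PreMod X) {V : X.Opens} (hV : V ≤ U) (c : ι → Γ(X, U))
    (b : ι → P.obj (op U)) : resP P hV (∑ i, c i • b i) = ∑ i, resO hV (c i) • resP P hV (b i) := by
  rw [map_sum]
  exact Finset.sum_congr rfl fun i _ ↦ resP_smul P hV _ _

/-- Sections of the associated sheaf come locally from the presheaf and so have local coordinates.
Local injectivity of sheafification makes these unique, and they glue. -/
theorem IsPreFrame.isFrame_toAssocSheaf {P : PreMod X} {b : ι → P.obj (op U)}
    (hb : IsPreFrame P b) : IsFrame fun i ↦ toAssocSheaf (X := X) P U (b i) := by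
  let S := (assocSheaf X).obj P
  let t (i : ι) : Γ(S, U) := toAssocSheaf (X := X) P U (b i)
  have ht (V : X.Opens) (hV : V ≤ U) (c : ι → Γ(X, V)) :
      toAssocSheaf (X := X) P V (∑ i, c i • resP P hV (b i)) = ∑ i, c i • resM S hV (t i) := by
    rw [toAssocSheaf_sum]
    exact Finset.sum_congr rfl fun i _ ↦ by rw [resM_toAssocSheaf]
  have huniq (V : X.Opens) (hV : V ≤ U) (c d : ι → Γ(X, V))
      (h : ∑ i, c i • resM S hV (t i) = ∑ i, d i • resM S hV (t i)) : c = d := by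
    rw [← ht, ← ht] at h
    funext i
    refine resO_ext fun x hx ↦ ?_
    obtain ⟨W, hW, hxW, h⟩ := toAssocSheaf_locally_injective P h x hx
    refine ⟨W, hW, hxW, ?_⟩
    simp only [resP_sum_smul, resP_resP] at h
    exact congrFun ((hb W (hW.trans hV) _).unique (y₁ := fun i ↦ resO hW (c i))
      (y₂ := fun i ↦ resO hW (d i)) rfl h) i
  intro V hV s
  -- The coordinates are glued one index at a time, the local condition being to occur as the `i`-th
  -- entry of some coordinate vector.
  have hglue (i : ι) := resO_glue (U := V) (fun W hW a ↦ ∃ c : ι → Γ(X, W), c i = a ∧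
    resM S hW s = ∑ i, c i • resM S (hW.trans hV) (t i))
    (by
      rintro W W' hW hW' _ ⟨c, rfl, hc⟩
      refine ⟨fun i ↦ resO hW' (c i), rfl, ?_⟩
      have := congrArg (resM S hW') hc
      simpa only [resM_sum_smul, resM_resM] using this)
    (by
      rintro W hW _ _ ⟨c, rfl, hc⟩ ⟨d, rfl, hd⟩
      rw [huniq W (hW.trans hV) c d (hc.symm.trans hd)])
    (by
      intro x hx
      obtain ⟨W, hW, hxW, s', hs'⟩ := toAssocSheaf_locally_surjective P s x hx
      obtain ⟨c, hc, -⟩ := hb W (hW.trans hV) s'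
      refine ⟨W, hW, hxW, c i, c, rfl, ?_⟩
      rw [← hs', ← ht, ← hc])
  choose c hc using hglue
  refine ⟨c, resM_ext S fun x hx ↦ ?_, fun d hd ↦ ?_⟩
  · obtain ⟨W, hW, hxW, s', hs'⟩ := toAssocSheaf_locally_surjective P s x hx
    obtain ⟨d, hd, -⟩ := hb W (hW.trans hV) s'
    have hd' : resM S hW s = ∑ i, d i • resM S (hW.trans hV) (t i) := by rw [← hs', ← ht, ← hd]
    refine ⟨W, hW, hxW, ?_⟩
    have hcd (i : ι) : resO hW (c i) = d i := hc i W hW (d i) ⟨d, rfl, hd'⟩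
    change _ = resM S hW (∑ i, c i • resM S hV (t i))
    simp only [resM_sum_smul, resM_resM, hcd, hd']
  · funext i
    have := hc i V le_rfl (d i) ⟨d, rfl, by rw [resM_self]; exact hd⟩
    rw [← this, resO_self]

theorem exists_le_mem_of_finite {ι : Type*} [Finite ι] {x : X} (hx : x ∈ U)
    (P : ι → X.Opens → Prop) (hP : ∀ i V W, W ≤ V → P i V → P i W)
    (h : ∀ i, ∃ V : X.Opens, x ∈ V ∧ P i V) : ∃ V ≤ U, x ∈ V ∧ ∀ i, P i V := by
  classical
  cases nonempty_fintype ι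
  choose V hxV hV using h
  refine ⟨U ⊓ Finset.univ.inf V, inf_le_left, ⟨hx, ?_⟩, fun i ↦ hP i (V i) _
    (inf_le_right.trans (Finset.inf_le (Finset.mem_univ i))) (hV i)⟩
  change x ∈ (Finset.univ.inf V : X.Opens)
  rw [← SetLike.mem_coe, Opens.coe_finset_inf]
  simpa using hxV

theorem exists_germ_family {ι : Type*} [Finite ι] {x : X} (hx : x ∈ U)
    (c : ι → X.presheaf.stalk x) :
    ∃ (V : X.Opens) (_ : V ≤ U) (hxV : x ∈ V) (d : ι → Γ(X, V)),
      c = fun i ↦ X.presheaf.germ V x hxV (d i) := by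
  obtain ⟨V, hV, hxV, h⟩ := exists_le_mem_of_finite hx
    (fun i V ↦ ∀ hxV : x ∈ V, ∃ d : Γ(X, V), X.presheaf.germ V x hxV d = c i)
    (fun i V W hW hV hxW ↦ by
      obtain ⟨d, hd⟩ := hV (hW hxW)
      exact ⟨resO hW d, (X.presheaf.germ_res_apply (homOfLE hW) x hxW d).trans hd⟩)
    (fun i ↦ by
      obtain ⟨V, hxV, d, hd⟩ := X.presheaf.exists_germ_eq (c i)
      exact ⟨V, hxV, fun _ ↦ ⟨d, hd⟩⟩)
  choose d hd using fun i ↦ h i hxV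
  exact ⟨V, hV, hxV, d, funext fun i ↦ (hd i).symm⟩

/-- Germs of a frame form a basis of the stalk. This links charts to the stalkwise rank used in the
definition of the top exterior power. -/
theorem IsPreFrame.preRankAt_eq {P : PreMod X} {b : ι → P.obj (op U)} (hb : IsPreFrame P b)
    {x : X} (hx : x ∈ U) : preRankAt P x = Fintype.card ι := by
  let S : Type u := (TopCat.Presheaf.stalk P.presheaf x : Ab)
  let γ (V : X.Opens) (hxV : x ∈ V) : P.obj (op V) →+ S :=
    (TopCat.Presheaf.germ P.presheaf V x hxV).hom
  have hγsmul (V : X.Opens) (hxV : x ∈ V) (a : Γ(X, V)) (s : P.obj (op V)) :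
      γ V hxV (a • s) = X.presheaf.germ V x hxV a • γ V hxV s :=
    PresheafOfModules.germ_smul P x V hxV a s
  have hγres (V W : X.Opens) (hxW : x ∈ W) (hW : W ≤ V) (s : P.obj (op V)) :
      γ W hxW (resP P hW s) = γ V (hW hxW) s :=
    TopCat.Presheaf.germ_res_apply P.presheaf (homOfLE hW) x hxW s
  have hγsum (V : X.Opens) (hxV : x ∈ V) (hV : V ≤ U) (c : ι → Γ(X, V)) :
      γ V hxV (∑ i, c i • resP P hV (b i)) =
        ∑ i, X.presheaf.germ V x hxV (c i) • γ U hx (b i) := by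
    rw [map_sum]
    refine Finset.sum_congr rfl fun i _ ↦ ?_
    rw [hγsmul, hγres]
  have hB : IsBasisFam (X.presheaf.stalk x) (M := S) fun i ↦ γ U hx (b i) := by
    intro s
    obtain ⟨V, hVU, hxV, s, rfl⟩ := TopCat.Presheaf.exists_le_germ_eq P.presheaf s hx
    obtain ⟨c, hc, -⟩ := hb V hVU s
    refine ⟨fun i ↦ X.presheaf.germ V x hxV (c i), ?_, fun d hd ↦ ?_⟩
    · exact (congrArg (γ V hxV) hc).trans (hγsum V hxV hVU c)
    · obtain ⟨W, hWV, hxW, d, rfl⟩ := exists_germ_family hxV d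
      have hd' : γ V hxV s = _ := hd
      rw [← hγsum W hxW (hWV.trans hVU) d] at hd'
      obtain ⟨T, hxT, i₁, i₂, hT⟩ := TopCat.Presheaf.germ_eq P.presheaf x hxV hxW _ _ hd'
      have hT' : resP P i₁.le s = resP P i₂.le _ := hT
      rw [hc] at hT'
      simp only [resP_sum_smul, resP_resP] at hT'
      have := (hb T (i₁.le.trans hVU) _).unique rfl hT'
      funext i
      have hi := congrArg (X.presheaf.germ T x hxT) (congrFun this i)
      have e1 := X.presheaf.germ_res_apply i₁ x hxT (c i)
      have e2 := X.presheaf.germ_res_apply i₂ x hxT (d i)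
      exact e2.symm.trans (hi.symm.trans e1)
  obtain ⟨B, -⟩ := hB.exists_basis
  exact Module.finrank_eq_card_basis B

end

/-! ### Charts -/

theorem FrobFinite.of_isLocalization {q : ℕ} {R S : Type*} [CommRing R] [CommRing S] [Algebra R S]
    (M : Submonoid R) [IsLocalization M S] (hq : 0 < q) (h : FrobFinite q R) : FrobFinite q S := by
  obtain ⟨k, r, hr⟩ := h
  refine ⟨k, fun i ↦ algebraMap R S (r i), fun x ↦ ?_⟩
  obtain ⟨⟨a, s⟩, hx⟩ := IsLocalization.surj M x
  -- The fraction `a / s` is rewritten as `a s ^ (q-1) / s ^ q`, whose denominator is a `q`-th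
  -- power.
  obtain ⟨c, hc⟩ := hr (a * s ^ (q - 1))
  obtain ⟨u, hu⟩ := IsLocalization.map_units S s
  refine ⟨fun i ↦ algebraMap R S (c i) * ((u⁻¹ : Sˣ) : S), ?_⟩
  have h1 : (u : S) ^ q * x = algebraMap R S (a * s ^ (q - 1)) := by
    rw [map_mul, map_pow, ← hx, ← hu]
    obtain ⟨m, rfl⟩ := Nat.exists_eq_succ_of_ne_zero hq.ne'
    simp only [Nat.succ_eq_add_one, Nat.add_sub_cancel]
    ring
  have h2 : x = ((u⁻¹ : Sˣ) : S) ^ q * ((u : S) ^ q * x) := by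
    rw [← mul_assoc, ← mul_pow, Units.inv_mul, one_pow, one_mul]
  rw [h2, h1, hc, map_sum, Finset.mul_sum]
  refine Finset.sum_congr rfl fun i _ ↦ ?_
  rw [map_mul, map_pow, mul_pow]
  ring

theorem exists_generators_of_finite {R S : Type*} [CommRing R] [CommRing S] (f : R →+* S)
    (hf : f.Finite) :
    ∃ (k : ℕ) (r : Fin k → S), ∀ a, ∃ c : Fin k → R, a = ∑ i, f (c i) * r i := by
  let := f.toAlgebra
  have : Module.Finite R S := hf
  obtain ⟨k, r, hr⟩ := Module.Finite.exists_fin (R := R) (M := S)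
  refine ⟨k, r, fun a ↦ ?_⟩
  obtain ⟨c, hc⟩ := (Submodule.mem_span_range_iff_exists_fun R).1 (hr ▸ Submodule.mem_top (x := a))
  exact ⟨c, hc.symm⟩

theorem FrobFinite.of_finite {q : ℕ} {R : Type*} [CommRing R] (f : R →+* R) (hf : f.Finite)
    (hfq : ∀ a, f a = a ^ q) : FrobFinite q R := by
  obtain ⟨k, r, hr⟩ := exists_generators_of_finite f hf
  exact ⟨k, r, fun a ↦ by simpa only [hfq] using hr a⟩

section

variable {X : Scheme.{u}} {U : X.Opens} {n : ℕ} {q : ℕ}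

/-- The functions `g` form a `q`-basis over every open subset of `U`. -/
def IsChart (q : ℕ) (g : Fin n → Γ(X, U)) : Prop :=
  ∀ (V : X.Opens) (hV : V ≤ U), IsFrobBasis q fun i ↦ resO hV (g i)

theorem IsChart.res {g : Fin n → Γ(X, U)} (hg : IsChart q g) {V : X.Opens} (hV : V ≤ U) :
    IsChart q fun i ↦ resO hV (g i) := fun W hW ↦ by
  simp only [resO_resO]; exact hg W _

theorem IsChart.isFrobBasis {g : Fin n → Γ(X, U)} (hg : IsChart q g) : IsFrobBasis q g := by
  have := hg U le_rfl
  simpa only [resO_self] using this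

theorem resO_frobSum {V : X.Opens} (hV : V ≤ U) (g : Fin n → Γ(X, U))
    (c : (Fin n → Fin q) → Γ(X, U)) : resO hV (frobSum q g c) =
      frobSum q (fun i ↦ resO hV (g i)) fun I ↦ resO hV (c I) :=
  map_frobSum (resO hV) c

/-- Coefficients are unique on arbitrarily small neighbourhoods of each point, so injectivity is
local and local coefficients glue to global ones. -/
theorem isChart_of_locally {g : Fin n → Γ(X, U)}
    (h : ∀ x ∈ U, ∀ V : X.Opens, x ∈ V → ∃ (W : X.Opens) (_ : W ≤ V) (hWU : W ≤ U), x ∈ W ∧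
      IsFrobBasis q fun i ↦ resO hWU (g i)) : IsChart q g := by
  have hinj (V : X.Opens) (hV : V ≤ U) : Function.Injective (frobSum q fun i ↦ resO hV (g i)) := by
    intro c d hcd
    funext I
    refine resO_ext fun x hx ↦ ?_
    obtain ⟨W, hWV, hWU, hxW, hW⟩ := h x (hV hx) V hx
    refine ⟨W, hWV, hxW, ?_⟩
    have := congrArg (resO hWV) hcd
    simp only [resO_frobSum, resO_resO] at this
    exact congrFun (hW.1 this) I
  intro V hV
  refine ⟨hinj V hV, fun s ↦ ?_⟩
  have hloc (x) (hx : x ∈ V) : ∃ (W : X.Opens) (hWV : W ≤ V), x ∈ W ∧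
      ∃ c, resO hWV s = frobSum q (fun i ↦ resO (hWV.trans hV) (g i)) c := by
    obtain ⟨W, hWV, hWU, hxW, hW⟩ := h x (hV hx) V hx
    obtain ⟨c, hc⟩ := hW.2 (resO hWV s)
    exact ⟨W, hWV, hxW, c, hc.symm⟩
  have hglue (I : Fin n → Fin q) := resO_glue (U := V) (fun W hW a ↦
    ∃ c, c I = a ∧ resO hW s = frobSum q (fun i ↦ resO (hW.trans hV) (g i)) c)
    (by
      rintro W W' hW hW' _ ⟨c, rfl, hc⟩
      refine ⟨fun I ↦ resO hW' (c I), rfl, ?_⟩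
      have := congrArg (resO hW') hc
      simpa only [resO_frobSum, resO_resO] using this)
    (by
      rintro W hW _ _ ⟨c, rfl, hc⟩ ⟨d, rfl, hd⟩
      rw [hinj W (hW.trans hV) (hc.symm.trans hd)])
    (fun x hx ↦ by
      obtain ⟨W, hWV, hxW, c, hc⟩ := hloc x hx
      exact ⟨W, hWV, hxW, c I, c, rfl, hc⟩)
  choose c hc using hglue
  refine ⟨c, resO_ext fun x hx ↦ ?_⟩
  obtain ⟨W, hWV, hxW, d, hd⟩ := hloc x hx
  refine ⟨W, hWV, hxW, ?_⟩
  have hcd : (fun I ↦ resO hWV (c I)) = d := funext fun I ↦ hc I W hWV (d I) ⟨d, rfl, hd⟩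
  simp only [resO_frobSum, resO_resO, hcd, hd]

/-- A basis of the stalk is lifted to functions near `x` and spread out to a basic open of an affine
neighbourhood. -/
theorem exists_isChart_prime (p : ℕ) [Fact p.Prime] (X : Scheme.{u}) [IsFpScheme p X]
    [IsLocallyNoetherian X] (hreg : ∀ x : X, IsRegularLocalRing (X.presheaf.stalk x))
    (hfin : IsFinite (frob p 1 X)) (x : X) :
    ∃ (U : X.Opens) (_ : x ∈ U) (n : ℕ) (g : Fin n → Γ(X, U)), IsChart p g := by
  have hff (W : X.Opens) (hW : IsAffineOpen W) : FrobFinite p Γ(X, W) := by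
    exact FrobFinite.of_finite ((frob p 1 X).app W).hom (hfin.finite_app W hW) fun a ↦ by
      change a ^ p ^ 1 = _
      rw [pow_one]
  have hadd (W : X.Opens) : FrobAdd p Γ(X, W) :=
    FrobAdd.of_natCast_eq_zero' (natCast_eq_zero p X W)
  have hpos : 0 < p := (Fact.out : p.Prime).pos
  obtain ⟨_, ⟨W₀, hW₀, rfl⟩, hxW₀, -⟩ := X.isBasis_affineOpens.exists_subset_of_mem_open
    (Set.mem_univ x) isOpen_univ
  have hst : FrobFinite p (X.presheaf.stalk x) := by
    let := X.presheaf.algebra_section_stalk ⟨x, hxW₀⟩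
    have := hW₀.isLocalization_stalk ⟨x, hxW₀⟩
    exact (hff W₀ hW₀).of_isLocalization (hW₀.primeIdealOf ⟨x, hxW₀⟩).asIdeal.primeCompl hpos
  have hp0 : (p : X.presheaf.stalk x) = 0 := by
    have := congrArg (X.presheaf.germ W₀ x hxW₀).hom (natCast_eq_zero p X W₀)
    simpa using this
  have := hreg x
  obtain ⟨n, g, hg⟩ := exists_isFrobBasis_of_regular (X.presheaf.stalk x) hp0 hst
  obtain ⟨V, hVW₀, hxV, g, rfl⟩ := exists_germ_family (U := W₀) hxW₀ g
  obtain ⟨_, ⟨W, hW, rfl⟩, hxW, hWV⟩ := X.isBasis_affineOpens.exists_subset_of_mem_open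
    (show x ∈ (V : Set X) from hxV) V.isOpen
  replace hWV : W ≤ V := hWV
  replace hxW : x ∈ W := hxW
  let := X.presheaf.algebra_section_stalk ⟨x, hxW⟩
  have := hW.isLocalization_stalk ⟨x, hxW⟩
  have : IsNoetherianRing Γ(X, W) := IsLocallyNoetherian.component_noetherian ⟨W, hW⟩
  have hg' : IsFrobBasis p (algebraMap Γ(X, W) (X.presheaf.stalk x) ∘ fun i ↦ resO hWV (g i)) := by
    convert! hg using 1
    funext i
    exact X.presheaf.germ_res_apply (homOfLE hWV) x hxW (g i)
  obtain ⟨f, hf, h⟩ := exists_isFrobBasis_localization (P := (hW.primeIdealOf ⟨x, hxW⟩).asIdeal)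
    (hadd W) (X.presheaf.stalk x) (hff W hW) hg'
  have hxf : x ∈ X.basicOpen f := by
    rw [Scheme.mem_basicOpen X f x hxW]
    exact (IsLocalization.AtPrime.isUnit_to_map_iff (X.presheaf.stalk x)
      (hW.primeIdealOf ⟨x, hxW⟩).asIdeal f).2 hf
  refine ⟨X.basicOpen f, hxf, n, fun i ↦ resO (X.basicOpen_le f) (resO hWV (g i)),
    isChart_of_locally fun y hy V' hyV' ↦ ?_⟩
  -- The test neighbourhoods are smaller basic opens of the same affine: their rings are
  -- localizations in which `f` is a unit.
  obtain ⟨f', hf', hyf'⟩ := hW.exists_basicOpen_le (V := V' ⊓ X.basicOpen f)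
    ⟨y, hyV', hy⟩ (X.basicOpen_le f hy)
  refine ⟨X.basicOpen f', hf'.trans inf_le_left, hf'.trans inf_le_right, hyf', ?_⟩
  have := hW.isLocalization_basicOpen f'
  have h3 := h Γ(X, X.basicOpen f') (Submonoid.powers f') (by
    have h4 : IsUnit (resO (X.basicOpen_le f) f) := X.toRingedSpace.isUnit_res_basicOpen f
    have h5 := h4.map (resO (hf'.trans inf_le_right))
    rw [resO_resO] at h5
    exact h5)
  simp only [resO_resO]
  convert! h3 using 1
  funext i
  exact (resO_resO hWV (X.basicOpen_le f') (g i)).symm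

theorem exists_isChart (p : ℕ) [Fact p.Prime] (e : ℕ) (X : Scheme.{u}) [IsFpScheme p X]
    [IsLocallyNoetherian X] (hreg : ∀ x : X, IsRegularLocalRing (X.presheaf.stalk x))
    (hfin : IsFinite (frob p 1 X)) (x : X) :
    ∃ (U : X.Opens) (_ : x ∈ U) (n : ℕ) (g : Fin n → Γ(X, U)), IsChart (p ^ e) g := by
  obtain ⟨U, hx, n, g, hg⟩ := exists_isChart_prime p X hreg hfin x
  exact ⟨U, hx, n, g, fun V hV ↦
    (hg V hV).pow (FrobAdd.of_natCast_eq_zero' (natCast_eq_zero p X V)) e⟩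

end

/-! ### Differentials and top forms in a chart -/

section

variable {X : Scheme.{u}} {U : X.Opens} {n : ℕ}

theorem resP_preOmega_d {V : X.Opens} (hV : V ≤ U) (g : Γ(X, U)) :
    resP (preOmega X) hV (CommRingCat.KaehlerDifferential.d (f := (fromZ X).app (op U)) g) =
      CommRingCat.KaehlerDifferential.d (f := (fromZ X).app (op V)) (resO hV g) := by
  exact PresheafOfModules.DifferentialsConstruction.relativeDifferentials'_map_d (fromZ X)
    (homOfLE hV).op g

theorem resM_differential {V : X.Opens} (hV : V ≤ U) (g : Γ(X, U)) :
    resM (Omega X) hV (differential g) = differential (resO hV g) := by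
  rw [differential, differential, ← resP_preOmega_d]
  exact resM_toAssocSheaf _ hV _

theorem IsChart.isPreFrame_d {q : ℕ} (hadd : ∀ V : X.Opens, FrobAdd q Γ(X, V))
    (hq0 : ∀ V : X.Opens, (q : Γ(X, V)) = 0) {g : Fin n → Γ(X, U)} (hg : IsChart q g) :
    IsPreFrame (preOmega X) fun i ↦
      CommRingCat.KaehlerDifferential.d (f := (fromZ X).app (op U)) (g i) := by
  intro V hV
  simp only [resP_preOmega_d]
  let : Algebra (ULift.{u} ℤ) Γ(X, V) := ((fromZ X).app (op V)).hom.toAlgebra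
  exact (hg V hV).kaehler_existsUnique (hadd V) (hq0 V) (ULift.{u} ℤ) fun b ↦ ⟨b.down, rfl⟩

theorem IsChart.isFrame_differential {q : ℕ} (hadd : ∀ V : X.Opens, FrobAdd q Γ(X, V))
    (hq0 : ∀ V : X.Opens, (q : Γ(X, V)) = 0) {g : Fin n → Γ(X, U)} (hg : IsChart q g) :
    IsFrame fun i ↦ differential (g i) :=
  (hg.isPreFrame_d hadd hq0).isFrame_toAssocSheaf

theorem IsChart.differential_eq {q : ℕ} (hadd : FrobAdd q Γ(X, U))
    (hq0 : (q : Γ(X, U)) = 0) {g : Fin n → Γ(X, U)} (hg : IsChart q g) (a : Γ(X, U)) :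
    differential a = ∑ j, hg.isFrobBasis.partialDeriv hadd j a • differential (g j) := by
  let : Algebra (ULift.{u} ℤ) Γ(X, U) := ((fromZ X).app (op U)).hom.toAlgebra
  have h := hg.isFrobBasis.kaehler_d_eq hadd hq0 (ULift.{u} ℤ) a
  refine Eq.trans ?_ (toAssocSheaf_sum (preOmega X) _ _)
  exact congrArg (toAssocSheaf (X := X) (preOmega X) U) h

theorem IsFrame.rankAt_eq {M : X.Modules} {b : Fin n → Γ(M, U)} (hb : IsFrame b) :
    ∀ x ∈ U, rankAt M x = n := fun _ hx ↦
  (hb.isPreFrame.preRankAt_eq hx).trans (Fintype.card_fin n)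

/-- The component in `⋀ᵏ P(U)` of a section of `preTopWedge P`. -/
def wedgeComp (P : PreMod X) (U : X.Opens) (k : ℕ) (s : (preTopWedge P).obj (op U)) :
    ⋀[X.presheaf.obj (op U)]^k (P.obj (op U)) :=
  (show extPart (X.presheaf.obj (op U)) (P.obj (op U)) fun n ↦ ∀ x ∈ U, preRankAt P x = n
    from s).1 k

theorem wedgeComp_ext {P : PreMod X} {s t : (preTopWedge P).obj (op U)}
    (h : ∀ k, wedgeComp P U k s = wedgeComp P U k t) : s = t :=
  Subtype.ext (funext h)

theorem wedgeComp_smul (P : PreMod X) (k : ℕ) (a : Γ(X, U)) (s : (preTopWedge P).obj (op U)) :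
    wedgeComp P U k (a • s) = a • wedgeComp P U k s := rfl

theorem wedgeComp_preWedge {P : PreMod X} (hn : ∀ x ∈ U, preRankAt P x = n)
    (m : Fin n → P.obj (op U)) :
    wedgeComp P U n (preWedge P hn m) = exteriorPower.ιMulti (X.presheaf.obj (op U)) n m :=
  Pi.single_eq_same (M := fun k ↦ ⋀[X.presheaf.obj (op U)]^k (P.obj (op U))) n _

theorem wedgeComp_preWedge_of_ne {P : PreMod X} (hn : ∀ x ∈ U, preRankAt P x = n)
    (m : Fin n → P.obj (op U)) {k : ℕ} (hk : k ≠ n) :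
    wedgeComp P U k (preWedge P hn m) = 0 :=
  Pi.single_eq_of_ne (M := fun k ↦ ⋀[X.presheaf.obj (op U)]^k (P.obj (op U))) hk _

theorem resP_preWedge {P : PreMod X} (hn : ∀ x ∈ U, preRankAt P x = n) {V : X.Opens} (hV : V ≤ U)
    (m : Fin n → P.obj (op U)) :
    resP (preTopWedge P) hV (preWedge P hn m) =
      preWedge P (fun x hx ↦ hn x (hV hx)) fun i ↦ resP P hV (m i) := by
  refine wedgeComp_ext fun k ↦ ?_
  change extMap (resₛₗ P (homOfLE hV).op) k (wedgeComp P U k (preWedge P hn m)) = _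
  rcases eq_or_ne k n with rfl | hk
  · rw [wedgeComp_preWedge, wedgeComp_preWedge, extMap_ιMulti]
    rfl
  · rw [wedgeComp_preWedge_of_ne _ _ hk, wedgeComp_preWedge_of_ne _ _ hk, map_zero]

theorem resM_wedge {M : X.Modules} (hn : ∀ x ∈ U, rankAt M x = n) {V : X.Opens} (hV : V ≤ U)
    (m : Fin n → Γ(M, U)) :
    resM (topExterior M) hV (wedge hn m) =
      wedge (fun x hx ↦ hn x (hV hx)) fun i ↦ resM M hV (m i) :=
  (resM_toAssocSheaf _ hV _).trans
    (congrArg (toAssocSheaf (X := X) _ V) (resP_preWedge (P := M.val) hn hV m))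

theorem subsingleton_of_forall_notMem {V : X.Opens} (hV : ∀ x, x ∉ V) : Subsingleton Γ(X, V) :=
  ⟨fun _ _ ↦ resO_ext fun x hx ↦ (hV x hx).elim⟩

/-- Over a nonempty open set the rank is `n` at some point, so every component other than the `n`-th
vanishes and the `n`-th exterior power alone counts. -/
theorem IsPreFrame.isPreFrame_preWedge {P : PreMod X} {b : Fin n → P.obj (op U)}
    (hb : IsPreFrame P b) (hn : ∀ x ∈ U, preRankAt P x = n) :
    IsPreFrame (preTopWedge P) fun _ : Unit ↦ preWedge P hn b := by
  intro V hV
  have hres := resP_preWedge hn hV b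
  by_cases hne : ∃ x, x ∈ V
  · obtain ⟨x, hx⟩ := hne
    intro s
    have hs0 (k : ℕ) (hk : k ≠ n) : wedgeComp P V k s = 0 := s.2 k fun h ↦
      hk ((h x hx).symm.trans (hn x (hV hx)))
    obtain ⟨c, hc, huniq⟩ := isBasisFam_ιMulti (hb V hV) (wedgeComp P V n s)
    simp only [Finset.univ_unique, Finset.sum_singleton] at hc huniq ⊢
    refine ⟨c, wedgeComp_ext fun k ↦ ?_, fun d hd ↦ huniq d ?_⟩
    · rw [hres, wedgeComp_smul]
      rcases eq_or_ne k n with rfl | hk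
      · rw [wedgeComp_preWedge]; exact hc
      · rw [wedgeComp_preWedge_of_ne _ _ hk, hs0 k hk, smul_zero]
    · rw [hd, hres, wedgeComp_smul, wedgeComp_preWedge]
  · have := subsingleton_of_forall_notMem (not_exists.1 hne)
    exact isBasisFam_of_subsingleton _

theorem IsFrame.isFrame_wedge {M : X.Modules} {b : Fin n → Γ(M, U)} (hb : IsFrame b)
    (hn : ∀ x ∈ U, rankAt M x = n) : IsFrame fun _ : Unit ↦ wedge hn b :=
  (hb.isPreFrame.isPreFrame_preWedge hn).isFrame_toAssocSheaf

theorem IsPreFrame.preWedge_sum {P : PreMod X} {b : Fin n → P.obj (op U)} (hb : IsPreFrame P b)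
    (hn : ∀ x ∈ U, preRankAt P x = n) (A : Matrix (Fin n) (Fin n) Γ(X, U)) :
    preWedge P hn (fun i ↦ ∑ j, A i j • b j) = A.det • preWedge P hn b := by
  refine wedgeComp_ext fun k ↦ ?_
  rw [wedgeComp_smul]
  rcases eq_or_ne k n with rfl | hk
  · rw [wedgeComp_preWedge, wedgeComp_preWedge]
    have h : IsBasisFam Γ(X, U) b := by simpa only [resP_self] using hb U le_rfl
    exact ιMulti_sum h A
  · rw [wedgeComp_preWedge_of_ne _ _ hk, wedgeComp_preWedge_of_ne _ _ hk, smul_zero]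

theorem IsFrame.wedge_sum {M : X.Modules} {b : Fin n → Γ(M, U)} (hb : IsFrame b)
    (hn : ∀ x ∈ U, rankAt M x = n) (A : Matrix (Fin n) (Fin n) Γ(X, U)) :
    wedge hn (fun i ↦ ∑ j, A i j • b j) = A.det • wedge hn b :=
  (congrArg (toAssocSheaf (X := X) (preTopWedge (X := X) M.val) U)
    (hb.isPreFrame.preWedge_sum hn A)).trans
    (toAssocSheaf_smul (preTopWedge (X := X) M.val) U A.det _)

end

/-! ### Twists by generated sheaves -/

section

variable {X : Scheme.{u}} {U : X.Opens} {M N L : X.Modules}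

/-- The section `w` is a basis of the restriction of `L` to `U`. -/
def IsGen (w : Γ(L, U)) : Prop :=
  ∀ (V : X.Opens) (hV : V ≤ U) (s : Γ(L, V)), ∃! c : Γ(X, V), s = c • resM L hV w

theorem IsFrame.isGen {w : Γ(L, U)} (h : IsFrame fun _ : Unit ↦ w) : IsGen w := fun V hV s ↦ by
  obtain ⟨c, hc, huniq⟩ := h V hV s
  simp only [Finset.univ_unique, Finset.sum_singleton] at hc huniq
  exact ⟨c default, hc, fun d hd ↦ congrFun (huniq (fun _ ↦ d) hd) default⟩

theorem IsGen.res {w : Γ(L, U)} (hw : IsGen w) {V : X.Opens} (hV : V ≤ U) :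
    IsGen (resM L hV w) := fun W hW s ↦ by
  rw [resM_resM]; exact hw W _ s

theorem IsGen.existsUnique {w : Γ(L, U)} (hw : IsGen w) (s : Γ(L, U)) :
    ∃! c : Γ(X, U), s = c • w := by
  have := hw U le_rfl s
  rwa [resM_self] at this

theorem tmul_add (m : Γ(M, U)) (l l' : Γ(L, U)) : tmul m (l + l') = tmul m l + tmul m l' := by
  refine (congrArg (toAssocSheaf (X := X) _ U) ?_).trans (toAssocSheaf_add _ _ _ _)
  exact TensorProduct.tmul_add _ _ _

theorem add_tmul (m m' : Γ(M, U)) (l : Γ(L, U)) : tmul (m + m') l = tmul m l + tmul m' l := by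
  refine (congrArg (toAssocSheaf (X := X) _ U) ?_).trans (toAssocSheaf_add _ _ _ _)
  exact TensorProduct.add_tmul _ _ _

theorem smul_tmul (a : Γ(X, U)) (m : Γ(M, U)) (l : Γ(L, U)) : tmul (a • m) l = a • tmul m l := by
  refine (congrArg (toAssocSheaf (X := X) _ U) ?_).trans (toAssocSheaf_smul _ _ _ _)
  exact TensorProduct.smul_tmul' a _ _

theorem tmul_smul (a : Γ(X, U)) (m : Γ(M, U)) (l : Γ(L, U)) : tmul m (a • l) = a • tmul m l := by
  refine (congrArg (toAssocSheaf (X := X) _ U) ?_).trans (toAssocSheaf_smul _ _ _ _)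
  exact TensorProduct.tmul_smul (R := Γ(X, U)) (M := Γ(M, U)) (N := Γ(L, U)) a m l

theorem sum_tmul {ι : Type*} (s : Finset ι) (m : ι → Γ(M, U)) (l : Γ(L, U)) :
    tmul (∑ i ∈ s, m i) l = ∑ i ∈ s, tmul (m i) l :=
  map_sum (AddMonoidHom.mk' (fun m : Γ(M, U) ↦ tmul m l) fun m m' ↦ add_tmul m m' l) _ _

theorem resM_tmul {V : X.Opens} (hV : V ≤ U) (m : Γ(M, U)) (l : Γ(L, U)) :
    resM _ hV (tmul m l) = tmul (resM M hV m) (resM L hV l) :=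
  resM_toAssocSheaf _ hV _

theorem tensorBy_map_app_tmul (a : M ⟶ N) (m : Γ(M, U)) (l : Γ(L, U)) :
    ((tensorBy L).map a).app U (tmul m l) = tmul (a.app U m) l := by
  have h := (PresheafOfModules.sheafificationAdjunction (𝟙 X.ringCatSheaf.obj)).unit.naturality
    ((MonoidalCategory.tensorRight (C := PreMod X) L.val).map
      ((Scheme.Modules.toPresheafOfModules X).map a))
  have h2 := congrArg (fun φ ↦ φ.app (op U)
    ((m : M.val.obj (op U)) ⊗ₜ[Γ(X, U)] (l : L.val.obj (op U)))) h
  exact h2.symm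

/-- The tensor product with a basis `w` of a module is bijective. -/
theorem bijective_tmul_right {R A B : Type*} [CommRing R] [AddCommGroup A] [AddCommGroup B]
    [Module R A] [Module R B] {w : B} (hw : ∀ s : B, ∃! c : R, s = c • w) :
    Function.Bijective fun m : A ↦ m ⊗ₜ[R] w := by
  choose φ hφ huniq using hw
  let f : B →ₗ[R] R :=
    { toFun := φ
      map_add' := fun x y ↦ (huniq (x + y) (φ x + φ y)
        (by change _ = (φ x + φ y) • w; rw [add_smul, ← hφ x, ← hφ y])).symm
      map_smul' := fun a x ↦ (huniq (a • x) (a * φ x)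
        (by change _ = (a * φ x) • w; rw [mul_smul, ← hφ x])).symm }
  have hf : f w = 1 := (huniq w 1 (one_smul _ _).symm).symm
  constructor
  · intro m m' h
    have := congrArg (fun t ↦ TensorProduct.rid R A (f.lTensor A t)) h
    simpa [hf] using this
  · intro t
    induction t using TensorProduct.induction_on with
    | zero => exact ⟨0, TensorProduct.zero_tmul _ _⟩
    | tmul m l =>
      refine ⟨φ l • m, ?_⟩
      change (φ l • m) ⊗ₜ[R] w = _
      rw [TensorProduct.smul_tmul, ← hφ l]
    | add x y hx hy =>
      obtain ⟨m, rfl⟩ := hx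
      obtain ⟨m', rfl⟩ := hy
      exact ⟨m + m', TensorProduct.add_tmul _ _ _⟩

/-- Tensoring with a generator is bijective on the presheaf tensor product over every smaller open
set; local injectivity and surjectivity of sheafification carry this over by gluing. -/
theorem IsGen.bijective_tmul {w : Γ(L, U)} (hw : IsGen w) :
    Function.Bijective fun m : Γ(M, U) ↦ tmul m w := by
  let T : PreMod X := MonoidalCategory.tensorObj (C := PreMod X) M.val L.val
  have hbij (V : X.Opens) (hV : V ≤ U) := bijective_tmul_right (R := Γ(X, V)) (A := Γ(M, V))
    (B := Γ(L, V)) (hw V hV)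
  have hinj (V : X.Opens) (hV : V ≤ U) (m m' : Γ(M, V))
      (h : tmul m (resM L hV w) = tmul m' (resM L hV w)) : m = m' := by
    refine resM_ext M fun x hx ↦ ?_
    obtain ⟨W, hW, hxW, h⟩ := toAssocSheaf_locally_injective T h x hx
    refine ⟨W, hW, hxW, (hbij W (hW.trans hV)).1 ?_⟩
    have h' : resM M hW m ⊗ₜ[Γ(X, W)] resM L hW (resM L hV w) =
        resM M hW m' ⊗ₜ[Γ(X, W)] resM L hW (resM L hV w) := h
    rwa [resM_resM] at h'
  constructor
  · intro m m' h
    refine hinj U le_rfl m m' ?_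
    rw [resM_self]; exact h
  · intro t
    have hloc (x) (hx : x ∈ U) : ∃ (V : X.Opens) (hV : V ≤ U), x ∈ V ∧ ∃ m : Γ(M, V),
        tmul m (resM L hV w) = resM ((tensorBy L).obj M) hV t := by
      obtain ⟨V, hV, hxV, t', ht'⟩ := toAssocSheaf_locally_surjective T t x hx
      obtain ⟨m, hm⟩ := (hbij V hV).2 t'
      exact ⟨V, hV, hxV, m, (congrArg (toAssocSheaf (X := X) T V) hm).trans ht'⟩
    obtain ⟨m, hm⟩ := resM_glue M (U := U)
      (fun V hV m ↦ tmul m (resM L hV w) = resM ((tensorBy L).obj M) hV t)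
      (fun V W hV hW m h ↦ by
        have := congrArg (resM _ hW) h
        rwa [resM_tmul, resM_resM, resM_resM] at this)
      (fun V hV m m' h h' ↦ hinj V hV m m' (h.trans h'.symm))
      hloc
    refine ⟨m, resM_ext _ fun x hx ↦ ?_⟩
    obtain ⟨V, hV, hxV, m', hm'⟩ := hloc x hx
    refine ⟨V, hV, hxV, ?_⟩
    change resM _ hV (tmul m w) = _
    rw [resM_tmul, hm V hV m' hm', hm']

theorem IsGen.tmul {v : Γ(M, U)} {w : Γ(L, U)} (hv : IsGen v) (hw : IsGen w) :
    IsGen (FrobTwist.tmul v w) := fun V hV s ↦ by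
  obtain ⟨m, rfl⟩ := (hw.res hV).bijective_tmul.2 s
  obtain ⟨c, rfl, huniq⟩ := hv V hV m
  refine ⟨c, ?_, fun d hd ↦ huniq d ?_⟩
  · change FrobTwist.tmul (c • resM M hV v) _ = _
    rw [resM_tmul, smul_tmul]
  · rw [resM_tmul, ← smul_tmul] at hd
    exact (hw.res hV).bijective_tmul.1 hd

theorem resM_secPow {V : X.Opens} (hV : V ≤ U) (w : Γ(L, U)) (k : ℕ) :
    resM (tpow L k) hV (secPow w k) = secPow (resM L hV w) k := by
  induction k with
  | zero => exact map_one (resO hV)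
  | succ k ih =>
    change resM _ hV (tmul (secPow w k) w) = tmul (secPow (resM L hV w) k) (resM L hV w)
    rw [resM_tmul, ih]

theorem secPow_smul (a : Γ(X, U)) (w : Γ(L, U)) (k : ℕ) :
    secPow (a • w) k = a ^ k • secPow w k := by
  induction k with
  | zero =>
    rw [pow_zero, one_smul]; rfl
  | succ k ih =>
    change tmul (secPow (a • w) k) (a • w) = a ^ (k + 1) • tmul (secPow w k) w
    rw [ih, tmul_smul, smul_tmul, smul_smul, pow_succ']

theorem IsGen.secPow {w : Γ(L, U)} (hw : IsGen w) (k : ℕ) : IsGen (FrobTwist.secPow w k) := by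
  induction k with
  | zero =>
    intro V hV s
    have h (c : Γ(X, V)) : c • resM (structureModule X) hV (1 : Γ(X, U)) = c := by
      change c * resO hV 1 = c
      rw [map_one, mul_one]
    refine ⟨s, (h s).symm, fun d hd ↦ ?_⟩
    exact (h d).symm.trans hd.symm
  | succ k ih => exact ih.tmul hw

end

/-! ### Sections of sheaves of homomorphisms -/

section

variable {X : Scheme.{u}} {U : X.Opens} {M N L : X.Modules}

/-- The map on sections over `U` given by a section over `U` of a sheaf of homomorphisms. -/
def homApp {f : X ⟶ X} [IsIdOnOpens f] (φ : Γ(homSheaf f M N, U)) : Γ(M, f ⁻¹ᵁ U) →+ Γ(N, U) :=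
  ((show HomSections f M N U from φ).app U le_rfl).toAddMonoidHom

section

variable {f : X ⟶ X} [IsIdOnOpens f]

theorem homApp_map_smul (φ : Γ(homSheaf f M N, U)) (a : Γ(X, U)) (m : Γ(M, f ⁻¹ᵁ U)) :
    homApp φ (f.app U a • m) = a • homApp φ m :=
  ((show HomSections f M N U from φ).app U le_rfl).map_smul a m

theorem resM_homApp {V : X.Opens} (hV : V ≤ U) (φ : Γ(homSheaf f M N, U)) (m : Γ(M, f ⁻¹ᵁ U)) :
    resM N hV (homApp φ m) = homApp (resM (homSheaf f M N) hV φ) (resM M (f.preimage_mono hV) m) :=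
  (show HomSections f M N U from φ).naturality U V le_rfl hV m

theorem homSheaf_ext {φ ψ : Γ(homSheaf f M N, U)}
    (h : ∀ (V : X.Opens) (hV : V ≤ U) (m : Γ(M, f ⁻¹ᵁ V)),
      homApp (resM (homSheaf f M N) hV φ) m = homApp (resM (homSheaf f M N) hV ψ) m) : φ = ψ :=
  HomSections.ext (funext fun V ↦ funext fun hV ↦ LinearMap.ext fun m ↦ h V hV m)

/-- A compatible family of semilinear maps defines a section of the sheaf of homomorphisms. -/
def homMk (φ : ∀ V : X.Opens, V ≤ U → (Γ(M, f ⁻¹ᵁ V) →+ Γ(N, V)))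
    (hsmul : ∀ (V : X.Opens) (hV : V ≤ U) (a : Γ(X, V)) (m : Γ(M, f ⁻¹ᵁ V)),
      φ V hV (f.app V a • m) = a • φ V hV m)
    (hres : ∀ (V W : X.Opens) (hV : V ≤ U) (hW : W ≤ V) (m : Γ(M, f ⁻¹ᵁ V)),
      resM N hW (φ V hV m) = φ W (hW.trans hV) (resM M (f.preimage_mono hW) m)) :
    Γ(homSheaf f M N, U) :=
  (show HomSections f M N U from
    { app := fun V hV ↦
        { toFun := φ V hV
          map_add' := map_add (φ V hV)
          map_smul' := hsmul V hV }
      naturality := hres })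

end

/-! ### Negative powers -/

variable {k : ℕ}

theorem evalNeg_add_left (δ δ' : Γ(negPow L k, U)) (s : Γ(tpow L k, U)) :
    evalNeg (δ + δ') s = evalNeg δ s + evalNeg δ' s := rfl

theorem evalNeg_smul (δ : Γ(negPow L k, U)) (a : Γ(X, U)) (s : Γ(tpow L k, U)) :
    evalNeg δ (a • s) = a * evalNeg δ s :=
  homApp_map_smul (f := 𝟙 X) (M := tpow L k) (N := structureModule X) δ a s

theorem evalNeg_smul_left (a : Γ(X, U)) (δ : Γ(negPow L k, U)) (s : Γ(tpow L k, U)) :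
    evalNeg (a • δ) s = a * evalNeg δ s := by
  rw [← evalNeg_smul]
  refine congrArg (evalNeg δ) ?_
  exact congrArg (fun b : Γ(X, U) ↦ b • s) (resO_self le_rfl a)

theorem resO_evalNeg {V : X.Opens} (hV : V ≤ U) (δ : Γ(negPow L k, U)) (s : Γ(tpow L k, U)) :
    resO hV (evalNeg δ s) = evalNeg (resM (negPow L k) hV δ) (resM (tpow L k) hV s) :=
  resM_homApp (f := 𝟙 X) (M := tpow L k) (N := structureModule X) hV δ s

theorem negPow_ext {δ δ' : Γ(negPow L k, U)} {s : Γ(tpow L k, U)} (hs : IsGen s)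
    (h : evalNeg δ s = evalNeg δ' s) : δ = δ' := by
  refine homSheaf_ext (f := 𝟙 X) fun V hV m ↦ ?_
  obtain ⟨c, rfl, -⟩ := hs V hV m
  change evalNeg (resM (negPow L k) hV δ) _ = evalNeg (resM (negPow L k) hV δ') _
  rw [evalNeg_smul, evalNeg_smul, ← resO_evalNeg, ← resO_evalNeg, h]

/-- The form sends a section to its coordinate with respect to `s` times `t`; uniqueness of
coordinates supplies linearity and compatibility with restriction. -/
theorem exists_evalNeg_eq {s : Γ(tpow L k, U)} (hs : IsGen s) (t : Γ(X, U)) :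
    ∃ δ : Γ(negPow L k, U), evalNeg δ s = t := by
  choose c hc huniq using hs
  replace hc (V : X.Opens) (hV : V ≤ U) (m : Γ(tpow L k, V)) :
    m = c V hV m • resM (tpow L k) hV s := hc V hV m
  have hres (V W : X.Opens) (hV : V ≤ U) (hW : W ≤ V) (m : Γ(tpow L k, V)) :
      resO hW (c V hV m) = c W (hW.trans hV) (resM _ hW m) := by
    refine huniq W (hW.trans hV) _ _ ?_
    have := congrArg (resM _ hW) (hc V hV m)
    rwa [resM_smul, resM_resM] at this
  have hadd (V : X.Opens) (hV : V ≤ U) (m m' : Γ(tpow L k, V)) :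
      c V hV (m + m') = c V hV m + c V hV m' := by
    refine (huniq V hV _ _ ?_).symm
    change _ = (c V hV m + c V hV m') • _
    rw [add_smul, ← hc, ← hc]
  have hsmul (V : X.Opens) (hV : V ≤ U) (a : Γ(X, V)) (m : Γ(tpow L k, V)) :
      c V hV (a • m) = a * c V hV m := by
    refine (huniq V hV _ _ ?_).symm
    change _ = (a * c V hV m) • _
    rw [mul_smul, ← hc]
  have h1 : c U le_rfl s = 1 := by
    refine (huniq U le_rfl s 1 ?_).symm
    change s = (1 : Γ(X, U)) • _
    rw [resM_self, one_smul]
  refine ⟨homMk (f := 𝟙 X) (M := tpow L k) (N := structureModule X) (fun V hV ↦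
    AddMonoidHom.mk' (fun m ↦ (c V hV m * resO hV t : Γ(X, V))) fun m m' ↦
      (congrArg (fun x ↦ (x * resO hV t : Γ(X, V))) (hadd V hV m m')).trans (add_mul _ _ _))
    (fun V hV a m ↦
      (congrArg (fun x ↦ (x * resO hV t : Γ(X, V))) (hsmul V hV a m)).trans (mul_assoc _ _ _))
    (fun V W hV hW m ↦ ?_), ?_⟩
  · refine (map_mul (resO hW) _ _).trans ?_
    exact congrArg₂ (fun x y : Γ(X, W) ↦ x * y) (hres V W hV hW m) (resO_resO hV hW t)
  · change c U le_rfl s * resO le_rfl t = t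
    rw [resO_self, h1, one_mul]

/-! ### The Cartier module -/

section

variable {p : ℕ} [Fact p.Prime] {e : ℕ} [IsFpScheme p X]

theorem cartierApp_add_left (C C' : Γ(cartier p e X, U)) (b : Γ(X, U)) :
    cartierApp (C + C') b = cartierApp C b + cartierApp C' b := rfl

theorem resO_cartierApp {V : X.Opens} (hV : V ≤ U) (C : Γ(cartier p e X, U)) (b : Γ(X, U)) :
    resO hV (cartierApp C b) = cartierApp (resM (cartier p e X) hV C) (resO hV b) :=
  resM_homApp (f := frob p e X) (M := structureModule X) (N := structureModule X) hV C b

theorem cartier_ext {C C' : Γ(cartier p e X, U)}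
    (h : ∀ (V : X.Opens) (hV : V ≤ U) (b : Γ(X, V)), cartierApp (resM (cartier p e X) hV C) b =
      cartierApp (resM (cartier p e X) hV C') b) : C = C' :=
  homSheaf_ext (f := frob p e X) h

theorem cartierTensor_eq (C : Γ(cartier p e X, U)) :
    cartierTensor C = frobTensor (natCast_eq_zero p X U) e (cartierApp C) := rfl

theorem cartierTensor_add (C C' : Γ(cartier p e X, U)) (z : Γ(X, U) ⊗[ℤ] Γ(X, U)) :
    cartierTensor (C + C') z = cartierTensor C z + cartierTensor C' z := by
  induction z using TensorProduct.induction_on with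
  | zero => simp
  | tmul x y =>
    rw [cartierTensor_tmul, cartierTensor_tmul, cartierTensor_tmul, cartierApp_add_left,
      add_pow_of_natCast_eq_zero (natCast_eq_zero p X U), mul_add]
  | add x y hx hy => rw [map_add, map_add, map_add, hx, hy, add_add_add_comm]

variable {n : ℕ}

theorem cartierTensor_diagPow (C : Γ(cartier p e X, U)) (g : Fin n → Γ(X, U)) :
    cartierTensor C (diagPow g (p ^ e - 1)) =
      frobSum (p ^ e) g fun I ↦ cartierApp C (∏ i, g i ^ ((I i).rev : ℕ)) :=
  frobTensor_diagonalPow (natCast_eq_zero p X U) e (cartierApp C) g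

theorem resO_cartierTensor {V : X.Opens} (hV : V ≤ U) (C : Γ(cartier p e X, U))
    (g : Fin n → Γ(X, U)) :
    resO hV (cartierTensor C (diagPow g (p ^ e - 1))) =
      cartierTensor (resM (cartier p e X) hV C) (diagPow (fun i ↦ resO hV (g i)) (p ^ e - 1)) := by
  simp only [cartierTensor_diagPow, resO_frobSum, resO_cartierApp, map_prod, map_pow]

theorem natCast_pow_eq_zero {p : ℕ} {e : ℕ} [IsFpScheme p X] (he : 0 < e) (V : X.Opens) : ((p ^ e : ℕ) : Γ(X, V)) = 0 := by
  rw [Nat.cast_pow, natCast_eq_zero p X V, zero_pow he.ne']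

theorem frobAdd_section (p : ℕ) [Fact p.Prime] (e : ℕ) [IsFpScheme p X] (V : X.Opens) :
    FrobAdd (p ^ e) Γ(X, V) :=
  FrobAdd.of_natCast_eq_zero (natCast_eq_zero p X V) e

variable {g : Fin n → Γ(X, U)}

theorem IsChart.cartier_ext (hg : IsChart (p ^ e) g) {C C' : Γ(cartier p e X, U)}
    (h : cartierTensor C (diagPow g (p ^ e - 1)) = cartierTensor C' (diagPow g (p ^ e - 1))) :
    C = C' := by
  refine FrobTwist.cartier_ext fun V hV b ↦ ?_
  have h1 := congrArg (resO hV) h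
  rw [resO_cartierTensor, resO_cartierTensor] at h1
  have h2 (C : Γ(cartier p e X, V)) := (hg V hV).apply_eq_sum (natCast_eq_zero p X V) e
    (cartierApp C) (cartierApp_pow_mul C) b
  rw [h2, h2]
  exact congrArg (fun t ↦ ∑ I, (hg V hV).coeff b I * (hg V hV).coeff t (fun i ↦ (I i).rev)) h1

/-- Over each smaller open set `IsFrobBasis.dualMap` solves the equation; uniqueness of coefficients
makes these maps compatible with restriction. -/
theorem IsChart.exists_cartierTensor_eq (hg : IsChart (p ^ e) g) (t : Γ(X, U)) :
    ∃ C : Γ(cartier p e X, U), cartierTensor C (diagPow g (p ^ e - 1)) = t := by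
  have hres {V W : X.Opens} (hV : V ≤ U) (hW : W ≤ V) (b : Γ(X, V)) (I : Fin n → Fin (p ^ e)) :
      resO hW ((hg V hV).coeff b I) = (hg W (hW.trans hV)).coeff (resO hW b) I := by
    have h := congrArg (resO hW) ((hg V hV).frobSum_coeff b)
    simp only [resO_frobSum, resO_resO] at h
    rw [← h, (hg W (hW.trans hV)).coeff_frobSum]
  have hresDual {V W : X.Opens} (hV : V ≤ U) (hW : W ≤ V) (b : Γ(X, V)) :
      resO hW ((hg V hV).dualMap (natCast_eq_zero p X V) e (resO hV t) b) =
        (hg W (hW.trans hV)).dualMap (natCast_eq_zero p X W) e (resO (hW.trans hV) t)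
          (resO hW b) := by
    change resO hW (∑ I, (hg V hV).coeff b I * (hg V hV).coeff (resO hV t) _) =
      ∑ I, (hg W _).coeff (resO hW b) I * (hg W _).coeff (resO _ t) _
    simp only [map_sum, map_mul, hres, resO_resO]
  let φ (V : X.Opens) (hV : V ≤ U) : Γ(X, V) →+ Γ(X, V) :=
    (hg V hV).dualMap (natCast_eq_zero p X V) e (resO hV t)
  have hφ : frobTensor (natCast_eq_zero p X U) e (φ U le_rfl)
      (diagonalPow (fun i ↦ resO le_rfl (g i)) (p ^ e - 1)) = resO le_rfl t :=
    (hg U le_rfl).frobTensor_dualMap (natCast_eq_zero p X U) e (resO le_rfl t)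
  obtain ⟨C, hC⟩ : ∃ C : Γ(cartier p e X, U), cartierApp C = φ U le_rfl :=
    ⟨homMk (f := frob p e X) (M := structureModule X) (N := structureModule X) φ
      (fun V hV a b ↦ (hg V hV).dualMap_pow_mul (natCast_eq_zero p X V) e _ a b)
      (fun V W hV hW b ↦ hresDual hV hW b), rfl⟩
  refine ⟨C, ?_⟩
  rw [← hC] at hφ
  simp only [resO_self] at hφ
  exact hφ

theorem IsChart.cartierTensor_smul (he : 0 < e) (hg : IsChart (p ^ e) g) (a : Γ(X, U))
    (C : Γ(cartier p e X, U)) : cartierTensor (a • C) (diagPow g (p ^ e - 1)) =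
      a * cartierTensor C (diagPow g (p ^ e - 1)) := by
  have h := hg.isFrobBasis.frobTensor_comp_mulLeft (natCast_eq_zero p X U) e (cartierApp C)
    (cartierApp_pow_mul C) (natCast_pow_eq_zero he U) a
  refine Eq.trans ?_ h
  rw [cartierTensor_eq]
  refine congrArg (fun C ↦ frobTensor (natCast_eq_zero p X U) e C (diagonalPow g (p ^ e - 1))) ?_
  ext b
  exact cartierApp_smul C a b

theorem IsChart.cartierTensor_diagPow_eq_det (he : 0 < e) (hg : IsChart (p ^ e) g)
    (C : Γ(cartier p e X, U)) (h : Fin n → Γ(X, U)) :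
    cartierTensor C (diagPow h (p ^ e - 1)) =
      (Matrix.of fun i j ↦ hg.isFrobBasis.partialDeriv (frobAdd_section p e U) j (h i)).det ^
        (p ^ e - 1) * cartierTensor C (diagPow g (p ^ e - 1)) :=
  hg.isFrobBasis.frobTensor_diagonalPow_eq_det (natCast_eq_zero p X U) e (cartierApp C)
    (cartierApp_pow_mul C) (natCast_pow_eq_zero he U) h

end

end

/-! ### Morphisms defined locally -/

section

variable {X : Scheme.{u}} {M N : X.Modules}

/-- A relation between sections that is local, linear, and functional locally on `X` defines a
morphism of modules. -/
theorem exists_hom_of_rel (R : ∀ V : X.Opens, Γ(M, V) → Γ(N, V) → Prop)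
    (hres : ∀ (V W : X.Opens) (hW : W ≤ V) (m : Γ(M, V)) (t : Γ(N, V)), R V m t →
      R W (resM M hW m) (resM N hW t))
    (huniq : ∀ (V : X.Opens) (m : Γ(M, V)) (t t' : Γ(N, V)), R V m t → R V m t' → t = t')
    (hex : ∀ (V : X.Opens) (m : Γ(M, V)), ∀ x ∈ V, ∃ (W : X.Opens) (hW : W ≤ V), x ∈ W ∧
      ∃ t, R W (resM M hW m) t)
    (hadd : ∀ (V : X.Opens) (m m' : Γ(M, V)) (t t' : Γ(N, V)), R V m t → R V m' t' →
      R V (m + m') (t + t'))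
    (hsmul : ∀ (V : X.Opens) (a : Γ(X, V)) (m : Γ(M, V)) (t : Γ(N, V)), R V m t →
      R V (a • m) (a • t)) :
    ∃ f : M ⟶ N, ∀ (V : X.Opens) (m : Γ(M, V)) (t : Γ(N, V)), R V m t → f.app V m = t := by
  have hglue (V : X.Opens) (m : Γ(M, V)) := resM_glue N (U := V)
    (fun W hW t ↦ R W (resM M hW m) t)
    (fun W W' hW hW' t ht ↦ by
      have := hres W W' hW' _ _ ht
      rwa [resM_resM] at this)
    (fun W hW t t' ht ht' ↦ huniq W _ t t' ht ht') (hex V m)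
  choose F hF using hglue
  -- Near every point a section and its glued image are related, also after shrinking. Additivity
  -- and linearity of `F` are then inherited from `R`.
  have hFloc (V : X.Opens) (m : Γ(M, V)) (x) (hx : x ∈ V) : ∃ (W : X.Opens) (hW : W ≤ V), x ∈ W ∧
      ∀ (W' : X.Opens) (hW' : W' ≤ W),
        R W' (resM M (hW'.trans hW) m) (resM N (hW'.trans hW) (F V m)) := by
    obtain ⟨W, hW, hxW, t, ht⟩ := hex V m x hx
    refine ⟨W, hW, hxW, fun W' hW' ↦ ?_⟩
    have := hres W W' hW' _ _ (hF V m W hW t ht ▸ ht)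
    rwa [resM_resM, resM_resM] at this
  have hFadd (V : X.Opens) (m m' : Γ(M, V)) : F V (m + m') = F V m + F V m' := by
    refine resM_ext N fun x hx ↦ ?_
    obtain ⟨W, hW, hxW, h⟩ := hFloc _ m x hx
    obtain ⟨W', hW', hxW', h'⟩ := hFloc _ m' x hx
    refine ⟨W ⊓ W', inf_le_left.trans hW, ⟨hxW, hxW'⟩, ?_⟩
    have := hadd _ _ _ _ _ (h _ inf_le_left) (h' (W ⊓ W') inf_le_right)
    rw [← map_add, ← map_add] at this
    exact hF _ _ _ _ _ this
  have hFsmul (V : X.Opens) (a : Γ(X, V)) (m : Γ(M, V)) : F V (a • m) = a • F V m := by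
    refine resM_ext N fun x hx ↦ ?_
    obtain ⟨W, hW, hxW, h⟩ := hFloc _ m x hx
    refine ⟨W, hW, hxW, ?_⟩
    have := hsmul _ (resO hW a) _ _ (h W le_rfl)
    rw [← resM_smul, ← resM_smul] at this
    exact hF _ _ _ _ _ this
  have hFres (V W : X.Opens) (hW : W ≤ V) (m : Γ(M, V)) :
      F W (resM M hW m) = resM N hW (F V m) := by
    refine resM_ext N fun x hx ↦ ?_
    obtain ⟨W', hW', hxW', t, ht⟩ := hex W (resM M hW m) x hx
    refine ⟨W', hW', hxW', ?_⟩
    rw [hF W (resM M hW m) W' hW' t ht, resM_resM]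
    rw [resM_resM] at ht
    exact (hF V m W' _ t ht).symm
  let f : M.val ⟶ N.val :=
    { app := fun V ↦ ModuleCat.ofHom (X := M.val.obj V) (Y := N.val.obj V)
        { toFun := F V.unop
          map_add' := hFadd V.unop
          map_smul' := hFsmul V.unop }
      naturality := fun {V W} i ↦ by
        ext m
        exact hFres V.unop W.unop i.unop.le m }
  refine ⟨⟨f⟩, fun V m t h ↦ ?_⟩
  have := hF V m V le_rfl t (by rwa [resM_self])
  rwa [resM_self] at this

theorem hom_ext_of_local {f g : M ⟶ N}
    (h : ∀ (V : X.Opens) (m : Γ(M, V)), ∀ x ∈ V, ∃ (W : X.Opens) (hW : W ≤ V), x ∈ W ∧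
      f.app W (resM M hW m) = g.app W (resM M hW m)) : f = g := by
  ext V m
  refine resM_ext N fun x hx ↦ ?_
  obtain ⟨W, hW, hxW, h⟩ := h V m x hx
  exact ⟨W, hW, hxW, by rw [← app_resM, ← app_resM, h]⟩

/-- The hypotheses are symmetric, so the relation and its transpose both define morphisms; these are
mutually inverse on the small opens where related pairs exist. -/
theorem exists_iso_of_rel (R : ∀ V : X.Opens, Γ(M, V) → Γ(N, V) → Prop)
    (hres : ∀ (V W : X.Opens) (hW : W ≤ V) (m : Γ(M, V)) (t : Γ(N, V)), R V m t →
      R W (resM M hW m) (resM N hW t))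
    (huniq : ∀ (V : X.Opens) (m : Γ(M, V)) (t t' : Γ(N, V)), R V m t → R V m t' → t = t')
    (huniq' : ∀ (V : X.Opens) (m m' : Γ(M, V)) (t : Γ(N, V)), R V m t → R V m' t → m = m')
    (hex : ∀ (V : X.Opens) (m : Γ(M, V)), ∀ x ∈ V, ∃ (W : X.Opens) (hW : W ≤ V), x ∈ W ∧
      ∃ t, R W (resM M hW m) t)
    (hex' : ∀ (V : X.Opens) (t : Γ(N, V)), ∀ x ∈ V, ∃ (W : X.Opens) (hW : W ≤ V), x ∈ W ∧
      ∃ m, R W m (resM N hW t))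
    (hadd : ∀ (V : X.Opens) (m m' : Γ(M, V)) (t t' : Γ(N, V)), R V m t → R V m' t' →
      R V (m + m') (t + t'))
    (hsmul : ∀ (V : X.Opens) (a : Γ(X, V)) (m : Γ(M, V)) (t : Γ(N, V)), R V m t →
      R V (a • m) (a • t)) :
    ∃ f : M ≅ N, ∀ (V : X.Opens) (m : Γ(M, V)) (t : Γ(N, V)), R V m t → f.hom.app V m = t := by
  obtain ⟨f, hf⟩ := exists_hom_of_rel R hres huniq hex hadd hsmul
  obtain ⟨g, hg⟩ := exists_hom_of_rel (fun V t m ↦ R V m t) (fun V W hW t m ↦ hres V W hW m t)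
    (fun V t m m' ↦ huniq' V m m' t) hex' (fun V t t' m m' ↦ hadd V m m' t t')
    (fun V a t m ↦ hsmul V a m t)
  refine ⟨⟨f, g, ?_, ?_⟩, hf⟩
  · refine hom_ext_of_local fun V m x hx ↦ ?_
    obtain ⟨W, hW, hxW, t, ht⟩ := hex V m x hx
    refine ⟨W, hW, hxW, ?_⟩
    change g.app W (f.app W _) = _
    rw [hf W _ t ht, hg W t _ ht]
    rfl
  · refine hom_ext_of_local fun V t x hx ↦ ?_
    obtain ⟨W, hW, hxW, m, hm⟩ := hex' V t x hx
    refine ⟨W, hW, hxW, ?_⟩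
    change f.app W (g.app W _) = _
    rw [hg W _ m hm, hf W m _ hm]
    rfl

end

/-! ### The canonical isomorphism -/

/-- The space is covered by charts. -/
def HasCharts (p e : ℕ) (X : Scheme.{u}) : Prop :=
  ∀ x : X, ∃ (U : X.Opens) (_ : x ∈ U) (n : ℕ) (g : Fin n → Γ(X, U)), IsChart (p ^ e) g

theorem HasCharts.exists_le {p e : ℕ} {X : Scheme.{u}} (hX : HasCharts p e X) {U : X.Opens}
    {x : X} (hx : x ∈ U) :
    ∃ (V : X.Opens) (_ : V ≤ U) (_ : x ∈ V) (n : ℕ) (g : Fin n → Γ(X, V)),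
      IsChart (p ^ e) g := by
  obtain ⟨V, hxV, n, g, hg⟩ := hX x
  exact ⟨U ⊓ V, inf_le_left, ⟨hx, hxV⟩, n, _, hg.res inf_le_right⟩

section

variable {p : ℕ} [Fact p.Prime] {e : ℕ} {X : Scheme.{u}} [IsFpScheme p X] {U : X.Opens} {n : ℕ}

/-- The top form `dg₁ ∧ ⋯ ∧ dgₙ`. -/
abbrev formOf (hn : ∀ x ∈ U, rankAt (Omega X) x = n) (g : Fin n → Γ(X, U)) : Γ(omega X, U) :=
  wedge hn fun i ↦ differential (g i)

theorem resM_formOf (hn : ∀ x ∈ U, rankAt (Omega X) x = n) {V : X.Opens} (hV : V ≤ U)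
    (g : Fin n → Γ(X, U)) :
    resM (omega X) hV (formOf hn g) = formOf (fun x hx ↦ hn x (hV hx)) fun i ↦ resO hV (g i) := by
  refine (resM_wedge hn hV _).trans ?_
  simp only [resM_differential]

variable {g : Fin n → Γ(X, U)}

theorem IsChart.rankAt_eq (he : 0 < e) (hg : IsChart (p ^ e) g) :
    ∀ x ∈ U, rankAt (Omega X) x = n :=
  (hg.isFrame_differential (frobAdd_section p e) (natCast_pow_eq_zero (p := p) he)).rankAt_eq

theorem IsChart.isGen_formOf (he : 0 < e) (hg : IsChart (p ^ e) g)
    (hn : ∀ x ∈ U, rankAt (Omega X) x = n) : IsGen (formOf hn g) :=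
  ((hg.isFrame_differential (frobAdd_section p e)
    (natCast_pow_eq_zero (p := p) he)).isFrame_wedge hn).isGen

theorem IsChart.formOf_eq_det (he : 0 < e) (hg : IsChart (p ^ e) g)
    (hn : ∀ x ∈ U, rankAt (Omega X) x = n) (h : Fin n → Γ(X, U)) :
    formOf hn h = (Matrix.of fun i j ↦ hg.isFrobBasis.partialDeriv
      (frobAdd_section p e U) j (h i)).det • formOf hn g := by
  refine Eq.trans ?_ ((hg.isFrame_differential (frobAdd_section p e)
    (natCast_pow_eq_zero (p := p) he)).wedge_sum hn _)
  refine congrArg (wedge hn) (funext fun i ↦ ?_)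
  exact hg.differential_eq (frobAdd_section p e U) (natCast_pow_eq_zero (p := p) he U) (h i)

/-- The normalization of the canonical isomorphism, for a pair of sections. -/
def IsCanonicalPair (U : X.Opens) (δ : Γ(negPow (omega X) (p ^ e - 1), U))
    (C : Γ(cartier p e X, U)) : Prop :=
  ∀ (V : X.Opens) (hV : V ≤ U) (n : ℕ) (hn : ∀ x ∈ V, rankAt (Omega X) x = n)
    (g : Fin n → Γ(X, V)), evalNeg (resM (negPow (omega X) (p ^ e - 1)) hV δ)
      (secPow (formOf hn g) (p ^ e - 1)) =
        cartierTensor (resM (cartier p e X) hV C) (diagPow g (p ^ e - 1))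

/-- A chart normalizes a pair of sections. -/
theorem IsChart.isCanonicalPair (he : 0 < e) (hg : IsChart (p ^ e) g)
    (hn : ∀ x ∈ U, rankAt (Omega X) x = n) {δ : Γ(negPow (omega X) (p ^ e - 1), U)}
    {C : Γ(cartier p e X, U)} (h : evalNeg δ (secPow (formOf hn g) (p ^ e - 1)) =
      cartierTensor C (diagPow g (p ^ e - 1))) : IsCanonicalPair U δ C := by
  intro V hV m hm f
  -- A nonempty `V` forces the two ranks to agree, and then both sides acquire the same power of the
  -- Jacobian determinant. Over the empty set all functions coincide.
  by_cases hne : ∃ x, x ∈ V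
  · obtain ⟨x, hx⟩ := hne
    obtain rfl : n = m := (hn x (hV hx)).symm.trans (hm x hx)
    have h' := congrArg (resO hV) h
    rw [resO_cartierTensor, resO_evalNeg, resM_secPow, resM_formOf] at h'
    have hgV := hg.res hV
    rw [hgV.formOf_eq_det he hm f, secPow_smul, evalNeg_smul,
      hgV.cartierTensor_diagPow_eq_det he _ f, h']
  · have := subsingleton_of_forall_notMem (not_exists.1 hne)
    exact Subsingleton.elim _ _

/-- In a chart, evaluating `δ` at the generator and `C` at the diagonal power are both bijections
onto functions. Hence `IsCanonicalPair` is locally the graph of an isomorphism, and any isomorphism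
with the normalization has this graph. -/
theorem HasCharts.exists_canonicalIso (he : 0 < e) (hX : HasCharts p e X) :
    ∃ Φ : negPow (omega X) (p ^ e - 1) ≅ cartier p e X, IsCanonicalIso Φ ∧
      ∀ Ψ : negPow (omega X) (p ^ e - 1) ≅ cartier p e X, IsCanonicalIso Ψ → Ψ = Φ := by
  have hres (V W : X.Opens) (hW : W ≤ V) (δ : Γ(negPow (omega X) (p ^ e - 1), V))
      (C : Γ(cartier p e X, V)) (h : IsCanonicalPair V δ C) :
      IsCanonicalPair W (resM _ hW δ) (resM _ hW C) := fun W' hW' m hm f ↦ by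
    rw [resM_resM, resM_resM]; exact h W' _ m hm f
  have hself {V : X.Opens} {δ : Γ(negPow (omega X) (p ^ e - 1), V)} {C : Γ(cartier p e X, V)}
      (h : IsCanonicalPair V δ C) {n : ℕ} (hn : ∀ x ∈ V, rankAt (Omega X) x = n)
      (g : Fin n → Γ(X, V)) : evalNeg δ (secPow (formOf hn g) (p ^ e - 1)) =
        cartierTensor C (diagPow g (p ^ e - 1)) := by
    have := h V le_rfl n hn g
    rwa [resM_self, resM_self] at this
  have huniq (V : X.Opens) (δ : Γ(negPow (omega X) (p ^ e - 1), V))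
      (C C' : Γ(cartier p e X, V)) (h : IsCanonicalPair V δ C) (h' : IsCanonicalPair V δ C') :
      C = C' := by
    refine resM_ext _ fun x hx ↦ ?_
    obtain ⟨W, hW, hxW, n, g, hg⟩ := hX.exists_le hx
    refine ⟨W, hW, hxW, hg.cartier_ext ?_⟩
    rw [← hself (hres V W hW _ _ h) (hg.rankAt_eq he), ← hself (hres V W hW _ _ h')]
  have huniq' (V : X.Opens) (δ δ' : Γ(negPow (omega X) (p ^ e - 1), V))
      (C : Γ(cartier p e X, V)) (h : IsCanonicalPair V δ C) (h' : IsCanonicalPair V δ' C) :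
      δ = δ' := by
    refine resM_ext _ fun x hx ↦ ?_
    obtain ⟨W, hW, hxW, n, g, hg⟩ := hX.exists_le hx
    refine ⟨W, hW, hxW, negPow_ext
      ((hg.isGen_formOf he (hg.rankAt_eq he)).secPow (p ^ e - 1)) ?_⟩
    rw [hself (hres V W hW _ _ h), hself (hres V W hW _ _ h')]
  have hloc (V : X.Opens) (δ : Γ(negPow (omega X) (p ^ e - 1), V)) (x) (hx : x ∈ V) :
      ∃ (W : X.Opens) (hW : W ≤ V), x ∈ W ∧ ∃ C, IsCanonicalPair W (resM _ hW δ) C := by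
    obtain ⟨W, hW, hxW, n, g, hg⟩ := hX.exists_le hx
    obtain ⟨C, hC⟩ := hg.exists_cartierTensor_eq
      (evalNeg (resM _ hW δ) (secPow (formOf (hg.rankAt_eq he) g) (p ^ e - 1)))
    exact ⟨W, hW, hxW, C, hg.isCanonicalPair he _ hC.symm⟩
  have hloc' (V : X.Opens) (C : Γ(cartier p e X, V)) (x) (hx : x ∈ V) :
      ∃ (W : X.Opens) (hW : W ≤ V), x ∈ W ∧ ∃ δ, IsCanonicalPair W δ (resM _ hW C) := by
    obtain ⟨W, hW, hxW, n, g, hg⟩ := hX.exists_le hx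
    obtain ⟨δ, hδ⟩ := exists_evalNeg_eq
      ((hg.isGen_formOf he (hg.rankAt_eq he)).secPow (p ^ e - 1))
      (cartierTensor (resM _ hW C) (diagPow g (p ^ e - 1)))
    exact ⟨W, hW, hxW, δ, hg.isCanonicalPair he _ hδ⟩
  obtain ⟨Φ, hΦ⟩ := exists_iso_of_rel IsCanonicalPair hres huniq huniq' hloc hloc'
    (fun V δ δ' C C' h h' W hW n hn g ↦ by
      rw [map_add, map_add, evalNeg_add_left, cartierTensor_add, h W hW n hn g, h' W hW n hn g])
    -- Linearity of the diagonal value in `C` is available for chart functions, so the scalar rule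
    -- is first proved on charts and then transferred to arbitrary `f`.
    (fun V a δ C h W hW m hm f ↦ by
      refine resO_ext fun x hx ↦ ?_
      obtain ⟨W', hW', hxW', n, g, hg⟩ := hX.exists_le hx
      refine ⟨W', hW', hxW', ?_⟩
      have h1 : IsCanonicalPair W' (resM _ (hW'.trans hW) (a • δ))
          (resM _ (hW'.trans hW) (a • C)) := by
        refine hg.isCanonicalPair he (hg.rankAt_eq he) ?_
        rw [resM_smul, resM_smul, evalNeg_smul_left, hg.cartierTensor_smul he,
          hself (hres V W' (hW'.trans hW) _ _ h)]
      rw [resO_evalNeg, resO_cartierTensor, resM_secPow, resM_formOf, resM_resM, resM_resM]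
      exact hself h1 _ _)
  have hpair (V : X.Opens) (δ : Γ(negPow (omega X) (p ^ e - 1), V)) (x) (hx : x ∈ V) :
      ∃ (W : X.Opens) (hW : W ≤ V), x ∈ W ∧ IsCanonicalPair W (resM _ hW δ)
        (resM _ hW (Φ.hom.app V δ)) := by
    obtain ⟨W, hW, hxW, C, hC⟩ := hloc V δ x hx
    refine ⟨W, hW, hxW, ?_⟩
    rw [← app_resM, hΦ _ _ _ hC]
    exact hC
  have hcan (V : X.Opens) (n : ℕ) (hn : ∀ x ∈ V, rankAt (Omega X) x = n) (g : Fin n → Γ(X, V))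
      (δ : Γ(negPow (omega X) (p ^ e - 1), V)) : evalNeg δ (secPow (formOf hn g) (p ^ e - 1)) =
        cartierTensor (Φ.hom.app V δ) (diagPow g (p ^ e - 1)) := by
    refine resO_ext fun x hx ↦ ?_
    obtain ⟨W, hW, hxW, h⟩ := hpair V δ x hx
    refine ⟨W, hW, hxW, ?_⟩
    rw [resO_evalNeg, resO_cartierTensor, resM_secPow, resM_formOf]
    exact hself h _ _
  refine ⟨Φ, hcan, fun Ψ hΨ ↦ ?_⟩
  · refine Iso.ext (hom_ext_of_local fun V δ x hx ↦ ?_)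
    obtain ⟨W, hW, hxW, C, hC⟩ := hloc V δ x hx
    refine ⟨W, hW, hxW, ?_⟩
    rw [hΦ _ _ _ hC]
    refine huniq W _ _ _ (fun W' hW' n hn g ↦ ?_) hC
    rw [← app_resM]
    exact hΨ W' n hn g _

end

/-! ### The sheaf of homomorphisms from the Cartier module -/

section

variable {p : ℕ} [Fact p.Prime] {e : ℕ} {X : Scheme.{u}} [IsFpScheme p X] {U : X.Opens}
  {M N : X.Modules}

variable (p e) in
/-- The sheaf of homomorphisms from `F_{q*} 𝒞` to `N`, a model of `F_q^* N`. -/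
abbrev cartierDual (N : X.Modules) : X.Modules := homSheaf (frob p e X) (cartier p e X) N

/-- The value of a section of `cartierDual` at a section of the Cartier module. -/
def dualApp (φ : Γ(cartierDual p e N, U)) : Γ(cartier p e X, U) →+ Γ(N, U) :=
  homApp (f := frob p e X) φ

theorem dualApp_pow_smul (φ : Γ(cartierDual p e N, U)) (a : Γ(X, U)) (C : Γ(cartier p e X, U)) :
    dualApp φ (a ^ p ^ e • C) = a • dualApp φ C :=
  homApp_map_smul (f := frob p e X) φ a C

theorem dualApp_add (φ ψ : Γ(cartierDual p e N, U)) (C : Γ(cartier p e X, U)) :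
    dualApp (φ + ψ) C = dualApp φ C + dualApp ψ C := rfl

theorem dualApp_sum {ι : Type*} (s : Finset ι) (φ : ι → Γ(cartierDual p e N, U))
    (C : Γ(cartier p e X, U)) : dualApp (∑ i ∈ s, φ i) C = ∑ i ∈ s, dualApp (φ i) C :=
  map_sum (AddMonoidHom.mk' (fun φ : Γ(cartierDual p e N, U) ↦ dualApp φ C)
    fun φ ψ ↦ dualApp_add φ ψ C) _ _

theorem dualApp_smul (a : Γ(X, U)) (φ : Γ(cartierDual p e N, U)) (C : Γ(cartier p e X, U)) :
    dualApp (a • φ) C = dualApp φ (a • C) := by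
  refine congrArg (dualApp φ) ?_
  exact congrArg (fun b : Γ(X, U) ↦ b • C) (resO_self le_rfl a)

theorem resM_dualApp {V : X.Opens} (hV : V ≤ U) (φ : Γ(cartierDual p e N, U))
    (C : Γ(cartier p e X, U)) :
    resM N hV (dualApp φ C) = dualApp (resM (cartierDual p e N) hV φ) (resM _ hV C) :=
  resM_homApp (f := frob p e X) hV φ C

theorem cartierDual_ext {φ ψ : Γ(cartierDual p e N, U)}
    (h : ∀ (V : X.Opens) (hV : V ≤ U) (C : Γ(cartier p e X, V)),
      dualApp (resM (cartierDual p e N) hV φ) C = dualApp (resM (cartierDual p e N) hV ψ) C) :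
    φ = ψ :=
  homSheaf_ext (f := frob p e X) h

theorem cartierApp_pow_smul (a : Γ(X, U)) (C : Γ(cartier p e X, U)) (b : Γ(X, U)) :
    cartierApp (a ^ p ^ e • C) b = a * cartierApp C b := by
  rw [cartierApp_smul, cartierApp_pow_mul]

theorem cartierApp_sum {ι : Type*} (s : Finset ι) (C : ι → Γ(cartier p e X, U)) (b : Γ(X, U)) :
    cartierApp (∑ i ∈ s, C i) b = ∑ i ∈ s, cartierApp (C i) b :=
  map_sum (AddMonoidHom.mk' (fun C : Γ(cartier p e X, U) ↦ cartierApp C b)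
    fun C C' ↦ cartierApp_add_left C C' b) _ _

variable (p e) in
/-- The section `C ↦ C(a) • n`. -/
def evalAt (a : Γ(X, U)) (n : Γ(N, U)) : Γ(cartierDual p e N, U) :=
  let φ (V : X.Opens) (hV : V ≤ U) : Γ(cartier p e X, V) →+ Γ(N, V) :=
    AddMonoidHom.mk' (fun C ↦ cartierApp C (resO hV a) • resM N hV n) fun C C' ↦ by
      rw [cartierApp_add_left, add_smul]
  have h1 (V : X.Opens) (hV : V ≤ U) (b : Γ(X, V)) (C : Γ(cartier p e X, V)) :
      φ V hV (b ^ p ^ e • C) = b • φ V hV C := by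
    change cartierApp (b ^ p ^ e • C) (resO hV a) • resM N hV n =
      b • cartierApp C (resO hV a) • resM N hV n
    rw [cartierApp_pow_smul, mul_smul]
  have h2 (V W : X.Opens) (hV : V ≤ U) (hW : W ≤ V) (C : Γ(cartier p e X, V)) :
      resM N hW (φ V hV C) = φ W (hW.trans hV) (resM _ hW C) := by
    change resM N hW (cartierApp C (resO hV a) • resM N hV n) =
      cartierApp (resM _ hW C) (resO (hW.trans hV) a) • resM N (hW.trans hV) n
    rw [resM_smul, resO_cartierApp, resM_resM, resO_resO]
  homMk (f := frob p e X) φ h1 h2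

theorem dualApp_evalAt (a : Γ(X, U)) (n : Γ(N, U)) (C : Γ(cartier p e X, U)) :
    dualApp (evalAt p e a n) C = cartierApp C a • n := by
  change cartierApp C (resO le_rfl a) • resM N le_rfl n = _
  rw [resO_self, resM_self]

theorem resM_evalAt {V : X.Opens} (hV : V ≤ U) (a : Γ(X, U)) (n : Γ(N, U)) :
    resM (cartierDual p e N) hV (evalAt p e a n) = evalAt p e (resO hV a) (resM N hV n) := by
  refine cartierDual_ext fun W hW C ↦ ?_
  have h (V : X.Opens) (hV : V ≤ U) (C : Γ(cartier p e X, V)) :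
      dualApp (resM (cartierDual p e N) hV (evalAt p e a n)) C =
        cartierApp C (resO hV a) • resM N hV n := rfl
  have h' : dualApp (resM (cartierDual p e N) hW (evalAt p e (resO hV a) (resM N hV n))) C =
    cartierApp C (resO hW (resO hV a)) • resM N hW (resM N hV n) := rfl
  rw [resM_resM, h, h', resM_resM, resO_resO]

theorem smul_evalAt (a b : Γ(X, U)) (n : Γ(N, U)) :
    a • evalAt p e b n = evalAt p e (a * b) n := by
  refine cartierDual_ext fun V hV C ↦ ?_
  rw [resM_smul, dualApp_smul, resM_evalAt, resM_evalAt, dualApp_evalAt, dualApp_evalAt,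
    cartierApp_smul, map_mul (resO hV)]

theorem evalAt_smul (a b : Γ(X, U)) (n : Γ(N, U)) :
    evalAt p e a (b • n) = evalAt p e (b ^ p ^ e * a) n := by
  refine cartierDual_ext fun V hV C ↦ ?_
  rw [resM_evalAt, resM_evalAt, dualApp_evalAt, dualApp_evalAt, map_mul (resO hV), map_pow,
    cartierApp_pow_mul, resM_smul, smul_smul, mul_comm]

theorem evalAt_add (a : Γ(X, U)) (n n' : Γ(N, U)) :
    evalAt p e a (n + n') = evalAt p e a n + evalAt p e a n' := by
  refine cartierDual_ext fun V hV C ↦ ?_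
  rw [map_add, dualApp_add, resM_evalAt, resM_evalAt, resM_evalAt, dualApp_evalAt, dualApp_evalAt,
    dualApp_evalAt, map_add, smul_add]

section

variable {n : ℕ} {g : Fin n → Γ(X, U)}

/-- By `IsFrobBasis.apply_eq_sum`, the coordinate functional at `I` is the section whose diagonal
value is the complementary monomial `g ^ (q-1-I)`. -/
theorem IsChart.exists_dual (hg : IsChart (p ^ e) g) (I : Fin n → Fin (p ^ e)) :
    ∃ C : Γ(cartier p e X, U), ∀ (V : X.Opens) (hV : V ≤ U) (b : Γ(X, V)),
      cartierApp (resM _ hV C) b = (hg V hV).coeff b I := by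
  classical
  obtain ⟨C, hC⟩ := hg.exists_cartierTensor_eq (∏ i, g i ^ ((I i).rev : ℕ))
  refine ⟨C, fun V hV b ↦ ?_⟩
  have h := congrArg (resO hV) hC
  rw [resO_cartierTensor] at h
  have h2 := (hg V hV).apply_eq_sum (natCast_eq_zero p X V) e (cartierApp (resM _ hV C))
    (cartierApp_pow_mul _) b
  have h3 : frobTensor (natCast_eq_zero p X V) e (cartierApp (resM _ hV C))
      (diagonalPow (fun i ↦ resO hV (g i)) (p ^ e - 1)) =
        ∏ i, resO hV (g i) ^ ((I i).rev : ℕ) := by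
    refine Eq.trans h ?_
    simp only [map_prod, map_pow]
  have h4 := frobSum_single (frobAdd_section p e V) (g := fun i ↦ resO hV (g i))
    (fun i ↦ (I i).rev) 1
  rw [one_pow, one_mul] at h4
  rw [h2, h3, ← h4, (hg V hV).coeff_frobSum, Finset.sum_eq_single I]
  · rw [Pi.single_eq_same, mul_one]
  · intro J _ hJ
    rw [Pi.single_eq_of_ne, mul_zero]
    intro h
    exact hJ (funext fun i ↦ Fin.rev_injective (congrFun h i))
  · simp

/-- The section `b ↦ (coefficient of b at g ^ I)` of the Cartier module. -/
def IsChart.dual (hg : IsChart (p ^ e) g) (I : Fin n → Fin (p ^ e)) : Γ(cartier p e X, U) :=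
  (hg.exists_dual I).choose

theorem IsChart.cartierApp_dual (hg : IsChart (p ^ e) g) (I : Fin n → Fin (p ^ e))
    {V : X.Opens} (hV : V ≤ U) (b : Γ(X, V)) :
    cartierApp (resM _ hV (hg.dual I)) b = (hg V hV).coeff b I :=
  (hg.exists_dual I).choose_spec V hV b

theorem IsChart.cartierApp_dual_self (hg : IsChart (p ^ e) g) (b : Γ(X, U)) :
    frobSum (p ^ e) g (fun I ↦ cartierApp (hg.dual I) b) = b := by
  have h (I) := hg.cartierApp_dual I le_rfl b
  simp only [resM_self] at h
  simp only [h]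
  have := (hg U le_rfl).frobSum_coeff b
  simp only [resO_self] at this
  exact this

/-- A dual basis expansion: `C` is determined by its values on the monomials, and `a ^ q • C` is `a`
times `C` as a map. -/
theorem IsChart.cartier_eq_sum (hg : IsChart (p ^ e) g) {V : X.Opens} (hV : V ≤ U)
    (C : Γ(cartier p e X, V)) :
    C = ∑ I : Fin n → Fin (p ^ e), (cartierApp C (resO hV (∏ i, g i ^ (I i : ℕ)))) ^ p ^ e •
      resM _ hV (hg.dual I) := by
  refine FrobTwist.cartier_ext fun W hW b ↦ ?_
  rw [map_sum, cartierApp_sum]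
  simp only [resM_smul, map_pow, cartierApp_pow_smul, resM_resM, hg.cartierApp_dual,
    resO_cartierApp, resO_resO]
  conv_lhs => rw [← (hg W (hW.trans hV)).frobSum_coeff b, frobSum, map_sum]
  refine Finset.sum_congr rfl fun I _ ↦ ?_
  rw [cartierApp_pow_mul, mul_comm]
  simp only [map_prod, map_pow]

/-- Evaluating on the dual basis shows that every section of `cartierDual` is, in a chart, a sum of
the sections coming from `F_q^* N`. -/
theorem IsChart.eq_sum_evalAt (hg : IsChart (p ^ e) g) (φ : Γ(cartierDual p e N, U)) :
    φ = ∑ I : Fin n → Fin (p ^ e), evalAt p e (∏ i, g i ^ (I i : ℕ)) (dualApp φ (hg.dual I)) := by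
  refine cartierDual_ext fun V hV C ↦ ?_
  rw [map_sum, dualApp_sum]
  simp only [resM_evalAt, dualApp_evalAt, resM_dualApp]
  conv_lhs => rw [hg.cartier_eq_sum hV C, map_sum]
  simp only [dualApp_pow_smul]

end

end

/-! ### The Frobenius pullback -/

section

variable {p : ℕ} [Fact p.Prime] {e : ℕ} {X : Scheme.{u}} [IsFpScheme p X] {U : X.Opens}
  {M N : X.Modules}

variable (p e) in
/-- The pullback `F_q^* N`. -/
abbrev frobPull (N : X.Modules) : X.Modules := (Scheme.Modules.pullback (frob p e X)).obj N

variable (p e) in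
/-- The section `1 ⊗ n` of `F_q^* N`. -/
def frobSec (n : Γ(N, U)) : Γ(frobPull p e N, U) := pullbackSection (frob p e X) n

theorem frobSec_add (n n' : Γ(N, U)) : frobSec p e (n + n') = frobSec p e n + frobSec p e n' :=
  map_add (((Scheme.Modules.pullbackPushforwardAdjunction (frob p e X)).unit.app N).app U).hom n n'

theorem frobSec_sum {ι : Type*} (s : Finset ι) (n : ι → Γ(N, U)) :
    frobSec p e (∑ i ∈ s, n i) = ∑ i ∈ s, frobSec p e (n i) :=
  map_sum (AddMonoidHom.mk' (fun n : Γ(N, U) ↦ frobSec p e n) frobSec_add) _ _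

theorem frobSec_smul (a : Γ(X, U)) (n : Γ(N, U)) :
    frobSec p e (a • n) = a ^ p ^ e • frobSec p e n :=
  Scheme.Modules.Hom.app_smul
    ((Scheme.Modules.pullbackPushforwardAdjunction (frob p e X)).unit.app N) a n

theorem resM_frobSec {V : X.Opens} (hV : V ≤ U) (n : Γ(N, U)) :
    resM (frobPull p e N) hV (frobSec p e n) = frobSec p e (resM N hV n) :=
  (app_resM ((Scheme.Modules.pullbackPushforwardAdjunction (frob p e X)).unit.app N) hV n).symm

theorem pullback_map_app_frobSec (b : M ⟶ N) (n : Γ(M, U)) :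
    ((Scheme.Modules.pullback (frob p e X)).map b).app U (frobSec p e n) =
      frobSec p e (b.app U n) := by
  have h := (Scheme.Modules.pullbackPushforwardAdjunction (frob p e X)).unit.naturality b
  exact (congrArg (fun φ ↦ Scheme.Modules.Hom.app φ U n) h).symm

theorem pullback_hom_ext {f g : frobPull p e N ⟶ M}
    (h : ∀ (U : X.Opens) (n : Γ(N, U)), f.app U (frobSec p e n) = g.app U (frobSec p e n)) :
    f = g := by
  refine ((Scheme.Modules.pullbackPushforwardAdjunction (frob p e X)).homEquiv N M).injective ?_
  rw [Adjunction.homEquiv_unit, Adjunction.homEquiv_unit]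
  ext V n
  exact h V n

/-- By adjunction, a `q`-semilinear family compatible with restriction is a morphism into the
pushforward, hence one out of the pullback. -/
theorem exists_pullback_hom (ν : ∀ U : X.Opens, Γ(N, U) → Γ(M, U))
    (hadd : ∀ (U : X.Opens) (n n' : Γ(N, U)), ν U (n + n') = ν U n + ν U n')
    (hsmul : ∀ (U : X.Opens) (a : Γ(X, U)) (n : Γ(N, U)), ν U (a • n) = a ^ p ^ e • ν U n)
    (hres : ∀ (U V : X.Opens) (hV : V ≤ U) (n : Γ(N, U)), resM M hV (ν U n) = ν V (resM N hV n)) :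
    ∃ f : frobPull p e N ⟶ M, ∀ (U : X.Opens) (n : Γ(N, U)),
      f.app U (frobSec p e n) = ν U n := by
  obtain ⟨φ, hφ⟩ := exists_hom_of_rel (M := N)
    (N := (Scheme.Modules.pushforward (frob p e X)).obj M) (fun U n m ↦ m = ν U n)
    (fun V W hW n m h ↦ by subst h; exact hres V W hW n)
    (fun V n m m' h h' ↦ h.trans h'.symm)
    (fun V n x hx ↦ ⟨V, le_rfl, hx, _, rfl⟩)
    (fun V n n' m m' h h' ↦ by subst h h'; exact (hadd V n n').symm)
    (fun V a n m h ↦ by subst h; exact (hsmul V a n).symm)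
  let adj := Scheme.Modules.pullbackPushforwardAdjunction (frob p e X)
  refine ⟨(adj.homEquiv N M).symm φ, fun U n ↦ ?_⟩
  have h := (adj.homEquiv N M).apply_symm_apply φ
  rw [Adjunction.homEquiv_unit] at h
  refine Eq.trans ?_ (hφ U n _ rfl)
  exact congrArg (fun φ ↦ Scheme.Modules.Hom.app φ U n) h

variable (p e) in
/-- The comparison `F_q^* N ⟶ ℋom(F_{q*} 𝒞, N)`, `a ⊗ n ↦ (C ↦ C(a) • n)`. -/
def toDual (N : X.Modules) : frobPull p e N ⟶ cartierDual p e N :=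
  (exists_pullback_hom (p := p) (e := e) (M := cartierDual p e N) (fun _ n ↦ evalAt p e 1 n)
    (fun _ n n' ↦ evalAt_add 1 n n')
    (fun _ a n ↦ by rw [evalAt_smul, smul_evalAt])
    (fun _ _ hV n ↦ by rw [resM_evalAt, map_one])).choose

theorem toDual_app_frobSec (n : Γ(N, U)) :
    (toDual p e N).app U (frobSec p e n) = evalAt p e 1 n :=
  (exists_pullback_hom (p := p) (e := e) (M := cartierDual p e N) (fun _ n ↦ evalAt p e 1 n)
    (fun _ n n' ↦ evalAt_add 1 n n')
    (fun _ a n ↦ by rw [evalAt_smul, smul_evalAt])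
    (fun _ _ hV n ↦ by rw [resM_evalAt, map_one])).choose_spec U n

theorem toDual_app_smul_frobSec (a : Γ(X, U)) (n : Γ(N, U)) :
    (toDual p e N).app U (a • frobSec p e n) = evalAt p e a n := by
  rw [Scheme.Modules.Hom.app_smul, toDual_app_frobSec, smul_evalAt, mul_one]

theorem toDual_app_sum {k : ℕ} (a : Fin k → Γ(X, U)) (n : Fin k → Γ(N, U)) :
    (toDual p e N).app U (∑ j, a j • frobSec p e (n j)) = ∑ j, evalAt p e (a j) (n j) := by
  refine (map_sum ((toDual p e N).app U).hom _ _).trans (Finset.sum_congr rfl fun j _ ↦ ?_)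
  exact toDual_app_smul_frobSec (a j) (n j)

/-- Expanding each `a j` in the `q`-basis and moving its `q`-th power coefficients across the tensor
rewrites the sum through its image in `cartierDual` alone. This makes the inverse of `toDual` well
defined. -/
theorem IsChart.sum_smul_frobSec {n : ℕ} {g : Fin n → Γ(X, U)} (hg : IsChart (p ^ e) g) {k : ℕ}
    (a : Fin k → Γ(X, U)) (m : Fin k → Γ(N, U)) :
    ∑ j, a j • frobSec p e (m j) = ∑ I : Fin n → Fin (p ^ e), (∏ i, g i ^ (I i : ℕ)) •
      frobSec p e (dualApp (∑ j, evalAt p e (a j) (m j)) (hg.dual I)) := by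
  simp only [dualApp_sum, dualApp_evalAt, frobSec_sum, frobSec_smul, Finset.smul_sum, smul_smul]
  rw [Finset.sum_comm]
  refine Finset.sum_congr rfl fun j _ ↦ ?_
  conv_lhs => rw [← hg.cartierApp_dual_self (a j), frobSum, Finset.sum_smul]
  exact Finset.sum_congr rfl fun I _ ↦ by rw [mul_comm]

/-- The relation pairs `∑ evalAt (a j) (n j)` with `∑ a j ⊗ n j`. Representations exist in charts by
`IsChart.eq_sum_evalAt`, and the result does not depend on them by `IsChart.sum_smul_frobSec`. -/
theorem HasCharts.exists_ofDual (hX : HasCharts p e X) (N : X.Modules) :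
    ∃ r : cartierDual p e N ⟶ frobPull p e N, ∀ (U : X.Opens) (a : Γ(X, U)) (n : Γ(N, U)),
      r.app U (evalAt p e a n) = a • frobSec p e n := by
  obtain ⟨r, hr⟩ := exists_hom_of_rel (M := cartierDual p e N) (N := frobPull p e N)
    (fun U φ s ↦ ∃ (k : ℕ) (a : Fin k → Γ(X, U)) (n : Fin k → Γ(N, U)),
      φ = ∑ j, evalAt p e (a j) (n j) ∧ s = ∑ j, a j • frobSec p e (n j))
    (by
      rintro V W hW _ _ ⟨k, a, n, rfl, rfl⟩
      refine ⟨k, fun j ↦ resO hW (a j), fun j ↦ resM N hW (n j), ?_, ?_⟩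
      · rw [map_sum]; simp only [resM_evalAt]
      · rw [map_sum]; simp only [resM_smul, resM_frobSec])
    (by
      rintro V _ _ _ ⟨k, a, n, rfl, rfl⟩ ⟨k', a', n', h, rfl⟩
      refine resM_ext _ fun x hx ↦ ?_
      obtain ⟨W, hW, hxW, _, g, hg⟩ := hX.exists_le hx
      refine ⟨W, hW, hxW, ?_⟩
      have h' := congrArg (resM _ hW) h
      simp only [map_sum, resM_evalAt] at h'
      simp only [map_sum, resM_smul, resM_frobSec]
      rw [hg.sum_smul_frobSec, hg.sum_smul_frobSec, h'])
    (by
      intro V φ x hx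
      obtain ⟨W, hW, hxW, d, g, hg⟩ := hX.exists_le hx
      let ε := Fintype.equivFin (Fin d → Fin (p ^ e))
      refine ⟨W, hW, hxW, _, Fintype.card (Fin d → Fin (p ^ e)),
        fun j ↦ ∏ i, g i ^ (ε.symm j i : ℕ),
        fun j ↦ dualApp (resM _ hW φ) (hg.dual (ε.symm j)), ?_, rfl⟩
      conv_lhs => rw [hg.eq_sum_evalAt (resM _ hW φ)]
      exact (ε.symm.sum_comp _).symm)
    (by
      rintro V _ _ _ _ ⟨k, a, n, rfl, rfl⟩ ⟨k', a', n', rfl, rfl⟩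
      refine ⟨k + k', Fin.append a a', Fin.append n n', ?_, ?_⟩ <;> simp [Fin.sum_univ_add])
    (by
      rintro V b _ _ ⟨k, a, n, rfl, rfl⟩
      refine ⟨k, fun j ↦ b * a j, n, ?_, ?_⟩
      · simp only [Finset.smul_sum, smul_evalAt]
      · simp only [Finset.smul_sum, smul_smul])
  exact ⟨r, fun U a n ↦ hr U _ _ ⟨1, fun _ ↦ a, fun _ ↦ n, by simp, by simp⟩⟩

theorem HasCharts.exists_toDual_comp (hX : HasCharts p e X) (N : X.Modules) :
    ∃ r : cartierDual p e N ⟶ frobPull p e N, toDual p e N ≫ r = 𝟙 _ ∧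
      ∀ (U : X.Opens) (a : Γ(X, U)) (n : Γ(N, U)),
        r.app U (evalAt p e a n) = a • frobSec p e n := by
  obtain ⟨r, hr⟩ := hX.exists_ofDual N
  refine ⟨r, pullback_hom_ext fun U n ↦ ?_, hr⟩
  change r.app U ((toDual p e N).app U _) = _
  rw [toDual_app_frobSec, hr, one_smul]
  rfl

theorem HasCharts.toDual_injective (hX : HasCharts p e X) :
    Function.Injective ((toDual p e N).app U) := by
  obtain ⟨r, hr, -⟩ := hX.exists_toDual_comp N
  intro s t h
  have h1 (s : Γ(frobPull p e N, U)) : r.app U ((toDual p e N).app U s) = s :=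
    congrArg (fun φ ↦ Scheme.Modules.Hom.app φ U s) hr
  rw [← h1 s, h, h1]

/-- The pullback is handled through its universal property; passing to `cartierDual` and back gives
the local expression of its sections as sums of tensors. -/
theorem HasCharts.exists_eq_sum_frobSec (hX : HasCharts p e X) (s : Γ(frobPull p e N, U)) :
    ∀ x ∈ U, ∃ (V : X.Opens) (hV : V ≤ U), x ∈ V ∧
      ∃ (k : ℕ) (a : Fin k → Γ(X, V)) (n : Fin k → Γ(N, V)),
        resM _ hV s = ∑ j, a j • frobSec p e (n j) := by
  intro x hx
  obtain ⟨r, hr, hr'⟩ := hX.exists_toDual_comp N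
  obtain ⟨V, hV, hxV, d, g, hg⟩ := hX.exists_le hx
  let ε := Fintype.equivFin (Fin d → Fin (p ^ e))
  let φ := (toDual p e N).app V (resM _ hV s)
  refine ⟨V, hV, hxV, Fintype.card (Fin d → Fin (p ^ e)), fun j ↦ ∏ i, g i ^ (ε.symm j i : ℕ),
    fun j ↦ dualApp φ (hg.dual (ε.symm j)), ?_⟩
  have h1 : r.app V φ = resM _ hV s := congrArg (fun φ ↦ Scheme.Modules.Hom.app φ V _) hr
  rw [← h1]
  conv_lhs => rw [hg.eq_sum_evalAt φ]
  refine (map_sum (r.app V).hom _ _).trans ?_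
  refine (ε.symm.sum_comp _).symm.trans (Finset.sum_congr rfl fun j _ ↦ ?_)
  exact hr' V _ _

theorem HasCharts.toDual_naturality (hX : HasCharts p e X) (b : M ⟶ N)
    (s : Γ(frobPull p e M, U)) (C : Γ(cartier p e X, U)) :
    dualApp ((toDual p e N).app U (((Scheme.Modules.pullback (frob p e X)).map b).app U s)) C =
      b.app U (dualApp ((toDual p e M).app U s) C) := by
  refine resM_ext N fun x hx ↦ ?_
  obtain ⟨V, hV, hxV, k, a, n, h⟩ := hX.exists_eq_sum_frobSec s x hx
  refine ⟨V, hV, hxV, ?_⟩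
  rw [resM_dualApp, ← app_resM, ← app_resM, ← app_resM, resM_dualApp, ← app_resM, h,
    toDual_app_sum]
  have h1 : ((Scheme.Modules.pullback (frob p e X)).map b).app V (∑ j, a j • frobSec p e (n j)) =
      ∑ j, a j • frobSec p e (b.app V (n j)) := by
    refine (map_sum (((Scheme.Modules.pullback (frob p e X)).map b).app V).hom _ _).trans
      (Finset.sum_congr rfl fun j _ ↦ ?_)
    refine (Scheme.Modules.Hom.app_smul _ _ _).trans ?_
    exact congrArg (a j • ·) (pullback_map_app_frobSec b (n j))
  rw [h1, toDual_app_sum, dualApp_sum, dualApp_sum]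
  refine Eq.trans ?_ (map_sum (b.app V).hom _ _).symm
  refine Finset.sum_congr rfl fun j _ ↦ ?_
  rw [dualApp_evalAt, dualApp_evalAt]
  exact (Scheme.Modules.Hom.app_smul b _ _).symm

end

/-! ### Dual generators of `ω` and of its negative power -/

section

variable {p : ℕ} [Fact p.Prime] {e : ℕ} {X : Scheme.{u}} [IsFpScheme p X] {U : X.Opens}
  {M N : X.Modules} {Φ : negPow (omega X) (p ^ e - 1) ≅ cartier p e X}

/-- The section `w` generates `ω` and `δ` is the dual generator of `ω ^ ⊗(-k)`. -/
structure IsDualGen {k : ℕ} (w : Γ(omega X, U)) (δ : Γ(negPow (omega X) k, U)) : Prop where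
  isGen : IsGen w
  eval_eq_one : evalNeg δ (secPow w k) = 1

namespace IsDualGen

theorem res {k : ℕ} {w : Γ(omega X, U)} {δ : Γ(negPow (omega X) k, U)} (h : IsDualGen w δ)
    {V : X.Opens} (hV : V ≤ U) : IsDualGen (resM _ hV w) (resM _ hV δ) :=
  ⟨h.isGen.res hV, by rw [← resM_secPow, ← resO_evalNeg, h.eval_eq_one, map_one]⟩

theorem eq_smul {k : ℕ} {w : Γ(omega X, U)} {δ : Γ(negPow (omega X) k, U)} (h : IsDualGen w δ)
    (δ' : Γ(negPow (omega X) k, U)) : δ' = evalNeg δ' (secPow w k) • δ :=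
  negPow_ext (h.isGen.secPow k) (by rw [evalNeg_smul_left, h.eval_eq_one, mul_one])

variable {w : Γ(omega X, U)} {δ : Γ(negPow (omega X) (p ^ e - 1), U)}

theorem exists_eq_smul (h : IsDualGen w δ) (C : Γ(cartier p e X, U)) :
    ∃ b : Γ(X, U), C = b • Φ.hom.app U δ := by
  refine ⟨evalNeg (Φ.inv.app U C) (secPow w _), ?_⟩
  have h1 : Φ.hom.app U (Φ.inv.app U C) = C :=
    congrArg (fun φ ↦ Scheme.Modules.Hom.app φ U C) Φ.inv_hom_id
  conv_lhs => rw [← h1, h.eq_smul (Φ.inv.app U C)]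
  exact Scheme.Modules.Hom.app_smul _ _ _

theorem smul_injective (h : IsDualGen w δ) {a b : Γ(X, U)}
    (hab : a • Φ.hom.app U δ = b • Φ.hom.app U δ) : a = b := by
  have h1 (δ' : Γ(negPow (omega X) (p ^ e - 1), U)) : Φ.inv.app U (Φ.hom.app U δ') = δ' :=
    congrArg (fun φ ↦ Scheme.Modules.Hom.app φ U δ') Φ.hom_inv_id
  rw [← Scheme.Modules.Hom.app_smul, ← Scheme.Modules.Hom.app_smul] at hab
  have h2 := congrArg (Φ.inv.app U) hab
  rw [h1, h1] at h2
  have h3 := congrArg (fun δ' ↦ evalNeg δ' (secPow w (p ^ e - 1))) h2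
  simpa only [evalNeg_smul_left, h.eval_eq_one, mul_one] using h3

/-- Comparison of an arbitrary pair of sections with a pair of dual generators. -/
theorem tmul_dualApp (h : IsDualGen w δ) (φ : Γ(cartierDual p e N, U)) (v : Γ(X, U))
    (δ' : Γ(negPow (omega X) (p ^ e - 1), U)) :
    tmul (dualApp φ (Φ.hom.app U δ')) (v • w) = tmul (dualApp
      ((evalNeg δ' (secPow (v • w) (p ^ e - 1)) * v) • φ) (Φ.hom.app U δ)) w := by
  have hpos : 0 < p ^ e := pow_pos (Fact.out : p.Prime).pos e
  -- The factor `v` of the generator enters the argument of `φ` as `v ^ q`, which matches `v * v ^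
  -- (q-1)` on the other side.
  rw [secPow_smul, evalNeg_smul, tmul_smul, ← smul_tmul, ← dualApp_pow_smul, dualApp_smul]
  conv_lhs => rw [h.eq_smul δ', Scheme.Modules.Hom.app_smul, smul_smul]
  congr 3
  rw [mul_right_comm, ← pow_succ, Nat.sub_add_cancel hpos]

end IsDualGen

theorem HasCharts.exists_isDualGen (he : 0 < e) (hX : HasCharts p e X) {x : X} (hx : x ∈ U) :
    ∃ (V : X.Opens) (_ : V ≤ U) (_ : x ∈ V) (n : ℕ) (g : Fin n → Γ(X, V)) (w : Γ(omega X, V))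
      (δ : Γ(negPow (omega X) (p ^ e - 1), V)), IsChart (p ^ e) g ∧ IsDualGen w δ := by
  obtain ⟨V, hV, hxV, n, g, hg⟩ := hX.exists_le hx
  have hw := hg.isGen_formOf he (hg.rankAt_eq he)
  obtain ⟨δ, hδ⟩ := exists_evalNeg_eq (hw.secPow (p ^ e - 1)) 1
  exact ⟨V, hV, hxV, n, g, _, δ, hg, hw, hδ⟩

/-! ### The correspondence of morphisms -/

variable (p e) in
/-- The module `F_{q*}(M ⊗ ω)`. -/
abbrev pushTwist (M : X.Modules) : X.Modules :=
  (Scheme.Modules.pushforward (frob p e X)).obj ((tensorBy (omega X)).obj M)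

/-- The value of a morphism `F_{q*}(M ⊗ ω) ⟶ N` at a section of `M ⊗ ω`. -/
def twistApp (C : pushTwist p e M ⟶ N) (z : Γ((tensorBy (omega X)).obj M, U)) : Γ(N, U) :=
  C.app U (show Γ(pushTwist p e M, U) from z)

theorem twistApp_add (C : pushTwist p e M ⟶ N) (z z' : Γ((tensorBy (omega X)).obj M, U)) :
    twistApp C (z + z') = twistApp C z + twistApp C z' := map_add (C.app U).hom z z'

theorem twistApp_sum {ι : Type*} (s : Finset ι) (C : pushTwist p e M ⟶ N)
    (z : ι → Γ((tensorBy (omega X)).obj M, U)) :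
    twistApp C (∑ i ∈ s, z i) = ∑ i ∈ s, twistApp C (z i) := map_sum (C.app U).hom _ _

theorem twistApp_pow_smul (C : pushTwist p e M ⟶ N) (a : Γ(X, U))
    (z : Γ((tensorBy (omega X)).obj M, U)) : twistApp C (a ^ p ^ e • z) = a • twistApp C z :=
  Scheme.Modules.Hom.app_smul C a z

theorem resM_twistApp {V : X.Opens} (hV : V ≤ U) (C : pushTwist p e M ⟶ N)
    (z : Γ((tensorBy (omega X)).obj M, U)) :
    resM N hV (twistApp C z) = twistApp C (resM _ hV z) :=
  (app_resM C hV z).symm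

/-- The section of `cartierDual` defined by the image of a section of `M` in `F_q^* N`. -/
def dualOf (θ : M ⟶ frobPull p e N) (m : Γ(M, U)) : Γ(cartierDual p e N, U) :=
  (toDual p e N).app U (θ.app U m)

theorem dualOf_add (θ : M ⟶ frobPull p e N) (m m' : Γ(M, U)) :
    dualOf θ (m + m') = dualOf θ m + dualOf θ m' := by
  rw [dualOf, map_add, map_add]; rfl

theorem dualOf_smul (θ : M ⟶ frobPull p e N) (a : Γ(X, U)) (m : Γ(M, U)) :
    dualOf θ (a • m) = a • dualOf θ m := by
  rw [dualOf, Scheme.Modules.Hom.app_smul, Scheme.Modules.Hom.app_smul]; rfl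

theorem resM_dualOf {V : X.Opens} (hV : V ≤ U) (θ : M ⟶ frobPull p e N) (m : Γ(M, U)) :
    resM _ hV (dualOf θ m) = dualOf θ (resM M hV m) := by
  rw [dualOf, dualOf, app_resM, app_resM]

/-- The morphism `C : F_{q*}(M ⊗ ω) ⟶ N ⊗ ω` corresponds to `θ : M ⟶ F_q^* N`. -/
def Corresponds (Φ : negPow (omega X) (p ^ e - 1) ≅ cartier p e X)
    (C : pushTwist p e M ⟶ (tensorBy (omega X)).obj N) (θ : M ⟶ frobPull p e N) : Prop :=
  ∀ (U : X.Opens) (m : Γ(M, U)) (w : Γ(omega X, U)) (δ : Γ(negPow (omega X) (p ^ e - 1), U)),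
    IsDualGen w δ → twistApp C (tmul m w) = tmul (dualApp (dualOf θ m) (Φ.hom.app U δ)) w

variable {C C' : pushTwist p e M ⟶ (tensorBy (omega X)).obj N} {θ θ' : M ⟶ frobPull p e N}

/-- Locally `w = v • w₀` with `w₀` a generator, and `IsDualGen.tmul_dualApp` reduces the formula to
the dual pair of `w₀`. -/
theorem Corresponds.twistApp_tmul (he : 0 < e) (hX : HasCharts p e X) (h : Corresponds Φ C θ)
    (m : Γ(M, U)) (w : Γ(omega X, U)) (δ : Γ(negPow (omega X) (p ^ e - 1), U)) :
    twistApp C (tmul m (evalNeg δ (secPow w (p ^ e - 1)) • w)) =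
      tmul (dualApp (dualOf θ m) (Φ.hom.app U δ)) w := by
  refine resM_ext _ fun x hx ↦ ?_
  obtain ⟨V, hV, hxV, -, -, w₀, δ₀, -, h₀⟩ := hX.exists_isDualGen he hx
  refine ⟨V, hV, hxV, ?_⟩
  obtain ⟨v, hv, -⟩ := h₀.isGen.existsUnique (resM _ hV w)
  rw [resM_twistApp, resM_tmul, resM_tmul, resM_smul, resO_evalNeg, resM_secPow, resM_dualApp,
    resM_dualOf, ← app_resM, hv, h₀.tmul_dualApp, ← dualOf_smul, smul_smul, tmul_smul,
    ← smul_tmul]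
  exact h V _ _ _ h₀

/-- Where `w` generates `ω`, every section of `M ⊗ ω` is of the form `m ⊗ w`. -/
theorem Corresponds.unique_left (he : 0 < e) (hX : HasCharts p e X) (h : Corresponds Φ C θ)
    (h' : Corresponds Φ C' θ) : C = C' := by
  refine hom_ext_of_local fun V z x hx ↦ ?_
  obtain ⟨W, hW, hxW, -, -, w, δ, -, hw⟩ := hX.exists_isDualGen he hx
  refine ⟨W, hW, hxW, ?_⟩
  obtain ⟨m, hm⟩ := hw.isGen.bijective_tmul.2
    (show Γ((tensorBy (omega X)).obj M, W) from resM (pushTwist p e M) hW z)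
  have h1 : twistApp C (tmul m w) = twistApp C' (tmul m w) := by
    rw [h W m w δ hw, h' W m w δ hw]
  have h2 (C : pushTwist p e M ⟶ (tensorBy (omega X)).obj N) :
      C.app W (resM (pushTwist p e M) hW z) = twistApp C (tmul m w) :=
    congrArg (twistApp C) hm.symm
  rw [h2, h2, h1]

/-- Every local section of the Cartier module is `b • Φ(δ)`, and `b` can be moved onto `m`; so all
values of the image of `θ(m)` in `cartierDual` are known. -/
theorem Corresponds.unique_right (he : 0 < e) (hX : HasCharts p e X) (h : Corresponds Φ C θ)
    (h' : Corresponds Φ C θ') : θ = θ' := by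
  refine hom_ext_of_local fun V m x hx ↦ ?_
  obtain ⟨W, hW, hxW, -, -, w, δ, -, hw⟩ := hX.exists_isDualGen he hx
  refine ⟨W, hW, hxW, hX.toDual_injective (cartierDual_ext fun T hT D ↦ ?_)⟩
  have hT' := hw.res hT
  obtain ⟨b, rfl⟩ := hT'.exists_eq_smul (Φ := Φ) D
  refine hT'.isGen.bijective_tmul.1 ?_
  change tmul (dualApp (resM _ hT (dualOf θ _)) _) _ = tmul (dualApp (resM _ hT (dualOf θ' _)) _) _
  rw [resM_dualOf, resM_dualOf, ← dualApp_smul, ← dualApp_smul, ← dualOf_smul, ← dualOf_smul,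
    ← h T _ _ _ hT', ← h' T _ _ _ hT']

theorem HasCharts.exists_corresponds_left (he : 0 < e) (hX : HasCharts p e X)
    (Φ : negPow (omega X) (p ^ e - 1) ≅ cartier p e X) (θ : M ⟶ frobPull p e N) :
    ∃ C, Corresponds Φ C θ := by
  -- The relation ranges over all dual pairs and all representations `m ⊗ w`, so that it is visibly
  -- local and free of choices.
  let S (V : X.Opens) (z : Γ((tensorBy (omega X)).obj M, V))
      (t : Γ((tensorBy (omega X)).obj N, V)) : Prop :=
    ∀ (W : X.Opens) (hW : W ≤ V) (w : Γ(omega X, W)) (δ : Γ(negPow (omega X) (p ^ e - 1), W))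
      (_ : IsDualGen w δ) (m : Γ(M, W)), resM _ hW z = tmul m w →
        resM _ hW t = tmul (dualApp (dualOf θ m) (Φ.hom.app W δ)) w
  have hloc (V : X.Opens) (z : Γ((tensorBy (omega X)).obj M, V)) (x) (hx : x ∈ V) :
      ∃ (W : X.Opens) (hW : W ≤ V), x ∈ W ∧ ∃ (m : Γ(M, W)) (w : Γ(omega X, W))
        (δ : Γ(negPow (omega X) (p ^ e - 1), W)), IsDualGen w δ ∧ resM _ hW z = tmul m w := by
    obtain ⟨W, hW, hxW, -, -, w, δ, -, hw⟩ := hX.exists_isDualGen he hx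
    obtain ⟨m, hm⟩ := hw.isGen.bijective_tmul.2 (resM _ hW z)
    exact ⟨W, hW, hxW, m, w, δ, hw, hm.symm⟩
  -- One dual pair suffices: another generator is `v • w`, and the normalization of its dual makes
  -- the extra factor equal to one.
  have hS {V : X.Opens} {m : Γ(M, V)} {w : Γ(omega X, V)}
      {δ : Γ(negPow (omega X) (p ^ e - 1), V)} (hw : IsDualGen w δ) :
      S V (tmul m w) (tmul (dualApp (dualOf θ m) (Φ.hom.app V δ)) w) := by
    intro W hW w' δ' hw' m' hm'
    obtain ⟨v, rfl, -⟩ := (hw.res hW).isGen.existsUnique w'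
    rw [resM_tmul, tmul_smul, ← smul_tmul] at hm'
    have hm := (hw.res hW).isGen.bijective_tmul.1 hm'
    rw [resM_tmul, (hw.res hW).tmul_dualApp, hw'.eval_eq_one, one_mul, ← dualOf_smul, ← hm,
      resM_dualApp, resM_dualOf, app_resM]
  obtain ⟨C, hC⟩ := exists_hom_of_rel (M := pushTwist p e M) (N := (tensorBy (omega X)).obj N) S
    (fun V W hW z t h W' hW' w δ hw m hm ↦ by
      rw [resM_resM]
      exact h W' _ w δ hw m ((resM_resM _ hW hW' _).symm.trans hm))
    (fun V z t t' h h' ↦ resM_ext _ fun x hx ↦ by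
      obtain ⟨W, hW, hxW, m, w, δ, hw, hm⟩ := hloc V z x hx
      exact ⟨W, hW, hxW, (h W hW w δ hw m hm).trans (h' W hW w δ hw m hm).symm⟩)
    (fun V z x hx ↦ by
      obtain ⟨W, hW, hxW, m, w, δ, hw, hm⟩ := hloc V z x hx
      refine ⟨W, hW, hxW, tmul (dualApp (dualOf θ m) (Φ.hom.app W δ)) w, ?_⟩
      have := hS (m := m) hw
      rw [← hm] at this
      exact this)
    (fun V z z' t t' h h' W hW w δ hw m hm ↦ by
      obtain ⟨m₁, hm₁⟩ := hw.isGen.bijective_tmul.2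
        (resM ((tensorBy (omega X)).obj M) hW z)
      obtain ⟨m₂, hm₂⟩ := hw.isGen.bijective_tmul.2
        (resM ((tensorBy (omega X)).obj M) hW z')
      have hm₃ : m = m₁ + m₂ := by
        refine hw.isGen.bijective_tmul.1 (hm.symm.trans ?_)
        refine ((resM ((tensorBy (omega X)).obj M) hW).map_add z z').trans ?_
        exact (congrArg₂ (· + ·) hm₁ hm₂).symm.trans (add_tmul _ _ _).symm
      rw [map_add, h W hW w δ hw m₁ hm₁.symm, h' W hW w δ hw m₂ hm₂.symm, hm₃, dualOf_add,
        dualApp_add, add_tmul])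
    (fun V a z t h W hW w δ hw m hm ↦ by
      obtain ⟨m₁, hm₁⟩ := hw.isGen.bijective_tmul.2
        (resM ((tensorBy (omega X)).obj M) hW z)
      -- The scalar `a` acts on the pushforward through `a ^ q`.
      have hm₃ : m = resO hW a ^ p ^ e • m₁ := by
        refine hw.isGen.bijective_tmul.1 (hm.symm.trans ?_)
        refine (resM_smul ((tensorBy (omega X)).obj M) hW (a ^ p ^ e) z).trans ?_
        change _ = tmul (resO hW a ^ p ^ e • m₁) w
        rw [smul_tmul, map_pow]
        exact congrArg (resO hW a ^ p ^ e • ·) hm₁.symm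
      rw [resM_smul, h W hW w δ hw m₁ hm₁.symm, hm₃, dualOf_smul, dualApp_smul, dualApp_pow_smul,
        smul_tmul])
  exact ⟨C, fun V m w δ hw ↦ hC V _ _ (hS hw)⟩

theorem HasCharts.exists_corresponds_right (he : 0 < e) (hX : HasCharts p e X)
    (Φ : negPow (omega X) (p ^ e - 1) ≅ cartier p e X)
    (C : pushTwist p e M ⟶ (tensorBy (omega X)).obj N) : ∃ θ, Corresponds Φ C θ := by
  -- The multiplier `b` makes the condition prescribe the value at every section of the Cartier
  -- module, which determines `s`.
  let T (V : X.Opens) (m : Γ(M, V)) (s : Γ(frobPull p e N, V)) : Prop :=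
    ∀ (W : X.Opens) (hW : W ≤ V) (w : Γ(omega X, W)) (δ : Γ(negPow (omega X) (p ^ e - 1), W))
      (_ : IsDualGen w δ) (b : Γ(X, W)),
        tmul (dualApp ((toDual p e N).app W (resM _ hW s)) (b • Φ.hom.app W δ)) w =
          twistApp C (tmul (resM M hW m) (b • w))
  have hloc (V : X.Opens) (m : Γ(M, V)) (x) (hx : x ∈ V) :
      ∃ (W : X.Opens) (hW : W ≤ V), x ∈ W ∧ ∃ s, T W (resM M hW m) s := by
    obtain ⟨W, hW, hxW, d, g, w, δ, hg, hw⟩ := hX.exists_isDualGen he hx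
    -- Writing the dual basis as `b_I • Φ(δ)`, the values sought are `n_I` with `n_I ⊗ w = C(m ⊗ b_I
    -- w)`, and `∑ g ^ I ⊗ n_I` is the required section.
    choose b hb using fun I ↦ hw.exists_eq_smul (Φ := Φ) (hg.dual I)
    choose n hn using fun I ↦ hw.isGen.bijective_tmul.2
      (twistApp C (tmul (resM M hW m) (b I • w)))
    let ε := Fintype.equivFin (Fin d → Fin (p ^ e))
    let s : Γ(frobPull p e N, W) :=
      ∑ j, (∏ i, g i ^ (ε.symm j i : ℕ)) • frobSec p e (n (ε.symm j))
    have hs : (toDual p e N).app W s =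
        ∑ I : Fin d → Fin (p ^ e), evalAt p e (∏ i, g i ^ (I i : ℕ)) (n I) :=
      (toDual_app_sum _ _).trans (ε.symm.sum_comp
        fun I : Fin d → Fin (p ^ e) ↦ evalAt p e (∏ i, g i ^ (I i : ℕ)) (n I))
    refine ⟨W, hW, hxW, s, ?_⟩
    have key (T : X.Opens) (hT : T ≤ W) (a : Γ(X, T)) :
        tmul (dualApp ((toDual p e N).app T (resM _ hT s)) (a • Φ.hom.app T (resM _ hT δ)))
          (resM _ hT w) = twistApp C (tmul (resM M hT (resM M hW m)) (a • resM _ hT w)) := by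
      have hn' (I) := congrArg (resM _ hT) (hn I)
      simp only [resM_tmul, resM_twistApp, resM_smul] at hn'
      -- The dual basis expansion of `a • Φ(δ)`, read off in the generator `Φ(δ)`, expresses `a`
      -- through the `b_I` with `q`-th power coefficients, for which `C` is semilinear.
      have ha : a = ∑ I : Fin d → Fin (p ^ e), cartierApp (a • Φ.hom.app T (resM _ hT δ))
          (resO hT (∏ i, g i ^ (I i : ℕ))) ^ p ^ e * resO hT (b I) := by
        refine (hw.res hT).smul_injective (Φ := Φ) ?_
        conv_lhs => rw [hg.cartier_eq_sum hT (a • Φ.hom.app T (resM _ hT δ))]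
        rw [Finset.sum_smul]
        refine Finset.sum_congr rfl fun I _ ↦ ?_
        rw [mul_smul, app_resM, ← resM_smul, ← hb]
      rw [app_resM, hs, map_sum, dualApp_sum, sum_tmul]
      simp only [resM_evalAt, dualApp_evalAt, smul_tmul]
      conv_rhs => rw [ha, Finset.sum_smul]
      have h2 (m' : Γ(M, T)) (l : (Fin d → Fin (p ^ e)) → Γ(omega X, T)) :
          tmul m' (∑ I, l I) = ∑ I, tmul m' (l I) :=
        map_sum (AddMonoidHom.mk' (fun l : Γ(omega X, T) ↦ tmul m' l) (tmul_add m')) _ _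
      rw [h2, twistApp_sum]
      refine Finset.sum_congr rfl fun I _ ↦ ?_
      rw [mul_smul, tmul_smul, twistApp_pow_smul]
      exact congrArg (_ • ·) (hn' I)
    -- An arbitrary dual pair is compared with the chosen one, again by `IsDualGen.tmul_dualApp`.
    intro T hT w' δ' hw' a
    obtain ⟨v, rfl, -⟩ := (hw.res hT).isGen.existsUnique w'
    rw [← dualApp_smul, (hw.res hT).tmul_dualApp, hw'.eval_eq_one, one_mul, smul_smul, dualApp_smul,
      key, mul_comm, mul_smul]
  obtain ⟨θ, hθ⟩ := exists_hom_of_rel (M := M) (N := frobPull p e N) T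
    (fun V W hW m s h W' hW' w δ hw b ↦ by
      rw [resM_resM, resM_resM]; exact h W' _ w δ hw b)
    (fun V m s s' h h' ↦ resM_ext _ fun x hx ↦ by
      obtain ⟨W, hW, hxW, -, -, w, δ, -, hw⟩ := hX.exists_isDualGen he hx
      refine ⟨W, hW, hxW, hX.toDual_injective (cartierDual_ext fun W' hW' D ↦ ?_)⟩
      have hW'' := hw.res hW'
      obtain ⟨b, rfl⟩ := hW''.exists_eq_smul (Φ := Φ) D
      refine hW''.isGen.bijective_tmul.1 ?_
      change tmul _ _ = tmul _ _
      rw [← app_resM, ← app_resM, resM_resM, resM_resM, h W' _ _ _ hW'' b, h' W' _ _ _ hW'' b])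
    hloc
    (fun V m m' s s' h h' W hW w δ hw b ↦ by
      rw [map_add, map_add, map_add, dualApp_add, add_tmul, add_tmul, twistApp_add,
        h W hW w δ hw b, h' W hW w δ hw b])
    (fun V a m s h W hW w δ hw b ↦ by
      rw [resM_smul, resM_smul, Scheme.Modules.Hom.app_smul, dualApp_smul, smul_smul,
        h W hW w δ hw, smul_tmul, mul_smul, tmul_smul])
  refine ⟨θ, fun V m w δ hw ↦ resM_ext _ fun x hx ↦ ?_⟩
  obtain ⟨W, hW, hxW, s, hs⟩ := hloc V m x hx
  refine ⟨W, hW, hxW, ?_⟩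
  have h := hs W le_rfl _ _ (hw.res hW) 1
  rw [one_smul, one_smul, resM_self, resM_self, ← hθ _ _ _ hs] at h
  rw [resM_twistApp, resM_tmul, resM_tmul, resM_dualApp, resM_dualOf, ← app_resM]
  exact h.symm

end

/-! ### Naturality and assembly of the bijections. -/

section

variable {p : ℕ} [Fact p.Prime] {e : ℕ} {X : Scheme.{u}} [IsFpScheme p X] {U : X.Opens}
  {M N M' N' : X.Modules} {Φ : negPow (omega X) (p ^ e - 1) ≅ cartier p e X}
  {C : pushTwist p e M ⟶ (tensorBy (omega X)).obj N} {θ : M ⟶ frobPull p e N}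

theorem Corresponds.comp (hX : HasCharts p e X) (h : Corresponds Φ C θ) (a : M' ⟶ M)
    (b : N ⟶ N') : Corresponds Φ
      ((Scheme.Modules.pushforward (frob p e X)).map ((tensorBy (omega X)).map a) ≫ C ≫
        (tensorBy (omega X)).map b)
      (a ≫ θ ≫ (Scheme.Modules.pullback (frob p e X)).map b) := by
  intro U m w δ hw
  have h1 : twistApp ((Scheme.Modules.pushforward (frob p e X)).map ((tensorBy (omega X)).map a) ≫
      C ≫ (tensorBy (omega X)).map b) (tmul m w) = ((tensorBy (omega X)).map b).app U
        (twistApp C (((tensorBy (omega X)).map a).app U (tmul m w))) := rfl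
  have h2 := hX.toDual_naturality b (θ.app U (a.app U m)) (Φ.hom.app U δ)
  rw [h1, tensorBy_map_app_tmul, h U _ w δ hw, tensorBy_map_app_tmul]
  exact congrArg (fun n : Γ(N', U) ↦ tmul n w) h2.symm

/-- `Corresponds` is the graph of a bijection, and its uniqueness gives naturality. Any family
induced by `Φ` satisfies `Corresponds`, because sections of the pullback are locally sums of
tensors; hence it is the same family. -/
theorem HasCharts.exists_homBijections (he : 0 < e) (hX : HasCharts p e X)
    (Φ : negPow (omega X) (p ^ e - 1) ≅ cartier p e X) :
    ∃ B : HomBijections p e X, B.IsNatural ∧ B.IsInducedBy Φ ∧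
      ∀ B' : HomBijections p e X, B'.IsInducedBy Φ → B' = B := by
  choose f hf using fun (M N : X.Modules) (C : pushTwist p e M ⟶ (tensorBy (omega X)).obj N) ↦
    hX.exists_corresponds_right he Φ C
  have hbij (M N : X.Modules) : Function.Bijective (f M N) := by
    refine ⟨fun C C' h ↦ ?_, fun θ ↦ ?_⟩
    · have h1 := hf M N C
      rw [h] at h1
      exact h1.unique_left he hX (hf M N C')
    · obtain ⟨C, hC⟩ := hX.exists_corresponds_left he Φ θ
      exact ⟨C, (hf M N C).unique_right he hX hC⟩
  refine ⟨fun M N ↦ Equiv.ofBijective _ (hbij M N), fun M M' N N' a b C ↦ ?_,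
    fun M N C U m k a n h w δ ↦ ?_, fun B' hB' ↦ ?_⟩
  · exact (hf M' N' _).unique_right he hX ((hf M N C).comp hX a b)
  · have h1 : dualOf (f M N C) m = ∑ j, evalAt p e (a j) (n j) :=
      (congrArg ((toDual p e N).app U) h).trans (toDual_app_sum a n)
    refine ((hf M N C).twistApp_tmul he hX m w δ).trans ?_
    rw [h1, dualApp_sum, sum_tmul]
    refine Finset.sum_congr rfl fun j _ ↦ ?_
    rw [dualApp_evalAt, smul_tmul, ← tmul_smul]
  · funext M N
    refine Equiv.ext fun C ↦ ?_
    have h1 : Corresponds Φ C (B' M N C) := by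
      intro U m w δ hw
      refine resM_ext _ fun x hx ↦ ?_
      obtain ⟨V, hV, hxV, k, a, n, h⟩ := hX.exists_eq_sum_frobSec ((B' M N C).app U m) x hx
      refine ⟨V, hV, hxV, ?_⟩
      rw [← app_resM] at h
      have hw' := hw.res hV
      have h2 := hB' M N C V (resM M hV m) k a n h (resM _ hV w) (resM _ hV δ)
      -- For a dual pair the factor `δ(w ^ ⊗(q-1))` is one, so the induced formula becomes the
      -- defining condition of `Corresponds`.
      rw [hw'.eval_eq_one, one_smul] at h2
      have h3 : dualOf (B' M N C) (resM M hV m) = ∑ j, evalAt p e (a j) (n j) :=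
        (congrArg ((toDual p e N).app V) h).trans (toDual_app_sum a n)
      rw [resM_twistApp, resM_tmul, resM_tmul, resM_dualApp, resM_dualOf, ← app_resM, h3,
        dualApp_sum, sum_tmul]
      refine Eq.trans h2 (Finset.sum_congr rfl fun j _ ↦ ?_)
      rw [dualApp_evalAt, smul_tmul, ← tmul_smul]
    exact h1.unique_right he hX (hf M N C)

end

end FrobTwist

end

open FrobTwist
theorem propositionA3 (p : ℕ) [Fact p.Prime] (e : ℕ) (he : 0 < e)
    (X : Scheme.{u}) [IsFpScheme p X] [IsNoetherian X]
    (hreg : ∀ x : X, IsRegularLocalRing (X.presheaf.stalk x))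
    (hfin : IsFinite (frob p 1 X)) :
    ∃ Φ : negPow (omega X) (p ^ e - 1) ≅ cartier p e X,
      IsCanonicalIso Φ ∧
      (∀ Ψ : negPow (omega X) (p ^ e - 1) ≅ cartier p e X, IsCanonicalIso Ψ → Ψ = Φ) ∧
      ∃ B : HomBijections p e X,
        B.IsNatural ∧ B.IsInducedBy Φ ∧
        ∀ B' : HomBijections p e X, B'.IsInducedBy Φ → B' = B := by
  have hX : HasCharts p e X := fun x ↦ exists_isChart p e X hreg hfin x
  obtain ⟨Φ, h1, h2⟩ := hX.exists_canonicalIso he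
  exact ⟨Φ, h1, h2, hX.exists_homBijections he Φ⟩
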